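/- Let $\mathcal P_\bullet=(\mathcal P_m)_{m\ge 0}$ be an (unshaded) factor planar algebra, i.e. a planar $*$-algebra with finite-dimensional box spaces, $\mathcal P_0\cong\mathbb C$ (the empty diagram corresponding to $1$), which is spherical and whose forms $\langle x,y\rangle$, joining all strings of $x^*$ and $y$, are positive definite; let its loop value satisfy $\delta>1$. Let $\Gamma$ be its principal graph: the vertices are the equivalence classes of minimal projections in the algebras $\mathcal P_{k,k}=\mathcal P_{2k}$, $k\ge 0$, and $[p]$, $[q]$ (with $p\in\mathcal P_{k,k}$, $q\in\mathcal P_{l,l}$) are joined by $\dim (p\otimes 1)\mathcal P_{k+1,l}\,q$ edges. The depth of $\mathcal P_\bullet$ is the supremum of the distances in $\Gamma$ from the class $\star$ of the empty diagram. For $k\ge 0$ let $\mathrm{Gr}_k=\bigoplus_{m\ge 0}\mathcal P_{2k+m}$, an element of the $m$-th summand being drawn with $k$ strings on the left, $m$ on top and $k$ on the right, with the graded multiplication $x\wedge_k y$ (join the right strings of $x$ to the left strings of $y$ and juxtapose the top strings) and the normalized Voiculescu trace $\tau_k$ ($\delta^{-k}$ times the closed diagram obtained by capping off the top strings with the sum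 of all Temperley–Lieb diagrams and joining the left strings to the right strings). Let $\mathcal A_k$ be the unital $C^*$-algebra generated by the left action of $\mathrm{Gr}_k$ on $L^2(\mathrm{Gr}_k,\tau_k)$. Suppose that $\mathcal P_\bullet$ has finite depth $n$ with $n\ge 1$. Then for every $k\ge n-1$ the $C^*$-algebras $\mathcal A_{n-1}$ and $\mathcal A_k$ are strongly Morita equivalent, i.e. there is a separable $C^*$-algebra $C$ such that $\mathcal A_{n-1}$ and $\mathcal A_k$ are both isomorphic to full hereditary $C^*$-subalgebras of $C$ (a $C^*$-subalgebra $A\subseteq C$ is full if the linear span of $CAC$ is dense in $C$, and hereditary if $a\in A$ and $0\le c\le a$ imply $c\in A$). -/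

import Mathlib

universe u

/-- An (unshaded) planar `*`-algebra, with the planar operad given by elementary tangles and
planar isotopies.

Every box is drawn with all of its strings leaving through the top, numbered `0, 1, 2, …` from left
to right, and with the distinguished interval at the bottom (so this is the clockwise order of the
marked points starting at the distinguished interval). Read from bottom to top, every planar tangle
is isotopic to a vertical stack of layers, each of which inserts a labelled box or a cup into a gap
between the strings that are present, or joins two neighbouring strings by a cap. Accordingly, the
action of the planar operad on the box spaces `V n` is generated by the actions of the tangles

* `empty`: the empty diagram in `V 0`;
* `cup`: the single string in `V 2`;
* `ins i v x`: the box `x` placed in gap `i` of `v` (with `i` strings of `v` to its left and the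
  others to its right), the bottom of `v` lying below `x`; for `i` equal to the number of
  strings of `v` this is juxtaposition of `v` and `x`;
* `cap i v`: strings `i` and `i + 1` of `v` joined.

Two stacks are isotopic precisely when they are related by the moves listed as axioms: layers that
do not interact may be interchanged, a zigzag may be straightened, and a box may be rotated by a
full turn. Finally `adj` is the conjugate-linear involution `*`, which is compatible with the
reflection of tangles. The dimension equations in `ins` and `cap` are arguments, so that the axioms
need no transport between box spaces. -/
structure PlanarAlgebra where
  /-- the box spaces -/
  V : ℕ → Type u
  [addCommGroup : ∀ n, AddCommGroup (V n)]
  [module : ∀ n, Module ℂ (V n)]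
  /-- the empty diagram -/
  empty : V 0
  /-- the diagram with one string -/
  cup : V 2
  /-- insertion of a box into gap `i` -/
  ins {m k n : ℕ} (i : ℕ) (hi : i ≤ m) (hn : n = m + k) : V m →ₗ[ℂ] V k →ₗ[ℂ] V n
  /-- joining strings `i` and `i + 1` -/
  cap {m n : ℕ} (i : ℕ) (hi : i ≤ n) (hm : m = n + 2) : V m →ₗ[ℂ] V n
  /-- the involution -/
  adj (n : ℕ) : V n →ₛₗ[starRingEnd ℂ] V n
  /-- placing a box into the empty diagram -/
  empty_ins : ∀ {k : ℕ} (x : V k), ins 0 le_rfl (Nat.zero_add k).symm empty x = x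
  /-- inserting the empty diagram -/
  ins_empty : ∀ {m : ℕ} (i : ℕ) (hi : i ≤ m) (v : V m), ins i hi (Nat.add_zero m).symm v empty = v
  /-- inserting `y` into a gap of `x`, and `x` into a gap of `v` -/
  ins_nested : ∀ {m k l p q r : ℕ} (i j : ℕ) (hi : i ≤ m) (hj : j ≤ k) (hp : p = m + k)
    (hq : q = k + l) (hr : r = m + k + l) (v : V m) (x : V k) (y : V l),
    ins (i + j) (by omega) (by omega) (ins i hi hp v x) y
      = (ins i hi (by omega) v (ins j hj hq x y) : V r)
  /-- inserting `x` and `y` into `v`, with `x` to the left of `y` -/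
  ins_comm : ∀ {m k l p q r : ℕ} (i j : ℕ) (hij : i ≤ j) (hj : j ≤ m) (hp : p = m + l)
    (hq : q = m + k) (hr : r = m + k + l) (v : V m) (x : V k) (y : V l),
    ins i (by omega) (by omega) (ins j hj hp v y) x
      = (ins (j + k) (by omega) (by omega) (ins i (by omega) hq v x) y : V r)
  /-- two caps side by side -/
  cap_cap : ∀ {m p n : ℕ} (i j : ℕ) (hij : i ≤ j) (hj : j ≤ n) (hp : p = n + 2) (hm : m = n + 4)
    (v : V m),
    cap i (by omega) hp (cap (j + 2) (by omega) (by omega) v)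
      = cap j hj hp (cap i (by omega) (by omega : m = p + 2) v)
  /-- a cap to the left of an inserted box -/
  cap_ins_left : ∀ {m m' k p n : ℕ} (j i : ℕ) (hji : j ≤ i) (hi : i ≤ m') (hm : m = m' + 2)
    (hp : p = m + k) (hn : n = m' + k) (v : V m) (x : V k),
    cap j (by omega) (by omega) (ins (i + 2) (by omega) hp v x)
      = ins i hi hn (cap j (by omega) hm v) x
  /-- a cap to the right of an inserted box -/
  cap_ins_right : ∀ {m m' k p n : ℕ} (i j : ℕ) (hij : i ≤ j) (hj : j ≤ m') (hm : m = m' + 2)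
    (hp : p = m + k) (hn : n = m' + k) (v : V m) (x : V k),
    cap (j + k) (by omega) (by omega) (ins i (by omega) hp v x)
      = ins i (by omega) hn (cap j hj hm v) x
  /-- a cap on an inserted box -/
  cap_ins_mid : ∀ {m k k' p n : ℕ} (i j : ℕ) (hi : i ≤ m) (hj : j ≤ k') (hk : k = k' + 2)
    (hp : p = m + k) (hn : n = m + k') (v : V m) (x : V k),
    cap (i + j) (by omega) (by omega) (ins i hi hp v x)
      = ins i hi hn v (cap j hj hk x)
  /-- straightening a zigzag -/
  zigzag_left : ∀ {m p : ℕ} (i : ℕ) (hi : i < m) (hp : p = m + 2) (v : V m),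
    cap (i + 1) (by omega) hp (ins i hi.le hp v cup) = v
  /-- straightening a zigzag -/
  zigzag_right : ∀ {m p : ℕ} (i : ℕ) (hi : i < m) (hp : p = m + 2) (v : V m),
    cap i hi.le hp (ins (i + 1) hi hp v cup) = v
  /-- turning a box with `n` strings by one click `n` times does nothing; one click bends the first
  string below the box to the last position -/
  rotate_full : ∀ (n : ℕ) (x : V n),
    (fun y : V n => cap 0 n.zero_le (Nat.add_comm 2 n) (ins 1 one_le_two rfl cup y))^[n] x = x
  /-- `*` is an involution -/
  adj_adj : ∀ {n : ℕ} (x : V n), adj n (adj n x) = x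
  /-- `*` and reflection of the empty diagram -/
  adj_empty : adj 0 empty = empty
  /-- `*` and reflection of the cup -/
  adj_cup : adj 2 cup = cup
  /-- `*` and reflection of an insertion -/
  adj_ins : ∀ {m k n : ℕ} (i i' : ℕ) (hi : i + i' = m) (hn : n = m + k) (v : V m) (x : V k),
    adj n (ins i (by omega) hn v x) = ins i' (by omega) hn (adj m v) (adj k x)
  /-- `*` and reflection of a cap -/
  adj_cap : ∀ {m n : ℕ} (i i' : ℕ) (hi : i + i' = n) (hm : m = n + 2) (v : V m),
    adj n (cap i (by omega) hm v) = cap i' (by omega) hm (adj m v)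

namespace PlanarAlgebra

attribute [instance] PlanarAlgebra.addCommGroup PlanarAlgebra.module

variable (P : PlanarAlgebra.{u})

/-- Identification of box spaces with equal indices. -/
def cast {m n : ℕ} (h : m = n) : P.V m →ₗ[ℂ] P.V n := h ▸ LinearMap.id

/-- Cap off the `2 * r` consecutive strings with positions `i, …, i + 2 * r - 1` by `r` nested
caps. -/
def nest : (r i : ℕ) → {m n : ℕ} → i ≤ n → m = n + 2 * r → P.V m →ₗ[ℂ] P.V n
  | 0, _, _, _, _, h => P.cast h
  | r + 1, i, _, n, hi, h =>
      nest r i hi (rfl : n + 2 * r = n + 2 * r) ∘ₗ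
        P.cap (i + r) (by omega) (by omega)

/-- The sum over all Temperley-Lieb diagrams capping off strings of an element of `V m`: there are
`s` strings at positions `a, …, a + s - 1`, followed by `N` strings. Scanning the latter from left to
right, each string is either left open (to be joined to a later one) or joined to the last string
that is still open; in the end all of the `N + s` strings have to be joined. For `s = 0`, these
sequences of decisions are the Dyck words, i.e. the non-crossing pairings of `N` points, so that
`tlCap N 0 a` is the action of the sum of all Temperley-Lieb diagrams on `N` points, placed on the
strings `a, …, a + N - 1`. -/
def tlCap : (N s a : ℕ) → {m n : ℕ} → a ≤ n → m = n + N + s → P.V m →ₗ[ℂ] P.V n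
  | 0, 0, _, _, _, _, h => P.cast h
  | 0, _ + 1, _, _, _, _, _ => 0
  | N + 1, 0, a, _, _, ha, h => tlCap N 1 a ha (by omega)
  | N + 1, s + 1, a, _, n, ha, h =>
      tlCap N (s + 2) a ha (by omega) +
        tlCap N s a ha (rfl : n + N + s = n + N + s) ∘ₗ P.cap (a + s) (by omega) (by omega)


/-- Put `x` and `y` side by side and join the last `r` strings of `x` to the first `r` strings of
`y` (nested). With `P_{l,r} = V (l + r)`, this is the composition `P_{a,r} × P_{r,b} → P_{a,b}`. -/
def contract (P : PlanarAlgebra.{u}) (r : ℕ) {a b m m' n : ℕ} (hx : m = a + r)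
    (hy : m' = r + b) (hn : n = a + b) :
    P.V m →ₗ[ℂ] P.V m' →ₗ[ℂ] P.V n :=
  (P.ins m le_rfl rfl).compr₂ (P.nest r a (by omega) (by omega))

/-- Rotation by one click. -/
def rot (P : PlanarAlgebra.{u}) {n : ℕ} (x : P.V n) : P.V n :=
  P.cap 0 n.zero_le (Nat.add_comm 2 n) (P.ins 1 one_le_two rfl P.cup x)

/-- The inclusion `P_{k,k} → P_{k+1,k+1}` which adds a through string below the box. -/
def addStrand (P : PlanarAlgebra.{u}) {k : ℕ} (x : P.V (k + k)) : P.V (k + 1 + (k + 1)) :=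
  P.ins 1 one_le_two (by omega) P.cup x

/-! Facts about sums over Temperley-Lieb diagrams, needed to see that the Voiculescu trace is
positive. -/

variable {P}

@[simp] theorem cast_rfl {m : ℕ} (h : m = m) (x : P.V m) : P.cast h x = x := rfl

theorem nest_zero {i m n : ℕ} (hi : i ≤ n) (h : m = n + 2 * 0) (x : P.V m) :
    P.nest 0 i hi h x = P.cast h x := rfl

theorem nest_succ {r i m p n : ℕ} (hi : i ≤ n) (h : m = n + 2 * (r + 1)) (hp : p = n + 2 * r)
    (x : P.V m) :
    P.nest (r + 1) i hi h x = P.nest r i hi hp (P.cap (i + r) (by omega) (by omega) x) := by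
  subst hp; rfl

theorem tlCap_succ_zero {N a m n : ℕ} (ha : a ≤ n) (h : m = n + (N + 1) + 0) (x : P.V m) :
    P.tlCap (N + 1) 0 a ha h x = P.tlCap N 1 a ha (by omega) x := rfl

theorem tlCap_succ_succ {N s a m p n : ℕ} (ha : a ≤ n) (h : m = n + (N + 1) + (s + 1))
    (hp : p = n + N + s) (x : P.V m) :
    P.tlCap (N + 1) (s + 1) a ha h x = P.tlCap N (s + 2) a ha (by omega) x +
      P.tlCap N s a ha hp (P.cap (a + s) (by omega) (by omega) x) := by
  subst hp; rfl

/-- Auxiliary: the scan in `tlCap` with `t` strings left open at the end; for `s = 0` this is the sum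
over all Temperley-Lieb diagrams from `N` to `t` points in which all of the `t` points are joined to
one of the `N` points. -/
def scanL : (N s t a : ℕ) → {q m n : ℕ} → a ≤ q → m = q + N + s → n = q + t → (P.V m →ₗ[ℂ] P.V n)
  | 0, s, t, _, _, _, _, _, h, h' =>
      if hst : s = t then P.cast (by omega) else 0
  | N + 1, 0, t, a, _, _, _, ha, h, h' => scanL N 1 t a ha (by omega) h'
  | N + 1, s + 1, t, a, q, _, _, ha, h, h' =>
      scanL N (s + 2) t a ha (by omega) h' +
        scanL N s t a ha (rfl : q + N + s = q + N + s) h' ∘ₗ P.cap (a + s) (by omega) (by omega)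

theorem scanL_succ_succ {N s t a q m p n : ℕ} (ha : a ≤ q) (h : m = q + (N + 1) + (s + 1))
    (h' : n = q + t) (hp : p = q + N + s) (x : P.V m) :
    scanL (N + 1) (s + 1) t a ha h h' x = scanL N (s + 2) t a ha (by omega) h' x +
      scanL N s t a ha hp h' (P.cap (a + s) (by omega) (by omega) x) := by
  subst hp; rfl

theorem scanL_succ_zero {N t a q m n : ℕ} (ha : a ≤ q) (h : m = q + (N + 1) + 0)
    (h' : n = q + t) (x : P.V m) :
    scanL (N + 1) 0 t a ha h h' x = scanL N 1 t a ha (by omega) h' x := rfl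

/-- Auxiliary: the mirror image of `scanL`, organised from right to left. -/
def scanR : (N t b : ℕ) → {q m n : ℕ} → b ≤ q → m = q + N → n = q + t → (P.V m →ₗ[ℂ] P.V n)
  | 0, 0, _, _, _, _, _, h, h' => P.cast (by omega)
  | 0, _ + 1, _, _, _, _, _, _, _ => 0
  | N + 1, 0, b, q, _, _, hb, h, h' =>
      P.cap b (by omega) (by omega) ∘ₗ
        scanR N 1 (b + 1) (by omega : b + 1 ≤ q + 1) (by omega) (rfl : q + 1 + 1 = q + 1 + 1)
  | N + 1, t + 1, b, q, _, _, hb, h, h' =>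
      scanR N t (b + 1) (by omega : b + 1 ≤ q + 1) (by omega) (by omega) +
      P.cap b (by omega) (by omega) ∘ₗ
        scanR N (t + 2) (b + 1) (by omega : b + 1 ≤ q + 1) (by omega)
          (rfl : q + 1 + (t + 2) = q + 1 + (t + 2))

theorem scanR_succ_zero {N b q m p n : ℕ} (hb : b ≤ q) (h : m = q + (N + 1)) (h' : n = q + 0)
    (hp : p = q + 2) (x : P.V m) :
    scanR (N + 1) 0 b hb h h' x = P.cap b (by omega) (by omega)
        (scanR N 1 (b + 1) (by omega : b + 1 ≤ q + 1) (by omega) (by omega) x : P.V p) := by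
  subst hp; rfl

theorem scanR_succ_succ {N t b q m p n : ℕ} (hb : b ≤ q) (h : m = q + (N + 1)) (h' : n = q + (t + 1))
    (hp : p = q + t + 3) (x : P.V m) :
    scanR (N + 1) (t + 1) b hb h h' x =
      scanR N t (b + 1) (by omega : b + 1 ≤ q + 1) (by omega) (by omega) x +
      P.cap b (by omega) (by omega)
        (scanR N (t + 2) (b + 1) (by omega : b + 1 ≤ q + 1) (by omega) (by omega) x : P.V p) := by
  obtain rfl : p = q + 1 + (t + 2) := by omega
  rfl

theorem cap_nest {c i r m p n n' : ℕ} (hc : c ≤ i) (hi : i ≤ n') (hn : n = n' + 2)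
    (hm : m = n + 2 * r) (hp : p = n' + 2 * r) (x : P.V m) :
    P.cap c (by omega) hn (P.nest r (i + 2) (by omega) hm x)
      = P.nest r i hi hp (P.cap c (by omega) (by omega) x) := by
  induction r generalizing m p with
  | zero =>
    obtain rfl : m = n := by omega
    obtain rfl : p = n' := by omega
    rfl
  | succ r ih =>
    rw [nest_succ (p := p) _ _ (by omega), nest_succ (p := n' + 2 * r) _ _ rfl,
      ih (m := p) (by omega) rfl,
      ← P.cap_cap (m := m) (p := p) (n := n' + 2 * r) c (i + r) (by omega) (by omega)
      (by omega) (by omega) x]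
    have e : i + 2 + r = i + r + 2 := by omega
    simp only [e]

theorem nest_add {r s i m p n : ℕ} (hi : i ≤ n) (hp : p = n + 2 * r) (hm : m = p + 2 * s)
    (x : P.V m) :
    P.nest r i hi hp (P.nest s (i + r) (by omega) hm x)
      = P.nest (r + s) i hi (by omega) x := by
  induction s generalizing m with
  | zero =>
    obtain rfl : m = p := by omega
    rfl
  | succ s ih =>
    rw [nest_succ (p := p + 2 * s) _ _ rfl, ih rfl]
    have := nest_succ (P := P) (r := r + s) (i := i) (m := m) (p := p + 2 * s) (n := n)
      hi (by omega) (by omega) x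
    simp only [Nat.add_assoc] at this ⊢
    exact this.symm

theorem cap_scanR {N t b c q q' m p n n' : ℕ} (hc : c ≤ b) (hb : b ≤ q) (hq : q' = q + 2)
    (h : m = q' + N) (hp : p = q + N) (h' : n = q' + t) (hn : n' = q + t) (x : P.V m) :
    P.cap c (by omega) (by omega) (scanR N t (b + 2) (by omega) h h' x : P.V n)
      = (scanR N t b hb hp hn (P.cap c (by omega) (by omega) x) : P.V n') := by
  induction N generalizing t b q q' m p n n' with
  | zero =>
    cases t with
    | zero =>
      obtain rfl : p = n' := by omega
      obtain rfl : m = n := by omega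
      obtain rfl : p = q := by omega
      obtain rfl : m = q' := by omega
      rfl
    | succ t => simp [scanR]
  | succ N ih =>
    cases t with
    | zero =>
      rw [scanR_succ_zero (p := q' + 2) _ _ _ rfl, scanR_succ_zero (p := n) _ _ _ (by omega),
        P.cap_cap c b hc (by omega) (by omega : n = n' + 2) (by omega)]
      congr 1
      exact ih (q := q + 1) (q' := q' + 1) (by omega) (by omega) (by omega) _ _ _ _ x
    | succ t =>
      rw [scanR_succ_succ (p := q' + t + 3) _ _ _ rfl, scanR_succ_succ (p := n) _ _ _ (by omega),
        map_add, P.cap_cap c b hc (by omega) (by omega : n = n' + 2) (by omega)]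
      congr 1
      · exact ih (q := q + 1) (q' := q' + 1) (by omega) (by omega) (by omega) _ _ _ _ x
      · congr 1
        exact ih (q := q + 1) (q' := q' + 1) (by omega) (by omega) (by omega) _ _ _ _ x

theorem tlCap_eq {N s a m p n : ℕ} (ha : a ≤ n) (h : m = n + N + s) (hp : p = n + s + s)
    (x : P.V m) :
    P.tlCap N s a ha h x
      = P.nest s a ha (by omega)
        (scanR N s (a + s) (by omega : a + s ≤ n + s) (by omega) hp x : P.V p) := by
  induction N generalizing s m p with
  | zero =>
    cases s with
    | zero =>
      obtain rfl : p = n := by omega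
      obtain rfl : m = p := by omega
      rfl
    | succ s => simp [scanR, tlCap]
  | succ N ih =>
    cases s with
    | zero =>
      rw [tlCap_succ_zero, ih (p := n + 2) _ rfl, nest_succ (p := n) _ _ rfl,
        scanR_succ_zero (p := n + 2) _ _ _ rfl]
      obtain rfl : p = n := by omega
      rfl
    | succ s =>
      rw [tlCap_succ_succ (p := n + N + s) _ _ rfl, ih (p := n + (s + 2) + (s + 2)) _ rfl,
        ih (p := n + s + s) _ rfl, scanR_succ_succ (p := n + (s + 2) + (s + 2)) _ _ _ (by omega),
        map_add, add_comm]
      congr 1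
      · rw [nest_succ (p := n + s + s) _ _ (by omega)]
        congr 1
        exact (cap_scanR (q := n + s) (q' := n + s + 2) (by omega) (by omega) (by omega) _ _ _ _ x).symm
      · rw [nest_succ (p := p) _ _ (by omega)]
        rfl

theorem scanL_last {N s t a q m n r : ℕ} (ha : a ≤ q) (h : m = q + (N + 1) + s) (h' : n = q + t)
    (hr : r = n + 2) (x : P.V m) :
    (scanL (N + 1) s t a ha h h' x : P.V n) =
      (if ht : 1 ≤ t then
        scanL N s (t - 1) a (by omega : a ≤ q + 1) (by omega) (by omega) x else 0) +
      P.cap (a + t) (by omega) hr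
        (scanL N s (t + 1) a (by omega : a ≤ q + 1) (by omega) (by omega) x : P.V r) := by
  induction N generalizing s m with
  | zero =>
    cases s with
    | zero =>
      rw [scanL_succ_zero]
      rcases t with _ | _ | t
      · simp [scanL]
      · simp [scanL]
      · simp [scanL]
    | succ s =>
      rw [scanL_succ_succ (p := q + s) _ _ _ (by omega)]
      rcases lt_trichotomy t s with hts | rfl | hts
      · have h1 : s + 2 ≠ t := by omega
        have h2 : s ≠ t := by omega
        have h3 : s + 1 ≠ t - 1 := by omega
        have h4 : s + 1 ≠ t + 1 := by omega
        simp [scanL, h1, h2, h3]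
      · have h1 : t + 2 ≠ t := by omega
        have h3 : t + 1 ≠ t - 1 := by omega
        obtain rfl : r = m := by omega
        obtain rfl : n = q + t := by omega
        simp [scanL, h3]
      · have h2 : s ≠ t := by omega
        have h4 : s + 1 ≠ t + 1 := by omega
        by_cases h1 : s + 2 = t
        · have h5 : 1 ≤ t := by omega
          have h3 : s + 1 = t - 1 := by omega
          simp [scanL, h1, h2, h3, h5]
        · have h3 : s + 1 ≠ t - 1 := by omega
          simp [scanL, h1, h2, h3]
  | succ N ih =>
    cases s with
    | zero =>
      rw [scanL_succ_zero, ih]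
      rfl
    | succ s =>
      rw [scanL_succ_succ (p := q + (N + 1) + s) _ _ _ rfl, ih, ih,
        scanL_succ_succ (p := q + (N + 1) + s) _ _ _ (by omega), map_add]
      split_ifs
      · rw [scanL_succ_succ (p := q + (N + 1) + s) _ _ _ (by omega)]
        abel
      · abel

theorem tlCap_split {N M R s a q m n : ℕ} (K : ℕ) (hK : N + s < K) (hR : R = N + M) (ha : a ≤ n)
    (hq : q = n + M) (h : m = n + R + s) (x : P.V m) :
    P.tlCap R s a ha h x = ∑ t ∈ Finset.range K, P.tlCap M t a ha (by omega)
        (scanL N s t a (by omega : a ≤ q) (by omega) rfl x : P.V (q + t)) := by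
  induction N generalizing R s m with
  | zero =>
    obtain rfl : R = M := by omega
    rw [Finset.sum_eq_single_of_mem s (by simp; omega)]
    · obtain rfl : m = q + s := by omega
      simp [scanL]
    · intro t _ hts
      simp [scanL, hts.symm]
  | succ N ih =>
    obtain ⟨R, rfl⟩ : ∃ R', R = R' + 1 := ⟨N + M, by omega⟩
    cases s with
    | zero => rw [tlCap_succ_zero, ih (by omega) (by omega)]; rfl
    | succ s =>
      rw [tlCap_succ_succ (p := n + R + s) _ _ rfl, ih (by omega) (by omega),
        ih (by omega) (by omega), ← Finset.sum_add_distrib]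
      refine Finset.sum_congr rfl fun t _ => ?_
      rw [scanL_succ_succ (p := n + R + s) _ _ _ (by omega), map_add]

theorem adj_scanR {N t b b' q m n : ℕ} (hb : b + b' = q) (h : m = q + N) (h' : n = q + t)
    (x : P.V m) :
    P.adj n (scanR N t b (by omega) h h' x) = scanL N 0 t b' (by omega) h h' (P.adj m x) := by
  induction N generalizing t b q n with
  | zero =>
    cases t with
    | zero =>
      obtain rfl : m = n := by omega
      rfl
    | succ t => simp [scanR, scanL]
  | succ N ih =>
    cases t with
    | zero =>
      rw [scanR_succ_zero (p := q + 2) _ _ _ rfl, scanL_last (r := q + 2) _ _ _ (by omega),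
        P.adj_cap b b' (by omega) (by omega),
        ih (q := q + 1) (b := b + 1) (by omega) (by omega) (by omega)]
      simp
    | succ t =>
      rw [scanR_succ_succ (p := q + t + 3) _ _ _ rfl,
        scanL_last (r := q + t + 3) _ _ _ (by omega), map_add,
        P.adj_cap b (b' + (t + 1)) (by omega) (by omega),
        ih (q := q + 1) (b := b + 1) (by omega) (by omega) (by omega),
        ih (q := q + 1) (b := b + 1) (by omega) (by omega) (by omega)]
      simp

theorem adj_nest {r i i' m n : ℕ} (hi : i + i' = n) (h : m = n + 2 * r) (x : P.V m) :
    P.adj n (P.nest r i (by omega) h x) = P.nest r i' (by omega) h (P.adj m x) := by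
  induction r generalizing m with
  | zero =>
    obtain rfl : m = n := by omega
    rfl
  | succ r ih =>
    rw [nest_succ (p := n + 2 * r) _ _ rfl, nest_succ (p := n + 2 * r) _ _ rfl, ih rfl,
      P.adj_cap (i + r) (i' + r) (by omega) (by omega)]

theorem scanL_nest {N s t a r i e q q' m n m' n' : ℕ} (ha : a ≤ i) (hi : i ≤ q)
    (he : e = i + N + s) (hq : q' = q + 2 * r)
    (h : m = q' + N + s) (h' : n = q' + t) (hm' : m' = q + N + s) (hn' : n' = q + t) (x : P.V m) :
    (scanL N s t a (by omega : a ≤ q) hm' hn'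
      (P.nest r e (by omega) (by omega) x : P.V m') : P.V n')
      = P.nest r (i + t) (by omega) (by omega)
        (scanL N s t a (by omega : a ≤ q') h h' x : P.V n) := by
  induction N generalizing s m m' e with
  | zero =>
    by_cases hst : s = t
    · obtain rfl : m = n := by omega
      obtain rfl : m' = n' := by omega
      obtain rfl : e = i + t := by omega
      simp [scanL, hst]
    · simp [scanL, hst]
  | succ N ih =>
    cases s with
    | zero =>
      rw [scanL_succ_zero, scanL_succ_zero, ih (by omega)]
    | succ s =>
      obtain ⟨e, rfl⟩ : ∃ e', e = e' + 2 := ⟨i + N + s, by omega⟩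
      rw [scanL_succ_succ (p := q + N + s) _ _ _ rfl, scanL_succ_succ (p := q' + N + s) _ _ _ rfl,
        ih (by omega) (by omega) (by omega) x, map_add,
        cap_nest (p := q' + N + s) (by omega) (by omega) (by omega) _ (by omega),
        ih (by omega) (by omega) (by omega)]

theorem scanL_ins {N s t a i e k q m n m' n' : ℕ} (ha : a ≤ i) (hi : i ≤ q)
    (he : e = i + N + s)
    (h : m = q + N + s) (h' : n = q + t) (hm' : m' = m + k) (hn' : n' = n + k)
    (v : P.V m) (x : P.V k) :
    (scanL N s t a (by omega : a ≤ q + k) (by omega) (by omega)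
      (P.ins e (by omega) hm' v x : P.V m') : P.V n')
      = P.ins (i + t) (by omega) hn'
        (scanL N s t a (by omega : a ≤ q) h h' v : P.V n) x := by
  induction N generalizing s m m' e with
  | zero =>
    by_cases hst : s = t
    · obtain rfl : m = n := by omega
      obtain rfl : m' = n' := by omega
      obtain rfl : e = i + t := by omega
      simp [scanL, hst]
    · simp [scanL, hst]
  | succ N ih =>
    cases s with
    | zero =>
      rw [scanL_succ_zero, scanL_succ_zero, ih (by omega)]
    | succ s =>
      obtain ⟨e, rfl⟩ : ∃ e', e = e' + 2 := ⟨i + N + s, by omega⟩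
      rw [scanL_succ_succ (p := q + k + N + s) _ _ _ rfl, scanL_succ_succ (p := q + N + s) _ _ _ rfl,
        ih (by omega) (by omega) (by omega) v, map_add, LinearMap.add_apply,
        P.cap_ins_left (m' := q + N + s) _ _ (by omega) (by omega) (by omega) _ (by omega),
        ih (by omega) (by omega) (by omega)]

theorem cap_nest_right {b i r m p n n' : ℕ} (hb : b ≤ n') (hi : i ≤ b) (hn : n = n' + 2)
    (hm : m = n + 2 * r) (hp : p = n' + 2 * r) (x : P.V m) :
    P.cap b (by omega) hn (P.nest r i (by omega) hm x)
      = P.nest r i (by omega) hp (P.cap (b + 2 * r) (by omega) (by omega) x) := by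
  induction r generalizing m p with
  | zero =>
    obtain rfl : m = n := by omega
    obtain rfl : p = n' := by omega
    rfl
  | succ r ih =>
    rw [nest_succ (p := p) _ _ (by omega), nest_succ (p := n' + 2 * r) _ _ rfl,
      ih (m := p) (by omega) rfl,
      ← P.cap_cap (m := m) (p := p) (n := n' + 2 * r) (i + r) (b + 2 * r) (by omega) (by omega)
      (by omega) (by omega) x]
    rfl

theorem scanR_nest {N t b b' i r q q' m n m' n' : ℕ} (hb : b ≤ q) (hi : i ≤ b)
    (hb' : b' = b + 2 * r) (hq : q' = q + 2 * r)
    (h : m = q' + N) (h' : n = q' + t) (hm' : m' = q + N) (hn' : n' = q + t) (x : P.V m) :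
    (scanR N t b hb hm' hn' (P.nest r i (by omega) (by omega) x : P.V m') : P.V n')
      = P.nest r i (by omega) (by omega)
        (scanR N t b' (by omega : b' ≤ q') h h' x : P.V n) := by
  induction N generalizing t b b' q q' n n' with
  | zero =>
    cases t with
    | zero =>
      obtain rfl : m = n := by omega
      obtain rfl : m' = n' := by omega
      rfl
    | succ t => simp [scanR]
  | succ N ih =>
    subst hb'
    cases t with
    | zero =>
      rw [scanR_succ_zero (p := q + 2) _ _ _ rfl, scanR_succ_zero (p := q' + 2) _ _ _ rfl,
        ih (q' := q' + 1) (n := q' + 2) (b' := b + 2 * r + 1) (by omega) (by omega) (by omega)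
          (by omega) (by omega) (by omega),
        cap_nest_right (p := n) (by omega) (by omega) (by omega) _ (by omega)]
    | succ t =>
      rw [scanR_succ_succ (p := q + t + 3) _ _ _ rfl, scanR_succ_succ (p := q' + t + 3) _ _ _ rfl,
        ih (t := t + 2) (q' := q' + 1) (n := q' + t + 3) (b' := b + 2 * r + 1) (by omega) (by omega) (by omega)
          (by omega) (by omega) (by omega),
        ih (t := t) (q' := q' + 1) (n := n) (b' := b + 2 * r + 1) (by omega) (by omega) (by omega)
          (by omega) (by omega) (by omega),
        cap_nest_right (p := n) (by omega) (by omega) (by omega) _ (by omega), map_add]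

theorem scanR_ins {N t b b' p q m n m' n' : ℕ} (hb : b ≤ q) (hb' : b' = p + b)
    (h : m = q + N) (h' : n = q + t) (hm' : m' = p + m) (hn' : n' = p + n)
    (v : P.V p) (x : P.V m) :
    (scanR N t b' (by omega : b' ≤ p + q) (by omega) (by omega)
        (P.ins p le_rfl hm' v x : P.V m') : P.V n')
      = P.ins p le_rfl hn' v (scanR N t b hb h h' x : P.V n) := by
  induction N generalizing t b b' q n n' with
  | zero =>
    cases t with
    | zero =>
      obtain rfl : m = n := by omega
      obtain rfl : m' = n' := by omega
      rfl
    | succ t => simp [scanR]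
  | succ N ih =>
    subst hb'
    cases t with
    | zero =>
      rw [scanR_succ_zero (p := p + q + 2) _ _ _ rfl, scanR_succ_zero (p := q + 2) _ _ _ rfl,
        ← P.cap_ins_mid (p := p + q + 2) _ _ _ _ _ (by omega),
        ← ih (q := q + 1) (b := b + 1) (b' := p + b + 1) (by omega) (by omega) (by omega)]
    | succ t =>
      rw [scanR_succ_succ (p := p + q + t + 3) _ _ _ (by omega),
        scanR_succ_succ (p := q + t + 3) _ _ _ rfl, map_add,
        ← P.cap_ins_mid (p := p + q + t + 3) _ _ _ _ _ (by omega),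
        ← ih (q := q + 1) (b := b + 1) (b' := p + b + 1) (by omega) (by omega) (by omega),
        ← ih (q := q + 1) (b := b + 1) (b' := p + b + 1) (by omega) (by omega) (by omega)]

theorem tlCap_contract {k N M : ℕ} (K : ℕ) (hK : N < K) (u : P.V (k + N + k))
    (y : P.V (k + M + k)) :
    P.nest k 0 (Nat.zero_le 0) (by omega) (P.tlCap (N + M) 0 k (by omega) (by omega)
        (P.contract k rfl (Nat.add_assoc k M k) (by omega) u y : P.V (k + (N + M) + k)) : P.V (k + k))
      = ∑ t ∈ Finset.range K, P.contract (k + t + k) (a := 0) (b := 0) (n := 0)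
          (by omega) (by omega) rfl
          (scanL N 0 t k (by omega : k ≤ k + k) (by omega) (by omega) u : P.V (k + t + k))
          (scanR M t k (by omega : k ≤ k + k) (by omega) (by omega) y : P.V (k + t + k)) := by
  rw [tlCap_split (N := N) (M := M) (q := k + k + M) K (by omega) rfl _ rfl, map_sum]
  refine Finset.sum_congr rfl fun t _ => ?_
  simp only [contract, LinearMap.compr₂_apply]
  rw [scanL_nest (i := k) (q' := k + k + (k + M + k)) (n := k + k + (k + M + k) + t) le_rfl (by omega)
      (by omega) (by omega) (by omega) rfl,
    scanL_ins (i := k + k) (q := k + k) (n := k + t + k) (by omega) (by omega) (by omega)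
      (by omega) (by omega) (by omega) (by omega),
    tlCap_eq (p := k + k + t + t) _ _ rfl,
    scanR_nest (b' := k + t + k + k) (q' := k + t + k + (k + k)) (n := k + t + k + (k + t + k))
      (by omega) le_rfl (by omega) (by omega) (by omega) (by omega)]
  have e : k + k + t = k + t + k := by omega
  simp only [e]
  rw [scanR_ins (b := k) (q := k + k) (n := k + t + k) (by omega) (by omega) (by omega)
      (by omega) (by omega) (by omega),
    nest_add (r := t) (s := k) (i := k)]
  have := fun z => nest_add (P := P) (r := k) (s := t + k) (i := 0) (m := k + t + k + (k + t + k))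
    (p := k + k) (n := 0) le_rfl (by omega) (by omega) z
  simp only [Nat.zero_add] at this
  rw [this]
  have e2 : k + (t + k) = k + t + k := by omega
  simp only [e2]

theorem adj_contract_self {n : ℕ} (x y : P.V n) :
    P.adj 0 (P.contract n (a := 0) (b := 0) (by omega) (by omega) rfl (P.adj n x) y)
      = P.contract n (a := 0) (b := 0) (by omega) (by omega) rfl (P.adj n y) x := by
  have key : P.ins 0 n.zero_le (rfl : n + n = n + n) x (P.adj n y)
      = P.ins n le_rfl rfl (P.adj n y) x := by
    have := P.ins_comm (m := 0) (k := n) (l := n) (p := n) (q := n) (r := n + n) 0 0 le_rfl le_rfl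
      (by omega) (by omega) (by omega) P.empty (P.adj n y) x
    rw [P.empty_ins, P.empty_ins] at this
    simpa only [Nat.zero_add] using this
  simp only [contract, LinearMap.compr₂_apply]
  rw [adj_nest (i' := 0) rfl, P.adj_ins n 0 (Nat.add_zero n), P.adj_adj, key]

end PlanarAlgebra

/-- A factor planar algebra: a planar `*`-algebra which is evaluable (finite-dimensional box spaces
and `V 0 ≅ ℂ` via `empty ↦ 1`), spherical, and positive, i.e. the sesquilinear form on `V n`
joining all `n` strings of `x^*` and `y` is a positive definite inner product. (It is Hermitian by the
compatibility of `*` with reflections, see `conj_pair`.) -/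
structure FactorPlanarAlgebra extends PlanarAlgebra.{u} where
  finite_dim : ∀ n, FiniteDimensional ℂ (V n)
  ev : V 0 ≃ₗ[ℂ] ℂ
  ev_empty : ev empty = 1
  spherical : ∀ x : V 2, toPlanarAlgebra.cap 0 le_rfl rfl (toPlanarAlgebra.rot x)
    = toPlanarAlgebra.cap 0 le_rfl rfl x
  positive : ∀ {n : ℕ} (x : V n), x ≠ 0 →
    0 < (ev (toPlanarAlgebra.contract n (a := 0) (b := 0) (by omega) (by omega) rfl (adj n x) x)).re

namespace FactorPlanarAlgebra

variable (P : FactorPlanarAlgebra.{u})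

/-- The modulus: the value of a closed loop (a real number). -/
def delta : ℝ := (P.ev (P.cap 0 le_rfl rfl P.cup)).re

/-- The inner product on `V n`. -/
def pair {n : ℕ} (x y : P.V n) : ℂ :=
  P.ev (P.contract n (a := 0) (b := 0) (by omega) (by omega) rfl (P.adj n x) y)

theorem ev_adj (z : P.V 0) : P.ev (P.adj 0 z) = starRingEnd ℂ (P.ev z) := by
  obtain ⟨c, rfl⟩ := P.ev.symm.surjective z
  have h : P.ev.symm c = c • P.empty := by
    apply P.ev.injective
    simp [P.ev_empty]
  rw [h, LinearMap.map_smulₛₗ, P.adj_empty, map_smul, map_smul, P.ev_empty]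
  simp

theorem conj_pair {n : ℕ} (x y : P.V n) : starRingEnd ℂ (P.pair x y) = P.pair y x := by
  rw [pair, ← ev_adj, PlanarAlgebra.adj_contract_self, pair]

theorem pair_nonneg {n : ℕ} (x : P.V n) : 0 ≤ (P.pair x x).re := by
  by_cases h : x = 0
  · simp [h, pair]
  · exact (P.positive x h).le

theorem delta_nonneg : 0 ≤ P.delta := by
  have h := P.pair_nonneg P.cup
  have e : P.contract 2 (a := 0) (b := 0) (n := 0) (by omega) (by omega) rfl P.cup P.cup
      = P.cap 0 le_rfl rfl P.cup := by
    rw [PlanarAlgebra.contract, LinearMap.compr₂_apply,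
      PlanarAlgebra.nest_succ (p := 2) _ _ rfl, PlanarAlgebra.nest_succ (p := 0) _ _ rfl]
    have := P.zigzag_right (m := 2) (p := 4) 1 (by omega) rfl P.cup
    simp only [Nat.zero_add]
    rw [this]
    rfl
  rwa [pair, P.adj_cup, e] at h

/-- The vector space `Gr_k = ⨁_N P_{2k+N}`; an element of the `N`-th summand is drawn with `k` strings
on the left, `N` on top and `k` on the right, in this order. -/
def Gr (k : ℕ) : Type u := DirectSum ℕ fun N => P.V (k + N + k)

noncomputable instance (k : ℕ) : AddCommGroup (P.Gr k) :=
  inferInstanceAs (AddCommGroup (DirectSum ℕ fun N => P.V (k + N + k)))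

noncomputable instance (k : ℕ) : Module ℂ (P.Gr k) :=
  inferInstanceAs (Module ℂ (DirectSum ℕ fun N => P.V (k + N + k)))

/-- The inclusion of a homogeneous component. -/
noncomputable def ofGr (k N : ℕ) : P.V (k + N + k) →ₗ[ℂ] P.Gr k :=
  DirectSum.lof ℂ ℕ (fun N => P.V (k + N + k)) N

/-- The linear map on `Gr_k` with given values on the homogeneous components. -/
noncomputable def liftGr (k : ℕ) {W : Type*} [AddCommGroup W] [Module ℂ W]
    (φ : (N : ℕ) → P.V (k + N + k) →ₗ[ℂ] W) : P.Gr k →ₗ[ℂ] W :=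
  DirectSum.toModule ℂ ℕ W φ

/-- The graded multiplication of `Gr_k`: the right strings of `x` are joined to the left strings of
`y`, and the top strings are juxtaposed. -/
noncomputable def grMul (k : ℕ) : P.Gr k →ₗ[ℂ] P.Gr k →ₗ[ℂ] P.Gr k :=
  P.liftGr k fun N => (P.liftGr k fun M =>
    ((P.contract k rfl (Nat.add_assoc k M k) (by omega)).compr₂ (P.ofGr k (N + M))).flip).flip

/-- The involution of `Gr_k`. -/
noncomputable def grStar (k : ℕ) : P.Gr k →ₛₗ[starRingEnd ℂ] P.Gr k where
  toFun := DFinsupp.mapRange (fun N => P.adj (k + N + k)) fun _ => map_zero _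
  map_add' := DFinsupp.mapRange_add _ _ fun _ => map_add _
  map_smul' c x := by
    refine DFinsupp.ext fun N => ?_
    erw [DFinsupp.mapRange_apply, DFinsupp.smul_apply, DFinsupp.smul_apply,
      DFinsupp.mapRange_apply]
    exact LinearMap.map_smulₛₗ _ _ _

/-- The normalized Voiculescu trace: the top strings are capped off by the sum of all Temperley-Lieb
diagrams, the `k` left strings are joined to the `k` right strings, and the result is divided by
`δ^k`. (By sphericality, it does not matter on which side the latter strings are closed up.) -/
noncomputable def tau (k : ℕ) : P.Gr k →ₗ[ℂ] ℂ :=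
  P.liftGr k fun N => ((P.delta : ℂ) ^ k)⁻¹ •
    (P.ev.toLinearMap ∘ₗ P.nest k 0 (n := 0) (m := k + k) le_rfl (by omega) ∘ₗ
      P.tlCap N 0 k (n := k + k) (by omega) (by omega))

theorem liftGr_ofGr (k : ℕ) {W : Type*} [AddCommGroup W] [Module ℂ W]
    (φ : (N : ℕ) → P.V (k + N + k) →ₗ[ℂ] W) (N : ℕ) (x : P.V (k + N + k)) :
    P.liftGr k φ (P.ofGr k N x) = φ N x := DirectSum.toModule_lof ..

theorem grMul_ofGr (k N M : ℕ) (x : P.V (k + N + k)) (y : P.V (k + M + k)) :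
    P.grMul k (P.ofGr k N x) (P.ofGr k M y)
      = P.ofGr k (N + M) (P.contract k rfl (Nat.add_assoc k M k) (by omega) x y) := by
  simp [grMul, liftGr_ofGr]

theorem grStar_ofGr (k N : ℕ) (x : P.V (k + N + k)) :
    P.grStar k (P.ofGr k N x) = P.ofGr k N (P.adj _ x) :=
  DFinsupp.mapRange_single (hf := fun _ => map_zero _)

@[elab_as_elim]
theorem gr_induction {k : ℕ} {C : P.Gr k → Prop} (x : P.Gr k) (h0 : C 0)
    (h1 : ∀ N y, C (P.ofGr k N y)) (h2 : ∀ y z, C y → C z → C (y + z)) : C x :=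
  DirectSum.induction_on x h0 h1 h2

/-- Auxiliary: the component with `t` top strings of the map from the graded to the filtered picture. -/
noncomputable def epi (k t : ℕ) : P.Gr k →ₗ[ℂ] P.V (k + t + k) :=
  P.liftGr k fun M => PlanarAlgebra.scanR M t k (by omega : k ≤ k + k) (by omega) (by omega)

theorem tau_star_mul (k : ℕ) (x y : P.Gr k) : ∃ K₀, ∀ K, K₀ ≤ K →
    P.tau k (P.grMul k (P.grStar k x) y) = ((P.delta : ℂ) ^ k)⁻¹ *
      ∑ t ∈ Finset.range K, P.pair (P.epi k t x) (P.epi k t y) := by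
  induction x using gr_induction with
  | h0 => exact ⟨0, fun K _ => by simp [pair]⟩
  | h2 x₁ x₂ h₁ h₂ =>
    obtain ⟨K₁, h₁⟩ := h₁
    obtain ⟨K₂, h₂⟩ := h₂
    refine ⟨max K₁ K₂, fun K hK => ?_⟩
    simp only [map_add, LinearMap.add_apply, h₁ K (le_trans (le_max_left _ _) hK),
      h₂ K (le_trans (le_max_right _ _) hK), pair, Finset.sum_add_distrib, mul_add]
  | h1 N x =>
    induction y using gr_induction with
    | h0 => exact ⟨0, fun K _ => by simp [pair]⟩
    | h2 x₁ x₂ h₁ h₂ =>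
      obtain ⟨K₁, h₁⟩ := h₁
      obtain ⟨K₂, h₂⟩ := h₂
      refine ⟨max K₁ K₂, fun K hK => ?_⟩
      simp only [map_add, h₁ K (le_trans (le_max_left _ _) hK),
        h₂ K (le_trans (le_max_right _ _) hK), pair, Finset.sum_add_distrib, mul_add]
    | h1 M y =>
      refine ⟨N + 1, fun K hK => ?_⟩
      rw [grStar_ofGr, grMul_ofGr, tau, liftGr_ofGr]
      simp only [LinearMap.smul_apply, LinearMap.comp_apply, smul_eq_mul]
      rw [PlanarAlgebra.tlCap_contract K (by omega)]
      simp only [LinearEquiv.coe_coe, map_sum, pair, epi, liftGr_ofGr]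
      congr 1
      refine Finset.sum_congr rfl fun t _ => ?_
      rw [PlanarAlgebra.adj_scanR (b' := k) rfl]

/-- The inner product `⟪x, y⟫ = τ_k(x^* ∧ y)` on `Gr_k`. -/
noncomputable abbrev innerCore (k : ℕ) : PreInnerProductSpace.Core ℂ (P.Gr k) where
  inner x y := P.tau k (P.grMul k (P.grStar k x) y)
  conj_inner_symm x y := by
    obtain ⟨K₁, h₁⟩ := P.tau_star_mul k x y
    obtain ⟨K₂, h₂⟩ := P.tau_star_mul k y x
    simp only [h₁ _ (le_max_left K₁ K₂), h₂ _ (le_max_right K₁ K₂), map_mul, map_inv₀, map_pow,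
      Complex.conj_ofReal, map_sum, conj_pair]
  re_inner_nonneg x := by
    obtain ⟨K, h⟩ := P.tau_star_mul k x x
    rw [h K le_rfl, ← Complex.ofReal_pow, ← Complex.ofReal_inv]
    simp only [RCLike.re_to_complex, Complex.re_ofReal_mul, Complex.re_sum]
    exact mul_nonneg (inv_nonneg.2 (pow_nonneg P.delta_nonneg _))
      (Finset.sum_nonneg fun t _ => P.pair_nonneg _)
  add_left x y z := by simp
  smul_left x y r := by simp [LinearMap.map_smulₛₗ]

noncomputable instance (k : ℕ) : SeminormedAddCommGroup (P.Gr k) :=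
  letI := P.innerCore k
  InnerProductSpace.Core.toSeminormedAddCommGroup (𝕜 := ℂ)

noncomputable instance (k : ℕ) : InnerProductSpace ℂ (P.Gr k) :=
  InnerProductSpace.ofCore (P.innerCore k)

/-- The Hilbert space `L²(Gr_k, τ_k)`. -/
abbrev L2 (k : ℕ) : Type u := UniformSpace.Completion (P.Gr k)

/-- The `C^*`-algebra `A_k`, as an algebra of operators: the unital `C^*`-algebra on `L²(Gr_k, τ_k)`
generated by the left multiplications with elements of `Gr_k`. -/
noncomputable def gjs (k : ℕ) : StarSubalgebra ℂ (P.L2 k →L[ℂ] P.L2 k) :=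
  (StarAlgebra.adjoin ℂ {T : P.L2 k →L[ℂ] P.L2 k | ∃ x : P.Gr k, ∀ y : P.Gr k,
    T (y : P.L2 k) = (P.grMul k x y : P.Gr k)}).topologicalClosure

/-- The Guionnet-Jones-Shlyakhtenko `C^*`-algebra `A_k`. -/
def GJSAlgebra (k : ℕ) : Type u := P.gjs k

noncomputable instance (k : ℕ) : CStarAlgebra (P.GJSAlgebra k) :=
  StarSubalgebra.cstarAlgebra (P.gjs k)
    (h_closed := StarSubalgebra.isClosed_topologicalClosure _)

/-- A minimal projection in one of the finite-dimensional `C^*`-algebras `P_{k,k}`. -/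
structure MinimalProjection where
  /-- the number `k` -/
  level : ℕ
  /-- the projection -/
  p : P.V (level + level)
  adj_p : P.adj _ p = p
  mul_p : P.contract level rfl rfl rfl p p = p
  ne_zero : p ≠ 0
  minimal : ∀ x : P.V (level + level), ∃ c : ℂ,
    P.contract level rfl rfl rfl (P.contract level rfl rfl rfl p x : P.V (level + level)) p = c • p

/-- Equivalence of projections `p ∈ P_{k,k}`, `q ∈ P_{l,l}`: there is `v ∈ P_{k,l}` with `v v^* = p` and
`v^* v = q`. -/
def MinimalProjection.Equivalent {P : FactorPlanarAlgebra.{u}} (p q : P.MinimalProjection) : Prop :=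
  ∃ v : P.V (p.level + q.level),
    P.contract q.level rfl (Nat.add_comm _ _) rfl v (P.adj _ v) = p.p ∧
    P.contract p.level (Nat.add_comm _ _) rfl rfl (P.adj _ v) v = q.p

/-- The vertices of the principal graph: the equivalence classes of minimal projections. -/
def Vertex : Type u := Quot (MinimalProjection.Equivalent (P := P))

/-- The empty diagram, whose class is the distinguished vertex of the principal graph. -/
def emptyProjection : P.MinimalProjection where
  level := 0
  p := P.empty
  adj_p := P.adj_empty
  mul_p := P.empty_ins P.empty
  ne_zero h := by simpa [h] using P.ev_empty
  minimal x := ⟨P.ev x, by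
    have h1 : P.contract 0 rfl rfl rfl P.empty x = x := P.empty_ins x
    have h2 : P.contract 0 rfl rfl rfl x P.empty = x := P.ins_empty 0 le_rfl x
    rw [h1, h2]
    apply P.ev.injective
    simp [P.ev_empty]⟩

/-- The principal graph: the number of edges between the classes of `p ∈ P_{k,k}` and `q ∈ P_{l,l}` is
the dimension of `(p ⊗ 1) P_{k+1,l} q`. Multiple edges and loops do not matter for distances, so only
the underlying simple graph is recorded. -/
def principalGraph : SimpleGraph P.Vertex :=
  SimpleGraph.fromRel fun α β => ∃ p q : P.MinimalProjection, Quot.mk _ p = α ∧ Quot.mk _ q = β ∧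
    ∃ x : P.V (p.level + 1 + q.level),
      P.contract q.level rfl rfl rfl
        (P.contract (p.level + 1) rfl rfl rfl (P.addStrand p.p) x : P.V (p.level + 1 + q.level))
        q.p ≠ 0

/-- The depth: the supremum of the distances of the vertices of the principal graph from the
distinguished vertex. -/
noncomputable def depth : ℕ∞ := P.principalGraph.eccent (Quot.mk _ P.emptyProjection)

end FactorPlanarAlgebra

/-- `S` is hereditary: `a ∈ S`, `a ≥ 0` and `0 ≤ c ≤ a` imply `c ∈ S`. An element of a `C^*`-algebra is
positive iff it is of the form `x^* x`. -/
def IsHereditary {C : Type*} [NonUnitalCStarAlgebra C] (S : Set C) : Prop :=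
  ∀ a ∈ S, ∀ c : C, (∃ x, a = star x * x) → (∃ y, c = star y * y) → (∃ z, a - c = star z * z) →
    c ∈ S

/-- `S` is full: the linear span of `C S C` is dense in `C`. -/
def IsFull {C : Type*} [NonUnitalCStarAlgebra C] (S : Set C) : Prop :=
  Dense (Submodule.span ℂ {c : C | ∃ x y : C, ∃ a ∈ S, c = x * a * y} : Set C)

/-- Strong Morita equivalence: `A` and `B` are (isomorphic to) full hereditary subalgebras of a
(separable) `C^*`-algebra `C`. -/
def StronglyMoritaEquivalent (A B : Type u) [NonUnitalCStarAlgebra A] [NonUnitalCStarAlgebra B] :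
    Prop :=
  ∃ (C : Type u) (_ : NonUnitalCStarAlgebra C) (f : A →⋆ₙₐ[ℂ] C) (g : B →⋆ₙₐ[ℂ] C),
    TopologicalSpace.SeparableSpace C ∧
    Function.Injective f ∧ IsHereditary (Set.range f) ∧ IsFull (Set.range f) ∧
    Function.Injective g ∧ IsHereditary (Set.range g) ∧ IsFull (Set.range g)

/-! Let `Bim P j s` be the space of diagrams with j strings on the left, s on the right and any
number on top. By the graded product, diagrams with i left and j right strings map `Bim P j s` to
`Bim P i s`. Passing from the graded to the filtered picture (`Bim.epi`) turns the Voiculescu form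
into an orthogonal sum of the inner products of box spaces, and turns left multiplication by a
diagram with one top string into a creation plus an annihilation operator (`Bim.epi_mul_one`).
Diagrams with at most one top string generate everything, so the action is by bounded operators,
with bounds independent of s.

Put m = n - 1 and use the column s = m. The closed spaces of operators between the completions of
`Bim P m m` and `Bim P k m` are the blocks of a separable linking algebra. Its diagonal corners are
hereditary. It remains to see that they are full, and that they are isomorphic to A_m and A_k
although A_k is defined on another column.

Both follow from one inequality: the identity of P_{j,j} is `Dominated` by level t, meaning that
‖ξ‖² ≤ C ∑ ‖y ξ‖² for finitely many y in `Bim P t j`, on every column. Then ∑ y* y is invertible, so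
the corner of level t generates level j (`LinkingSystem.isFull_corner`), and the norm of a left
multiplication on an arbitrary column is at most its norm on column t
(`Bim.norm_mul_le_of_dominated`).

Domination by a higher level needs only δ > 1: an extra strand acts as √δ times an isometry plus a
contraction, hence is bounded below (`Dominated.of_ins_cup`). Domination of level k by level m uses
the depth (`dominated_idn_of_depth`). The dominated elements form an ideal of P_{k,k}; if it were
proper there would be a minimal projection p outside it, and a minimal projection q below p with one
more strand, also not dominated. Depth m + 1 and parity put p and q inside m or m + 1 strings; a
projection inside m strings is dominated, so both lie inside m + 1 strings. Let e be the edge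
between p and q and let g connect p to m strings through one top string. Then g* e = 0, since
otherwise q would lie inside m strings. Left multiplication by g* is a multiple of an isometry on
the range of p plus an annihilation term that could cancel it. Apply g* to the vectors η_i = z_i ξ,
where the z_i are the orthogonal polynomials of a free Poisson law in e e*, multiplied by p. The
annihilation terms are square summable by a telescoping estimate (`CreationPair.sum_norm_sq_le`),
whereas ∑ ‖η_i‖² exceeds any prescribed multiple of ‖η_0‖² (`ChebyshevSeq.exists_le_sum_norm_sq`).
Hence finitely many g* z_i dominate p or, after exchanging roles according to the ratio of the
traces, q: a contradiction (`Dominated.of_creation`). -/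

namespace PlanarAlgebra

variable {P : PlanarAlgebra.{u}}

/-! ### Interchange laws for nested caps, and composition of boxes. -/

theorem nest_ins_left {r i q k m n m' n' : ℕ} (hi : i ≤ q) (hq : q ≤ n) (hm : m = n + 2 * r)
    (hm' : m' = m + k) (hn' : n' = n + k) (v : P.V m) (x : P.V k) :
    P.nest r i (by omega) (by omega) (P.ins (q + 2 * r) (by omega) hm' v x : P.V m')
      = P.ins q hq hn' (P.nest r i (by omega) hm v) x := by
  induction r generalizing m m' with
  | zero =>
    obtain rfl : m = n := by omega
    obtain rfl : m' = n' := by omega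
    rfl
  | succ r ih =>
    rw [nest_succ (p := n' + 2 * r) _ _ rfl, nest_succ (p := n + 2 * r) _ _ rfl,
      ← ih (m := n + 2 * r) (m' := n' + 2 * r) rfl (by omega)]
    congr 1
    exact P.cap_ins_left (i + r) (q + 2 * r) (by omega) (by omega) (by omega) _ (by omega) v x

theorem nest_ins_right {r i q k m n m' n' : ℕ} (hqi : q ≤ i) (hi : i ≤ n) (hm : m = n + 2 * r)
    (hm' : m' = m + k) (hn' : n' = n + k) (v : P.V m) (x : P.V k) :
    P.nest r (i + k) (by omega) (by omega) (P.ins q (by omega) hm' v x : P.V m')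
      = P.ins q (by omega) hn' (P.nest r i (by omega) hm v) x := by
  induction r generalizing m m' with
  | zero =>
    obtain rfl : m = n := by omega
    obtain rfl : m' = n' := by omega
    rfl
  | succ r ih =>
    rw [nest_succ (p := n' + 2 * r) _ _ rfl, nest_succ (p := n + 2 * r) _ _ rfl,
      ← ih (m := n + 2 * r) (m' := n' + 2 * r) rfl (by omega)]
    congr 1
    have := P.cap_ins_right (m := m) (m' := n + 2 * r) (k := k) (p := m') (n := n' + 2 * r)
      q (i + r) (by omega) (by omega) (by omega) (by omega) (by omega) v x
    rw [← this]
    simp only [Nat.add_right_comm i k r]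

theorem nest_ins_mid {r i j m k k' p n : ℕ} (hi : i ≤ m) (hj : j ≤ k') (hk : k = k' + 2 * r)
    (hp : p = m + k) (hn : n = m + k') (v : P.V m) (x : P.V k) :
    P.nest r (i + j) (by omega) (by omega) (P.ins i hi hp v x : P.V p)
      = P.ins i hi hn v (P.nest r j hj hk x) := by
  induction r generalizing k p with
  | zero =>
    obtain rfl : k = k' := by omega
    obtain rfl : p = n := by omega
    rfl
  | succ r ih =>
    rw [nest_succ (p := n + 2 * r) _ _ rfl, nest_succ (p := k' + 2 * r) _ _ rfl,
      ← ih (k := k' + 2 * r) (p := n + 2 * r) rfl (by omega)]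
    congr 1
    have := P.cap_ins_mid (m := m) (k := k) (k' := k' + 2 * r) (p := p) (n := n + 2 * r)
      i (j + r) hi (by omega) (by omega) (by omega) (by omega) v x
    rw [← this]
    simp only [Nat.add_assoc]

theorem nest_nest {r s i j m p q n : ℕ} (hij : i ≤ j) (hj : j ≤ n) (hp : p = n + 2 * r)
    (hq : q = n + 2 * s) (hm : m = p + 2 * s) (x : P.V m) :
    P.nest r i (by omega) hp (P.nest s (j + 2 * r) (by omega) hm x)
      = P.nest s j hj hq (P.nest r i (by omega) (by omega) x) := by
  induction r generalizing p m with
  | zero =>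
    obtain rfl : p = n := by omega
    obtain rfl : m = q := by omega
    rfl
  | succ r ih =>
    rw [nest_succ (p := n + 2 * r) _ _ rfl, nest_succ (p := q + 2 * r) _ _ (by omega),
      ← ih (p := n + 2 * r) rfl (by omega)]
    congr 1
    have := cap_nest (P := P) (c := i + r) (i := j + 2 * r) (r := s) (m := m) (n := p)
      (n' := n + 2 * r) (p := q + 2 * r) (by omega) (by omega) (by omega) hm (by omega) x
    rw [← this]
    simp only [Nat.mul_add, Nat.mul_one, Nat.add_assoc]

theorem ins_zero {m k n : ℕ} (hn : n = m + k) (hn' : n = k + m) (x : P.V m) (y : P.V k) :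
    P.ins 0 m.zero_le hn x y = P.ins k le_rfl hn' y x := by
  have := P.ins_comm (m := 0) (k := k) (l := m) (p := m) (q := k) (r := n) 0 0 le_rfl le_rfl
    (by omega) (by omega) (by omega) P.empty y x
  rw [P.empty_ins, P.empty_ins] at this
  simpa only [Nat.zero_add] using this

theorem ins_ins_top {m k l p q r : ℕ} (hp : p = m + k) (hq : q = k + l) (hr : r = m + k + l)
    (x : P.V m) (y : P.V k) (z : P.V l) :
    P.ins p le_rfl (by omega) (P.ins m le_rfl hp x y) z
      = (P.ins m le_rfl (by omega) x (P.ins k le_rfl hq y z) : P.V r) := by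
  subst hp
  exact P.ins_nested m k le_rfl le_rfl rfl hq hr x y z

theorem contract_apply {r a b m m' n q : ℕ} (hx : m = a + r) (hy : m' = r + b) (hn : n = a + b)
    (hq : q = m + m') (x : P.V m) (y : P.V m') :
    P.contract r hx hy hn x y = P.nest r a (by omega) (by omega) (P.ins m le_rfl hq x y) := by
  subst hq; rfl

/-- Both sides are two nests of caps applied to the juxtaposition of x, y and z; the nests touch
disjoint strings of y and therefore commute. -/
theorem contract_assoc_aux {r r' a b c mx my mz mxy myz n : ℕ} (hx : mx = a + r) (hy : my = r + b + r')
    (hy' : my = r + (b + r')) (hz : mz = r' + c) (hxy : mxy = a + (b + r')) (hxy' : mxy = a + b + r')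
    (hyz : myz = r + b + c) (hyz' : myz = r + (b + c)) (hn : n = a + b + c) (hn' : n = a + (b + c))
    (x : P.V mx) (y : P.V my) (z : P.V mz) :
    P.contract r' hxy' hz hn (P.contract r hx hy' hxy x y) z
      = P.contract r hx hyz' hn' x (P.contract r' hy hz hyz y z) := by
  rw [contract_apply (q := mxy + mz) _ _ _ rfl, contract_apply (q := mx + my) _ _ _ rfl,
    contract_apply (q := mx + myz) _ _ _ rfl, contract_apply (q := my + mz) _ _ _ rfl]
  have h1 := nest_ins_left (P := P) (r := r) (i := a) (q := mxy) (k := mz) (m := mx + my) (n := mxy)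
    (m' := mx + (my + mz)) (n' := mxy + mz) (by omega) le_rfl (by omega) (by omega) rfl
    (P.ins mx le_rfl rfl x y) z
  have h2 := nest_ins_mid (P := P) (r := r') (i := mx) (j := r + b) (m := mx) (k := my + mz)
    (k' := myz) (p := mx + (my + mz)) (n := mx + myz) le_rfl (by omega) (by omega) rfl rfl x
    (P.ins my le_rfl rfl y z)
  rw [← h1, ← h2]
  have h3 := ins_ins_top (P := P) (m := mx) (k := my) (l := mz) (p := mx + my) (q := my + mz)
    (r := mx + (my + mz)) rfl rfl (by omega) x y z
  rw [← h3]
  have h4 := nest_nest (P := P) (r := r) (s := r') (i := a) (j := a + b) (n := n)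
    (m := mx + (my + mz)) (p := mx + myz) (q := mxy + mz)
    (by omega) (by omega) (by omega) (by omega) (by omega)
    (P.ins (mx + my) le_rfl (by omega) (P.ins mx le_rfl rfl x y) z)
  have e1 : a + b + 2 * r = mx + (r + b) := by omega
  have e2 : mxy + 2 * r = mx + my := by omega
  simp only [e1] at h4
  rw [h4]
  congr 1
  simp only [e2]

/-- All index equations are free arguments, so that the law can be used for rewriting whatever way
the numbers of strings are written. The only real condition, r + r' ≤ my, says that the strings of y
joined to x and those joined to z do not overlap. -/
theorem contract_assoc {r r' a₁ c₁ a₂ b₂ a₃ b₃ a₄ b₄ mx my mz mxy myz n : ℕ}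
    {h₁ : mxy = a₁ + r'} {h₂ : mz = r' + c₁} {h₃ : n = a₁ + c₁} {h₄ : mx = a₂ + r}
    {h₅ : my = r + b₂} {h₆ : mxy = a₂ + b₂} {h₇ : mx = a₃ + r} (h₈ : myz = r + b₃)
    (h₉ : n = a₃ + b₃) (h₁₀ : my = a₄ + r') (h₁₁ : mz = r' + b₄) (h₁₂ : myz = a₄ + b₄)
    (h : r + r' ≤ my) (x : P.V mx) (y : P.V my) (z : P.V mz) :
    P.contract r' h₁ h₂ h₃ (P.contract r h₄ h₅ h₆ x y) z
      = P.contract r h₇ h₈ h₉ x (P.contract r' h₁₀ h₁₁ h₁₂ y z) := by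
  obtain ⟨b, rfl⟩ : ∃ b, b₂ = b + r' := ⟨b₂ - r', by omega⟩
  obtain rfl : a₁ = a₂ + b := by omega
  obtain rfl : a₃ = a₂ := by omega
  obtain rfl : a₄ = r + b := by omega
  obtain rfl : b₄ = c₁ := by omega
  obtain rfl : b₃ = b + b₄ := by omega
  exact contract_assoc_aux ..

theorem adj_contract {r a b m m' n : ℕ} (hx : m = a + r) (hy : m' = r + b) (hn : n = a + b)
    (x : P.V m) (y : P.V m') :
    P.adj n (P.contract r hx hy hn x y)
      = P.contract r (a := b) (b := a) (by omega) (by omega) (by omega) (P.adj m' y) (P.adj m x) := by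
  rw [contract_apply (q := m + m') _ _ _ rfl,
    contract_apply (a := b) (b := a) (q := m + m') (by omega) (by omega) (by omega) (by omega),
    adj_nest (i := a) (i' := b) (by omega), P.adj_ins m 0 (by omega),
    ins_zero _ (by omega : m + m' = m' + m)]

theorem cap_ins_cup {i m p : ℕ} (hi : i ≤ m) (hp : p = m + 2) (v : P.V m) :
    P.cap i hi hp (P.ins i hi hp v P.cup) = P.ins i hi rfl v (P.cap 0 le_rfl rfl P.cup) :=
  P.cap_ins_mid i 0 hi le_rfl rfl hp rfl v P.cup

/-- Adding a through string next to the top strings. -/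
theorem contract_ins_cup {a j b m m' m'' n : ℕ} (hp : m = a + j) (hx : m'' = j + 1 + b)
    (hm : m' = m + 2) (hn : n = a + 1 + b) (p : P.V m) (x : P.V m'') :
    P.contract (j + 1) (by omega) hx hn (P.ins a (by omega) hm p P.cup : P.V m') x
      = P.contract j hp (by omega : m'' = j + (1 + b)) (by omega) p x := by
  rw [contract_apply (q := m' + m'') _ _ _ rfl, contract_apply (q := m + m'') _ _ _ rfl]
  have h0 := nest_add (P := P) (r := 1) (s := j) (i := a + 1) (m := m' + m'') (p := n + 2) (n := n)
    (by omega) (by omega) (by omega) (P.ins m' le_rfl rfl (P.ins a (by omega) hm p P.cup) x)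
  have e1 : 1 + j = j + 1 := by omega
  simp only [e1] at h0
  rw [← h0]
  have h1 := P.ins_comm (m := m) (k := 2) (l := m'') (p := m + m'') (q := m') (r := m' + m'')
    a m (by omega) le_rfl rfl hm (by omega) p P.cup x
  subst hm
  rw [← h1]
  have h2 := nest_ins_right (P := P) (r := j) (i := a) (q := a) (k := 2) (m := m + m'')
    (n := n) (m' := m + 2 + m'') (n' := n + 2) le_rfl (by omega) (by omega) (by omega) rfl
    (P.ins m le_rfl rfl p x) P.cup
  rw [nest_succ (p := n) _ _ (by omega)]
  erw [h2]
  exact P.zigzag_left a (by omega) rfl _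

/-- The identity of `P_{r,r}`. -/
def idn (P : PlanarAlgebra.{u}) : (r : ℕ) → P.V (r + r)
  | 0 => P.empty
  | r + 1 => P.ins r (by omega) (by omega) (idn P r) P.cup

theorem idn_contract {r b m : ℕ} (h : m = r + b) (x : P.V m) :
    P.contract r rfl h h (P.idn r) x = x := by
  induction r generalizing b with
  | zero =>
    obtain rfl : m = b := by omega
    rw [contract_apply (q := m) _ _ _ (by omega)]
    exact P.empty_ins x
  | succ r ih =>
    have := contract_ins_cup (P := P) (a := r) (j := r) (b := b) (n := m) rfl h
      (by omega : r + 1 + (r + 1) = r + r + 2) h (P.idn r) x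
    exact this.trans (ih (b := 1 + b) _)

theorem adj_idn (r : ℕ) : P.adj _ (P.idn r) = P.idn r := by
  induction r with
  | zero => exact P.adj_empty
  | succ r ih =>
    rw [idn, P.adj_ins r r rfl, ih, P.adj_cup]

theorem contract_idn {r b m : ℕ} (h : m = b + r) (x : P.V m) :
    P.contract r h rfl h x (P.idn r) = x := by
  have := idn_contract (P := P) (r := r) (b := b) (m := m) (by omega) (P.adj m x)
  have h2 := congrArg (P.adj m) this
  rw [adj_contract, P.adj_adj, adj_idn] at h2
  exact h2

/-! ### Rotation and through strings below a box. -/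

theorem rot_nest {r i m n : ℕ} (hi : i + 1 ≤ n) (hm : m = n + 2 * r) (v : P.V m) :
    P.rot (P.nest r (i + 1) hi hm v) = P.nest r i (by omega) hm (P.rot v) := by
  have h := nest_ins_mid (P := P) (r := r) (i := 1) (j := i + 1) (m := 2) (k := m) (k' := n)
    (p := 2 + m) (n := 2 + n) one_le_two hi hm rfl rfl P.cup v
  rw [rot, ← h]
  have e : 1 + (i + 1) = i + 2 := by omega
  simp only [e]
  exact cap_nest (Nat.zero_le i) (by omega) (by omega) (by omega) (by omega) _

theorem rot_ins {a m k n : ℕ} (ha : a + 1 ≤ m) (hn : n = m + k) (x : P.V m) (y : P.V k) :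
    P.rot (P.ins (a + 1) ha hn x y) = P.ins a (by omega) hn (P.rot x) y := by
  have h := P.ins_nested (m := 2) (k := m) (l := k) (p := 2 + m) (q := n) (r := 2 + n) 1 (a + 1)
    one_le_two ha rfl hn (by omega) P.cup x y
  rw [rot, ← h]
  have e : 1 + (a + 1) = a + 2 := by omega
  simp only [e]
  exact P.cap_ins_left 0 a (Nat.zero_le a) (by omega) (by omega) (by omega) (by omega) _ _

theorem rot_injective (n : ℕ) : Function.Injective (P.rot : P.V (n + 1) → P.V (n + 1)) := by
  intro x y h
  have hf : Function.Injective ((P.rot : P.V (n + 1) → P.V (n + 1))^[n + 1]) := by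
    intro x y h
    have hx := P.rotate_full (n + 1) x
    have hy := P.rotate_full (n + 1) y
    exact hx.symm.trans (h.trans hy)
  apply hf
  rw [Function.iterate_succ_apply, Function.iterate_succ_apply, h]

end PlanarAlgebra

namespace PlanarAlgebra

variable {P : PlanarAlgebra.{u}}

theorem nest_one_add {r i m p n : ℕ} (hi : i ≤ n) (hp : p = n + 2) (hm : m = p + 2 * r)
    (x : P.V m) :
    P.cap i hi hp (P.nest r (i + 1) (by omega) hm x) = P.nest (r + 1) i hi (by omega) x := by
  have h0 := nest_add (P := P) (r := 1) (s := r) (i := i) (m := m) (p := p) (n := n)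
    hi (by omega) hm x
  have e1 : 1 + r = r + 1 := by omega
  simp only [e1] at h0
  rw [← h0, nest_succ (p := n) _ _ (by omega)]
  rfl

/-- The strand below x and the first string of w form a zigzag. Once it is straightened, x sits in
gap 1 of w. -/
theorem contract_addStrand {r a m m' q n n' : ℕ} (hm : m = a + r) (hm' : m' = m + 2)
    (hq : q = 1 + r + n') (hn : n = a + 1 + n') (x : P.V m) (w : P.V q) :
    P.contract (r + 1) (a := a + 1) (b := n') (by omega) (by omega) hn
        (P.ins 1 one_le_two (by omega) P.cup x : P.V m') w
      = P.nest r (a + 1) (by omega) (by omega) (P.ins 1 (by omega) rfl w x) := by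
  rw [contract_apply (q := m' + q) _ _ _ rfl,
    nest_succ (p := q + m) _ _ (by omega)]
  congr 1
  have h1 := P.ins_comm (m := 2) (k := m) (l := q) (p := 2 + q) (q := m') (r := m' + q)
    1 2 one_le_two le_rfl (by omega) (by omega) (by omega) P.cup x w
  have e : 2 + m = m' := by omega
  simp only [e] at h1
  rw [← h1]
  have h2 := P.cap_ins_right (m := 2 + q) (m' := q) (k := m) (p := m' + q) (n := q + m) 1 1 le_rfl
    (by omega) (by omega) (by omega) rfl (P.ins 2 le_rfl rfl P.cup w) x
  have e2 : 1 + m = a + 1 + r := by omega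
  simp only [e2] at h2
  rw [h2, ← ins_zero (by omega)]
  rw [P.zigzag_left 0 (by omega) (by omega)]

theorem contract_addStrand_addStrand {r a b m m' k k' n n' : ℕ} (hm : m = a + r) (hm' : m' = m + 2)
    (hk : k = r + b) (hk' : k' = k + 2) (hn : n = a + b) (hn' : n' = n + 2)
    (x : P.V m) (y : P.V k) :
    P.contract (r + 1) (a := a + 1) (b := b + 1) (n := n') (by omega) (by omega) (by omega)
        (P.ins 1 one_le_two (by omega) P.cup x : P.V m')
        (P.ins 1 one_le_two (by omega) P.cup y : P.V k')
      = P.ins 1 one_le_two (by omega) P.cup (P.contract r hm hk hn x y) := by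
  rw [contract_addStrand (n' := b + 1) hm hm' (by omega) (by omega)]
  have h1 := P.ins_nested (m := 2) (k := k) (l := m) (p := k') (q := m + k) (r := k' + m)
    1 0 one_le_two (by omega) (by omega) (by omega) (by omega) P.cup y x
  simp only [Nat.add_zero] at h1
  rw [h1, ins_zero _ rfl]
  have h2 := nest_ins_mid (P := P) (r := r) (i := 1) (j := a) (m := 2) (k := m + k) (k' := n)
    (p := k' + m) (n := n') one_le_two (by omega) (by omega) (by omega) (by omega) P.cup
    (P.ins m le_rfl rfl x y)
  rw [contract_apply (q := m + k) _ _ _ rfl, ← h2]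
  have e : 1 + a = a + 1 := by omega
  simp only [e]

/-- Frobenius reciprocity: bending the first string of w over to the right end turns the action of x
with a strand below into the action of x alone. This gives one direction along an edge of the
principal graph. -/
theorem contract_rot {l r m k q : ℕ} (hm : m = l + l) (hk : k = 1 + l + r) (hk' : k = l + (r + 1))
    (hq : q = m + 2) (x : P.V m) (w : P.V k) :
    P.contract l hm hk' hk' x (P.rot w)
      = P.rot (P.contract (l + 1) (a := l + 1) (b := r) (by omega) (by omega) (by omega)
        (P.ins 1 one_le_two (by omega) P.cup x : P.V q) w) := by
  rw [contract_addStrand (n' := r) hm hq hk (by omega), rot_nest,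
    rot_ins (a := 0) (by omega), ins_zero _ (by omega : k + m = m + k),
    contract_apply (q := k + m) _ _ _ (by omega)]

theorem adj_addStrand {m n : ℕ} (h : n = m + 2) (x : P.V m) :
    P.adj n (P.ins 1 one_le_two (by omega) P.cup x)
      = P.ins 1 one_le_two (by omega) P.cup (P.adj m x) := by
  rw [P.adj_ins 1 1 rfl, P.adj_cup]

/-! ### Mirror symmetry of the sum over Temperley-Lieb diagrams. -/

theorem scanR_eq_zero {N t b q m n : ℕ} (hb : b ≤ q) (h : m = q + N) (h' : n = q + t)
    (ht : N < t) (x : P.V m) : (scanR N t b hb h h' x : P.V n) = 0 := by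
  induction N generalizing t b q n with
  | zero =>
    obtain ⟨t, rfl⟩ : ∃ t', t = t' + 1 := ⟨t - 1, by omega⟩
    simp [scanR]
  | succ N ih =>
    obtain ⟨t, rfl⟩ : ∃ t', t = t' + 1 := ⟨t - 1, by omega⟩
    rw [scanR_succ_succ (p := q + t + 3) _ _ _ rfl, ih _ _ _ (by omega), ih _ _ _ (by omega)]
    simp

/-- `scanR` is defined by peeling off the first string; here the last one is peeled off. The two
steps commute because the two caps do, and the cases t = 0 and t > 0 feed each other, hence the
joint induction. -/
theorem scanR_last {N m : ℕ} (x : P.V m) :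
    (∀ {b q n r : ℕ} (hb : b ≤ q) (h : m = q + (N + 1)) (h' : n = q + 0) (hr : r = n + 2),
      (scanR (N + 1) 0 b hb h h' x : P.V n) = P.cap b (by omega) hr
        (scanR N 1 b (by omega : b ≤ q + 1) (by omega) (by omega) x : P.V r)) ∧
    (∀ {t b q n r : ℕ} (hb : b ≤ q) (h : m = q + (N + 1)) (h' : n = q + (t + 1)) (hr : r = n + 2),
      (scanR (N + 1) (t + 1) b hb h h' x : P.V n) =
        scanR N t b (by omega : b ≤ q + 1) (by omega) (by omega) x +
        P.cap (b + t + 1) (by omega) hr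
          (scanR N (t + 2) b (by omega : b ≤ q + 1) (by omega) (by omega) x : P.V r)) := by
  induction N with
  | zero =>
    refine ⟨fun hb h h' hr => by simp [scanR], fun {t b q n r} hb h h' hr => ?_⟩
    rw [scanR_succ_succ (p := q + t + 3) _ _ _ (by omega)]
    cases t <;> simp [scanR]
  | succ N ih =>
    obtain ⟨ihA, ihB⟩ := ih
    refine ⟨fun {b q n r} hb h h' hr => ?_, fun {t b q n r} hb h h' hr => ?_⟩
    · rw [scanR_succ_zero (p := r) _ _ _ (by omega), ihB (r := r + 2) _ _ _ rfl, map_add,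
        scanR_succ_succ (p := r + 2) _ _ _ (by omega), map_add]
      congr 1
      exact P.cap_cap (m := r + 2) (p := r) (n := n) b b le_rfl (by omega) (by omega) (by omega) _
    · rw [scanR_succ_succ (p := r) _ _ _ (by omega), ihB (t := t + 1) (r := r + 2) _ _ _ rfl,
        map_add, scanR_succ_succ (p := r + 2) _ _ _ (by omega), map_add]
      have hcc := P.cap_cap (m := r + 2) (p := r) (n := n) b (b + t + 1) (by omega)
        (by omega) (by omega) (by omega)
        (scanR N (t + 3) (b + 1) (by omega : b + 1 ≤ q + 2) (by omega) (by omega) x)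
      have e : b + 1 + (t + 1) + 1 = b + t + 1 + 2 := by omega
      simp only [e]
      rw [hcc]
      cases t with
      | zero =>
        rw [ihA (r := r) _ _ _ (by omega), scanR_succ_zero (p := r) _ _ _ (by omega)]
        simp only [Nat.add_zero]
        abel
      | succ t =>
        rw [ihB (r := r) _ _ _ (by omega), scanR_succ_succ (p := r) _ _ _ (by omega)]
        have e : b + 1 + t + 1 = b + (t + 1) + 1 := by omega
        simp only [e]
        abel

/-- Both satisfy the recursion in the last string. Since `adj` exchanges the two scans, the passage
to the filtered picture commutes with the involution. -/
theorem scanL_eq_scanR {N t b q m n : ℕ} (hb : b ≤ q) (h : m = q + N) (h' : n = q + t)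
    (x : P.V m) : (scanL N 0 t b hb h h' x : P.V n) = scanR N t b hb h h' x := by
  induction N generalizing t b q n with
  | zero =>
    cases t with
    | zero => rfl
    | succ t => simp [scanR, scanL]
  | succ N ih =>
    rw [scanL_last (r := n + 2) _ _ _ rfl]
    simp only [ih]
    cases t with
    | zero => rw [(scanR_last x).1 (r := n + 2) _ _ _ rfl, dif_neg (by omega), zero_add]; rfl
    | succ t => rw [(scanR_last x).2 (r := n + 2) _ _ _ rfl, dif_pos (by omega)]; rfl

theorem adj_scanR_eq {N t b b' q m n : ℕ} (hb : b + b' = q) (h : m = q + N) (h' : n = q + t)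
    (x : P.V m) :
    P.adj n (scanR N t b (by omega) h h' x) = scanR N t b' (by omega) h h' (P.adj m x) := by
  rw [adj_scanR hb, scanL_eq_scanR]

theorem nest_cast {r i m m' n : ℕ} (hi : i ≤ n) (h : m = m') (h' : m' = n + 2 * r) (x : P.V m) :
    P.nest r i hi h' (P.cast h x) = P.nest r i hi (h.trans h') x := by
  subst h; rfl

end PlanarAlgebra

namespace FactorPlanarAlgebra

variable {P : FactorPlanarAlgebra.{u}}
open PlanarAlgebra

/-! ### The trace property, from sphericality. -/

theorem nest_swap_step {i i' n : ℕ} (h : i + 1 + i' = n) (x y : P.V n) :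
    P.nest i 0 (n := 0) (m := 2 * i) le_rfl (by omega)
        (P.nest (i' + 1) 0 (Nat.zero_le _) (by omega) (P.ins (i' + 1) (by omega) rfl x y))
      = P.nest (i + 1) 0 (n := 0) (m := 2 * (i + 1)) le_rfl (by omega)
        (P.nest i' 0 (Nat.zero_le _) (by omega) (P.ins i' (by omega) rfl (P.rot x) y)) := by
  rw [← nest_one_add (r := i') (p := 2 * i + 2) (by omega) rfl (by omega),
    ← cap_nest (n := 2) (n' := 0) (m := 2 * i + 2) le_rfl le_rfl rfl (by omega) (by omega),
    ← P.spherical, rot_nest, rot_nest, rot_ins,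
    nest_one_add (r := i) (p := 2) le_rfl rfl (by omega)]

/-- The strings joining x and y are carried around the sphere one at a time, each costing one click
of x. After n clicks x is unchanged by `rotate_full`, and y has moved from its right to its left. -/
theorem nest_swap {n : ℕ} (x y : P.V n) :
    P.nest n 0 (n := 0) le_rfl (by omega) (P.ins n le_rfl rfl x y)
      = P.nest n 0 (n := 0) le_rfl (by omega) (P.ins n le_rfl rfl y x) := by
  have key : ∀ i i' : ℕ, ∀ h : i + i' = n,
      P.nest n 0 (n := 0) le_rfl (by omega) (P.ins n le_rfl rfl x y)
      = P.nest i 0 (n := 0) (m := 2 * i) le_rfl (by omega)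
        (P.nest i' 0 (Nat.zero_le _) (by omega) (P.ins i' (by omega) rfl (P.rot^[i] x) y)) := by
    intro i
    induction i with
    | zero =>
      intro i' h
      obtain rfl : i' = n := by omega
      rfl
    | succ i ih =>
      intro i' h
      rw [ih (i' + 1) (by omega), nest_swap_step (by omega), Function.iterate_succ_apply']
  rw [key n 0 rfl]
  have := P.rotate_full n x
  have h2 : (P.rot^[n] x) = x := this
  rw [h2, ins_zero _ rfl]
  rw [nest_zero, nest_cast]

end FactorPlanarAlgebra

open scoped InnerProductSpace

/-- Symmetry and Cauchy-Schwarz make n ↦ ‖T^n ξ‖ logarithmically convex, so a first ratio larger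
than N would force growth faster than N^n. No boundedness of T is assumed: this lemma is what proves
boundedness later. -/
theorem norm_apply_le_of_iterate_le {E : Type*} [SeminormedAddCommGroup E] [InnerProductSpace ℂ E]
    (T : E → E) (hT : ∀ x y, ⟪T x, y⟫_ℂ = ⟪x, T y⟫_ℂ) {ξ : E} {D N : ℝ} (hN : 0 ≤ N)
    (h : ∀ n, ‖T^[n] ξ‖ ≤ D * N ^ n) : ‖T ξ‖ ≤ N * ‖ξ‖ := by
  have hconv : ∀ x : E, ‖T x‖ * ‖T x‖ ≤ ‖x‖ * ‖T (T x)‖ := fun x => by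
    have h1 := norm_inner_le_norm (𝕜 := ℂ) x (T (T x))
    rw [← hT, inner_self_eq_norm_sq_to_K] at h1
    simpa [pow_two] using h1
  by_contra! hlt
  have hξ : 0 < ‖ξ‖ := by
    rcases (norm_nonneg ξ).eq_or_lt with h0 | h0
    · have := hconv ξ
      rw [← h0, zero_mul] at this
      rw [← h0, mul_zero] at hlt
      nlinarith
    · exact h0
  set ρ := ‖T ξ‖ / ‖ξ‖ with hρ
  have hρN : N < ρ := by rwa [hρ, lt_div_iff₀ hξ]
  have hρ0 : 0 < ρ := hN.trans_lt hρN
  have hstep : ∀ n, 0 < ‖T^[n] ξ‖ ∧ ρ * ‖T^[n] ξ‖ ≤ ‖T^[n + 1] ξ‖ := by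
    intro n
    induction n with
    | zero =>
      refine ⟨hξ, ?_⟩
      simp [hρ, hξ.ne']
    | succ n ih =>
      obtain ⟨h1, h2⟩ := ih
      have h3 : 0 < ‖T^[n + 1] ξ‖ := (mul_pos hρ0 h1).trans_le h2
      refine ⟨h3, ?_⟩
      have h4 := hconv (T^[n] ξ)
      rw [← Function.iterate_succ_apply' T, ← Function.iterate_succ_apply' T] at h4
      nlinarith
  have hgrow : ∀ n, ρ ^ n * ‖ξ‖ ≤ ‖T^[n] ξ‖ := by
    intro n
    induction n with
    | zero => simp
    | succ n ih =>
      calc ρ ^ (n + 1) * ‖ξ‖ = ρ * (ρ ^ n * ‖ξ‖) := by ring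
        _ ≤ ρ * ‖T^[n] ξ‖ := by gcongr
        _ ≤ _ := (hstep n).2
  -- For N = 0 there is no ratio ρ / N to compare with, but the bound at n = 1 already contradicts
  -- ‖T ξ‖ > 0.
  rcases hN.eq_or_lt with h0 | h0
  · have h1 := h 1
    rw [← h0] at h1
    have h2 := (hstep 1).1
    simp at h1 h2
    linarith
  · obtain ⟨n, hn⟩ := pow_unbounded_of_one_lt (D / ‖ξ‖) ((one_lt_div h0).2 hρN)
    have h1 := (hgrow n).trans (h n)
    rw [div_pow, div_lt_div_iff₀ hξ (pow_pos h0 n)] at hn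
    linarith

/-! ### The box spaces as Hilbert spaces, and minimal projections in P_{j,j}. -/

namespace FactorPlanarAlgebra

variable {P : FactorPlanarAlgebra.{u}}
open PlanarAlgebra

attribute [instance] FactorPlanarAlgebra.finite_dim

/-- The inner product on the box space `V n`. -/
noncomputable abbrev boxCore (P : FactorPlanarAlgebra.{u}) (n : ℕ) :
    InnerProductSpace.Core ℂ (P.V n) where
  inner x y := P.pair x y
  conj_inner_symm x y := P.conj_pair y x
  re_inner_nonneg x := P.pair_nonneg x
  add_left x y z := by simp [pair]
  smul_left x y r := by simp [pair, LinearMap.map_smulₛₗ]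
  definite x h := by
    by_contra hx
    have := P.positive x hx
    change P.pair x x = 0 at h
    change 0 < (P.pair x x).re at this
    simp [h] at this

noncomputable instance (n : ℕ) : NormedAddCommGroup (P.V n) :=
  letI := P.boxCore n
  InnerProductSpace.Core.toNormedAddCommGroup (𝕜 := ℂ)

noncomputable instance (n : ℕ) : InnerProductSpace ℂ (P.V n) :=
  InnerProductSpace.ofCore (P.boxCore n).toCore

theorem inner_eq {n : ℕ} (x y : P.V n) : ⟪x, y⟫_ℂ = P.pair x y := rfl

theorem contract_all {r i m m' q : ℕ} (hm : m = r + i) (hm' : m' = i + r) (hq : q = r + r)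
    (hm0 : m = 0 + m') (x : P.V m) (y : P.V m') :
    P.contract m' (a := 0) (b := 0) (n := 0) hm0 (by omega) rfl x y
      = P.nest r 0 le_rfl (by omega) (P.contract i hm hm' hq x y) := by
  rw [contract_apply (q := m + m') _ _ _ rfl, contract_apply (q := m + m') _ _ _ rfl]
  have := nest_add (P := P.toPlanarAlgebra) (r := r) (s := i) (i := 0) (m := m + m') (p := q)
    (n := 0) le_rfl (by omega) (by omega) (P.ins m le_rfl rfl x y)
  simp only [Nat.zero_add] at this
  rw [this]
  have e : r + i = m' := by omega
  simp only [e]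

theorem pair_contract {i j r m p q : ℕ} (hm : m = i + j) (hp : p = j + r) (hq : q = i + r)
    (b : P.V m) (y : P.V p) (z : P.V q) :
    P.pair (P.contract j hm hp hq b y) z
      = P.pair y (P.contract i (a := j) (by omega) hq hp (P.adj m b) z) := by
  rw [pair, pair, adj_contract, contract_all (r := r) (i := i) (q := r + r) (by omega) hq rfl,
    contract_all (r := r) (i := j) (q := r + r) (by omega) hp rfl,
    contract_assoc (h := by omega)]

/-- This is the trace property in disguise; it makes right multiplications adjointable as well. -/
theorem pair_adj {n : ℕ} (x y : P.V n) : P.pair (P.adj n x) (P.adj n y) = P.pair y x := by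
  rw [pair, pair, P.adj_adj]
  exact congrArg P.ev (nest_swap x (P.adj n y))

theorem pair_contract_right {i j r m p q : ℕ} (hm : m = r + i) (hp : p = j + r) (hq : q = j + i)
    (b : P.V m) (y : P.V p) (z : P.V q) :
    P.pair (P.contract r hp hm hq y b) z
      = P.pair y (P.contract i (b := r) hq (by omega) hp z (P.adj m b)) := by
  rw [← pair_adj z, adj_contract, ← pair_adj _ y, adj_contract, P.adj_adj]
  exact (pair_contract (r := j) (i := r) (j := i) hm (by omega) (by omega) b _ _).symm

/-- The bound must not depend on r. With a = b* b, the vector a^n y is the image under right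
multiplication by y of a^n in the fixed finite-dimensional space P_{j,j}, so it grows at most like
‖L‖^n; `norm_apply_le_of_iterate_le` removes the constant depending on y. -/
theorem exists_norm_contract_le {i j m : ℕ} (hm : m = i + j) (b : P.V m) :
    ∃ C : ℝ, 0 ≤ C ∧ ∀ {r p q : ℕ} (hp : p = j + r) (hq : q = i + r) (y : P.V p),
      ‖P.contract j hm hp hq b y‖ ≤ C * ‖y‖ := by
  set a : P.V (j + j) := P.contract i (by omega) hm rfl (P.adj m b) b with ha
  let L : P.V (j + j) →L[ℂ] P.V (j + j) := LinearMap.toContinuousLinearMap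
    (P.contract j rfl rfl rfl a)
  refine ⟨Real.sqrt ‖L‖, Real.sqrt_nonneg _, fun {r p q} hp hq y => ?_⟩
  let T : P.V p → P.V p := fun y => P.contract j rfl hp hp a y
  have hba : ∀ y, P.contract i (by omega) hq hp (P.adj m b) (P.contract j hm hp hq b y) = T y := by
    intro y
    simp only [T, ha]
    rw [contract_assoc (h := by omega)]
  have hT : ∀ x y, ⟪T x, y⟫_ℂ = ⟪x, T y⟫_ℂ := by
    intro x y
    rw [inner_eq, inner_eq, ← hba, ← hba, ← conj_pair, ← pair_contract, ← pair_contract,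
      conj_pair]
  let R : P.V (j + j) →L[ℂ] P.V p := LinearMap.toContinuousLinearMap
    ((P.contract j rfl hp hp).flip y)
  have hiter : ∀ n, T^[n] y = R ((fun x => L x)^[n] (P.idn j)) := by
    intro n
    induction n with
    | zero => exact (idn_contract hp y).symm
    | succ n ih =>
      rw [Function.iterate_succ_apply', Function.iterate_succ_apply', ih]
      simp only [T, R, L, LinearMap.coe_toContinuousLinearMap', LinearMap.flip_apply]
      exact (contract_assoc (h := by omega) ..).symm
  have hn : ∀ n, ‖(fun x => L x)^[n] (P.idn j)‖ ≤ ‖L‖ ^ n * ‖P.idn j‖ := by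
    intro n
    induction n with
    | zero => simp
    | succ n ih =>
      rw [Function.iterate_succ_apply', pow_succ', mul_assoc]
      exact (L.le_opNorm _).trans (by gcongr)
  have key := norm_apply_le_of_iterate_le T hT (ξ := y) (D := ‖R‖ * ‖P.idn j‖) (N := ‖L‖)
    (norm_nonneg _) (fun n => by
      rw [hiter]
      refine (R.le_opNorm _).trans ?_
      have := mul_le_mul_of_nonneg_left (hn n) (norm_nonneg R)
      linarith)
  have h1 : ‖P.contract j hm hp hq b y‖ ^ 2 ≤ ‖L‖ * ‖y‖ ^ 2 := by
    rw [← inner_self_eq_norm_sq (𝕜 := ℂ), inner_eq, pair_contract, hba, ← inner_eq]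
    refine (Complex.re_le_norm _).trans ((norm_inner_le_norm _ _).trans ?_)
    nlinarith [norm_nonneg y]
  rw [← Real.sqrt_sq (norm_nonneg y), ← Real.sqrt_mul (norm_nonneg _)]
  exact Real.le_sqrt_of_sq_le h1

/-- A minimal right ideal I of P_{j,j} inside the orthogonal complement of J and inside the range of
r is generated by a minimal projection: the orthogonal projection of 1 to I. -/
theorem exists_minimal_projection {j : ℕ} (J : Submodule ℂ (P.V (j + j)))
    (hl : ∀ b x : P.V (j + j), x ∈ J → P.contract j rfl rfl rfl b x ∈ J)
    (hr : ∀ b x : P.V (j + j), x ∈ J → P.contract j rfl rfl rfl x b ∈ J)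
    (r : P.V (j + j)) (hrr : P.contract j rfl rfl rfl r r = r)
    (hrJ : r ∉ J) :
    ∃ q : P.V (j + j), P.adj _ q = q ∧ P.contract j rfl rfl rfl q q = q ∧ q ≠ 0 ∧
      (∀ x : P.V (j + j), ∃ c : ℂ, P.contract j rfl rfl rfl
        (P.contract j rfl rfl rfl q x : P.V (j + j)) q = c • q) ∧
      q ∉ J ∧ P.contract j rfl rfl rfl r q = q := by
  let M : P.V (j + j) →ₗ[ℂ] P.V (j + j) →ₗ[ℂ] P.V (j + j) := P.contract j rfl rfl rfl
  have massoc : ∀ x y z, M (M x y) z = M x (M y z) := fun x y z => contract_assoc (h := by omega) ..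
  have madj : ∀ x y, P.adj _ (M x y) = M (P.adj _ y) (P.adj _ x) := fun x y => adj_contract ..
  have onem : ∀ x, M (P.idn j) x = x := fun x => idn_contract rfl x
  have innerl : ∀ b x y, ⟪M b x, y⟫_ℂ = ⟪x, M (P.adj _ b) y⟫_ℂ := fun b x y =>
    pair_contract rfl rfl rfl b x y
  have innerr : ∀ b x y, ⟪M x b, y⟫_ℂ = ⟪x, M y (P.adj _ b)⟫_ℂ := fun b x y =>
    pair_contract_right rfl rfl rfl b x y
  change ∃ q : P.V (j + j), P.adj _ q = q ∧ M q q = q ∧ q ≠ 0 ∧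
      (∀ x, ∃ c : ℂ, M (M q x) q = c • q) ∧ q ∉ J ∧ M r q = q
  change ∀ b x, x ∈ J → M b x ∈ J at hl
  change ∀ b x, x ∈ J → M x b ∈ J at hr
  change M r r = r at hrr
  let S : Set (Submodule ℂ (P.V (j + j))) :=
    {I | I ≠ ⊥ ∧ (∀ x ∈ I, ∀ b, M x b ∈ I) ∧ I ≤ Jᗮ ∧ ∀ x ∈ I, M r x = x}
  have hperp : ∀ I : Submodule ℂ (P.V (j + j)), (∀ x ∈ I, ∀ b, M x b ∈ I) →
      ∀ x ∈ Iᗮ, ∀ b, M x b ∈ Iᗮ := by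
    intro I hI x hx b
    rw [Submodule.mem_orthogonal'] at hx ⊢
    intro u hu
    rw [innerr]
    exact hx _ (hI _ hu _)
  have hS : S.Nonempty := by
    -- Nonzero: if r = a + b with a in J and b orthogonal to J, then r b - b lies in J and in its
    -- complement, so b is fixed by r; and b = 0 would put r into J.
    refine ⟨Jᗮ ⊓ LinearMap.ker (M r - LinearMap.id), ?_, ?_, inf_le_left, ?_⟩
    · intro hbot
      obtain ⟨a, ha, b, hb, hab⟩ := Submodule.exists_add_mem_mem_orthogonal (K := J) r
      have hMb : M r b ∈ Jᗮ := by
        rw [Submodule.mem_orthogonal'] at hb ⊢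
        intro u hu
        rw [innerl]
        exact hb _ (hl _ _ hu)
      have h1 : M r a - a = b - M r b := by
        rw [sub_eq_sub_iff_add_eq_add, ← map_add, ← hab, hrr, add_comm b a, ← hab]
      have h2 : b - M r b ∈ J ⊓ Jᗮ := ⟨h1 ▸ J.sub_mem (hl _ _ ha) ha, Jᗮ.sub_mem hb hMb⟩
      rw [Submodule.inf_orthogonal_eq_bot, Submodule.mem_bot, sub_eq_zero] at h2
      have h3 : b ∈ Jᗮ ⊓ LinearMap.ker (M r - LinearMap.id) := ⟨hb, by simp [← h2]⟩
      rw [hbot, Submodule.mem_bot] at h3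
      rw [h3, add_zero] at hab
      exact hrJ (hab ▸ ha)
    · intro x hx b
      refine ⟨hperp J (fun x hx b => hr b x hx) x hx.1 b, ?_⟩
      refine LinearMap.mem_ker.2 ?_
      have := LinearMap.mem_ker.1 hx.2
      simp only [LinearMap.sub_apply, LinearMap.id_apply, sub_eq_zero] at this ⊢
      rw [← massoc, this]
    · intro x hx
      have := LinearMap.mem_ker.1 hx.2
      simpa only [LinearMap.sub_apply, LinearMap.id_apply, sub_eq_zero] using this
  obtain ⟨I, ⟨hI0, hIr, hIJ, hIM⟩, hmin⟩ := (wellFounded_lt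
    (α := Submodule ℂ (P.V (j + j)))).has_min S hS
  obtain ⟨q, hq, e', he', hqe⟩ := Submodule.exists_add_mem_mem_orthogonal (K := I) (P.idn j)
  have hqy : ∀ y ∈ I, M q y = y := by
    intro y hy
    have h1 : M q y + M e' y = y := by
      rw [← LinearMap.add_apply, ← map_add, ← hqe, onem]
    have h2 : y - M q y ∈ I ⊓ Iᗮ := by
      refine ⟨I.sub_mem hy (hIr _ hq _), ?_⟩
      have : y - M q y = M e' y :=
        sub_eq_iff_eq_add.2 ((add_comm _ _).trans h1).symm
      rw [this]
      exact hperp I hIr _ he' _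
    rw [Submodule.inf_orthogonal_eq_bot, Submodule.mem_bot, sub_eq_zero] at h2
    exact h2.symm
  -- With e' = 1 - q one has e' x ⟂ I for all x, hence e'* q = 0, that is q = q* q.
  have hqa : P.adj _ q = q := by
    have h0 : ∀ x, ⟪x, M (P.adj _ e') q⟫_ℂ = 0 := by
      intro x
      rw [← innerl]
      exact (Submodule.mem_orthogonal' I _).1 (hperp I hIr _ he' x) _ hq
    have h1 : M (P.adj _ e') q = 0 := inner_self_eq_zero (𝕜 := ℂ).1 (h0 _)
    have h2 : e' = P.idn j - q := by rw [hqe]; abel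
    rw [h2, map_sub, adj_idn, map_sub, LinearMap.sub_apply, onem, sub_eq_zero] at h1
    have h3 := congrArg (P.adj _) h1
    rw [madj, P.adj_adj] at h3
    rw [h3, ← h1]
  have hq0 : q ≠ 0 := by
    rintro rfl
    refine hI0 ((Submodule.eq_bot_iff _).2 fun y hy => ?_)
    rw [← hqy y hy]
    simp
  refine ⟨q, hqa, hqy q hq, hq0, fun x => ?_, fun hqJ => ?_, hIM q hq⟩
  -- Schur's argument: an eigenspace of y ↦ q x y on I is again a right ideal in the same family,
  -- hence all of I; evaluating at q gives q x q = c q.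
  · let f : I →ₗ[ℂ] I := ((M q).comp (M x)).restrict (p := I) (q := I) fun y _ => hIr _ hq _
    have : Nontrivial I := Submodule.nontrivial_iff_ne_bot.2 hI0
    obtain ⟨c, hc⟩ := Module.End.exists_eigenvalue f
    obtain ⟨y, hy⟩ := hc.exists_hasEigenvector
    have hyI := y.2
    have hfy : M q (M x y) = c • (y : P.V (j + j)) := congrArg Subtype.val hy.apply_eq_smul
    let I' : Submodule ℂ (P.V (j + j)) := I ⊓ LinearMap.ker ((M q).comp (M x) - c • LinearMap.id)
    have hI' : ∀ z, z ∈ I' ↔ z ∈ I ∧ M q (M x z) = c • z := by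
      intro z
      simp [I', sub_eq_zero]
    have hI'S : I' ∈ S := by
      refine ⟨?_, ?_, inf_le_left.trans hIJ, fun z hz => hIM z hz.1⟩
      · intro hbot
        have : (y : P.V (j + j)) ∈ I' := (hI' _).2 ⟨hyI, hfy⟩
        rw [hbot, Submodule.mem_bot] at this
        exact hy.2 (Subtype.ext this)
      · intro z hz b
        rw [hI'] at hz ⊢
        refine ⟨hIr _ hz.1 _, ?_⟩
        rw [← massoc, ← massoc, massoc q, hz.2]
        simp
    have hle : I' ≤ I := inf_le_left
    have heq : I' = I := by
      by_contra hne
      exact hmin I' hI'S (lt_of_le_of_ne hle hne)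
    refine ⟨c, ?_⟩
    rw [massoc]
    exact ((hI' q).1 (heq ▸ hq)).2
  · exact hq0 (inner_self_eq_zero (𝕜 := ℂ).1 ((Submodule.mem_orthogonal J q).1 (hIJ hq) q hqJ))

end FactorPlanarAlgebra

/-! ### Compatibility of the Temperley-Lieb sum and of caps with composition. -/

namespace PlanarAlgebra

variable {P : PlanarAlgebra.{u}}

/-- The scan only touches the top strings of y, which x does not meet. -/
theorem scanR_contract {N t r a s b d m n p p' q qa : ℕ} {hm : m = a + r} {hb : n = r + b}
    {hc : q = a + b} (hn : n = r + N + s) (hp : p = r + t + s) (hd : p' = a + d) (hqa : qa = a + s)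
    (h₁ : a ≤ qa) (h₂ : q = qa + N) (h₃ : p' = qa + t) (x : P.V m) (y : P.V n) :
    (scanR N t a h₁ h₂ h₃ (P.contract r hm hb hc x y : P.V q) : P.V p')
      = P.contract r hm (by omega : p = r + d) hd x
        (scanR N t r (by omega : r ≤ r + s) (by omega) (by omega) y : P.V p) := by
  subst hqa
  obtain rfl : d = t + s := by omega
  rw [contract_apply (q := m + n) _ _ _ rfl, contract_apply (q := m + p) _ _ _ rfl,
    scanR_nest (b' := a + 2 * r) (q' := m + (r + s)) (n := m + p)
      (by omega) le_rfl (by omega) (by omega) (by omega) (by omega)]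
  have e : a + 2 * r = m + r := by omega
  simp only [e]
  rw [scanR_ins (b := r) (q := r + s) (n := p) (by omega) (by omega) (by omega)
      (by omega) (by omega) (by omega)]

theorem contract_congr {r a b a' b' m m' n : ℕ} (hx : m = a + r) (hy : m' = r + b) (hn : n = a + b)
    (hx' : m = a' + r) (hy' : m' = r + b') (hn' : n = a' + b') (x : P.V m) (y : P.V m') :
    P.contract r hx hy hn x y = P.contract r hx' hy' hn' x y := by
  obtain rfl : a = a' := by omega
  obtain rfl : b = b' := by omega
  rfl

theorem cap_contract {a r b m m' n n' : ℕ} (hm : m = a + 1 + r) (hm' : m' = r + 1 + b)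
    (hn : n = a + 1 + (1 + b)) (hn' : n' = a + b) (x : P.V m) (y : P.V m') :
    P.cap a (by omega) (by omega)
        (P.contract r hm (by omega : m' = r + (1 + b)) hn x y)
      = P.contract (r + 1) (by omega : m = a + (r + 1)) hm' hn' x y := by
  rw [contract_apply (q := m + m') _ _ _ rfl, contract_apply (q := m + m') _ _ _ rfl,
    nest_one_add (by omega) (by omega)]

end PlanarAlgebra

/-! ### The filtered picture: a Fock space with creation and annihilation operators. -/

namespace FactorPlanarAlgebra

variable {P : FactorPlanarAlgebra.{u}}
open PlanarAlgebra

/-- The direct sum of the box spaces with `j` strings on the left and `s` strings on the right. -/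
def Tot (P : FactorPlanarAlgebra.{u}) (j s : ℕ) : Type u := DirectSum ℕ fun N => P.V (j + N + s)

noncomputable instance (j s : ℕ) : AddCommGroup (P.Tot j s) :=
  inferInstanceAs (AddCommGroup (DirectSum ℕ fun N => P.V (j + N + s)))

noncomputable instance (j s : ℕ) : Module ℂ (P.Tot j s) :=
  inferInstanceAs (Module ℂ (DirectSum ℕ fun N => P.V (j + N + s)))

namespace Tot

/-- The inclusion of the summand with `N` top strings. -/
noncomputable def of {j s : ℕ} (N : ℕ) {n : ℕ} (h : n = j + N + s) : P.V n →ₗ[ℂ] P.Tot j s :=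
  DirectSum.lof ℂ ℕ (fun N => P.V (j + N + s)) N ∘ₗ P.cast h

/-- The component with `t` top strings. -/
noncomputable def comp {j s : ℕ} (t : ℕ) {n : ℕ} (h : n = j + t + s) : P.Tot j s →ₗ[ℂ] P.V n :=
  P.cast h.symm ∘ₗ DirectSum.component ℂ ℕ (fun N => P.V (j + N + s)) t

/-- The linear map with given values on the summands. -/
noncomputable def lift {j s : ℕ} {W : Type*} [AddCommGroup W] [Module ℂ W]
    (φ : (N : ℕ) → P.V (j + N + s) →ₗ[ℂ] W) : P.Tot j s →ₗ[ℂ] W :=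
  DirectSum.toModule ℂ ℕ W φ

variable {i j l s : ℕ}

theorem lift_of {W : Type*} [AddCommGroup W] [Module ℂ W]
    (φ : (N : ℕ) → P.V (j + N + s) →ₗ[ℂ] W) (N : ℕ) (x : P.V (j + N + s)) :
    lift φ (of N rfl x) = φ N x := DirectSum.toModule_lof ..

@[simp] theorem comp_of {N n : ℕ} (h h' : n = j + N + s) (x : P.V n) : comp N h' (of N h x) = x := by
  subst h
  exact DirectSum.component.lof_self ..

theorem comp_of_ne {N t n m : ℕ} (hN : N ≠ t) (h : n = j + N + s) (h' : m = j + t + s) (x : P.V n) :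
    comp t h' (of N h x) = 0 := by
  subst h h'
  exact (DirectSum.component.of (R := ℂ) (M := fun N => P.V (j + N + s)) t N x).trans (dif_neg hN)

theorem ext {x y : P.Tot j s} (h : ∀ t, comp t rfl x = comp t rfl y) : x = y :=
  DFinsupp.ext h

@[elab_as_elim]
theorem induction {C : P.Tot j s → Prop} (x : P.Tot j s) (h0 : C 0)
    (h1 : ∀ N y, C (of N rfl y)) (h2 : ∀ y z, C y → C z → C (y + z)) : C x :=
  DirectSum.induction_on x h0 h1 h2

/-- The sum of the inner products of the components. -/
noncomputable def fockInner (x : P.Tot j s) : P.Tot j s →ₗ[ℂ] ℂ :=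
  lift fun N => innerₛₗ ℂ (comp N rfl x)

theorem fockInner_of (x : P.Tot j s) {N n : ℕ} (h : n = j + N + s) (y : P.V n) :
    fockInner x (of N h y) = ⟪comp N h x, y⟫_ℂ := by
  subst h
  exact lift_of ..

theorem exists_fockInner_eq_sum (x y : P.Tot j s) : ∃ K₀, ∀ K, K₀ ≤ K →
    fockInner x y = ∑ t ∈ Finset.range K, ⟪comp t rfl x, comp t rfl y⟫_ℂ := by
  induction y using induction with
  | h0 => exact ⟨0, fun K _ => by simp⟩
  | h1 N y =>
    refine ⟨N + 1, fun K hK => ?_⟩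
    rw [fockInner_of, Finset.sum_eq_single_of_mem N (by simp; omega), comp_of]
    intro t _ ht
    rw [comp_of_ne ht.symm, inner_zero_right]
  | h2 y z hy hz =>
    obtain ⟨K₁, h₁⟩ := hy
    obtain ⟨K₂, h₂⟩ := hz
    refine ⟨max K₁ K₂, fun K hK => ?_⟩
    simp only [map_add, h₁ K (le_trans (le_max_left _ _) hK),
      h₂ K (le_trans (le_max_right _ _) hK), inner_add_right, Finset.sum_add_distrib]

noncomputable abbrev fockCore (P : FactorPlanarAlgebra.{u}) (j s : ℕ) :
    PreInnerProductSpace.Core ℂ (P.Tot j s) where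
  inner x y := fockInner x y
  conj_inner_symm x y := by
    obtain ⟨K₁, h₁⟩ := exists_fockInner_eq_sum x y
    obtain ⟨K₂, h₂⟩ := exists_fockInner_eq_sum y x
    simp only [h₁ _ (le_max_left K₁ K₂), h₂ _ (le_max_right K₁ K₂), map_sum, inner_conj_symm]
  re_inner_nonneg x := by
    obtain ⟨K, h⟩ := exists_fockInner_eq_sum x x
    rw [h K le_rfl]
    simp only [RCLike.re_to_complex, Complex.re_sum]
    exact Finset.sum_nonneg fun t _ => inner_self_nonneg (𝕜 := ℂ)
  add_left x y z := by
    induction z using induction with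
    | h0 => simp
    | h1 N z => simp [fockInner_of]
    | h2 z w hz hw => simp only [map_add, hz, hw]; ring
  smul_left x y r := by
    induction y using induction with
    | h0 => simp
    | h1 N z => simp [fockInner_of, mul_comm]
    | h2 z w hz hw => simp only [map_add, hz, hw]; ring

noncomputable instance : SeminormedAddCommGroup (P.Tot j s) :=
  letI := fockCore P j s
  InnerProductSpace.Core.toSeminormedAddCommGroup (𝕜 := ℂ)

noncomputable instance : InnerProductSpace ℂ (P.Tot j s) :=
  InnerProductSpace.ofCore (fockCore P j s)

theorem inner_eq (x y : P.Tot j s) : ⟪x, y⟫_ℂ = fockInner x y := rfl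

theorem inner_of (x : P.Tot j s) {N n : ℕ} (h : n = j + N + s) (y : P.V n) :
    ⟪x, of N h y⟫_ℂ = ⟪comp N h x, y⟫_ℂ := fockInner_of ..

theorem exists_norm_sq_eq_sum (x : P.Tot j s) : ∃ K₀, ∀ K, K₀ ≤ K →
    ‖x‖ ^ 2 = ∑ t ∈ Finset.range K, ‖comp t rfl x‖ ^ 2 := by
  obtain ⟨K₀, h⟩ := exists_fockInner_eq_sum x x
  refine ⟨K₀, fun K hK => ?_⟩
  have h2 := congrArg Complex.re (h K hK)
  rw [← inner_eq, Complex.re_sum] at h2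
  rw [← inner_self_eq_norm_sq (𝕜 := ℂ)]
  refine h2.trans (Finset.sum_congr rfl fun t _ => ?_)
  exact inner_self_eq_norm_sq (𝕜 := ℂ) _

/-- The left action of an element without top strings. -/
noncomputable def act {m : ℕ} (h : m = i + j) (b : P.V m) : P.Tot j s →ₗ[ℂ] P.Tot i s :=
  lift fun N => of N rfl ∘ₗ
    P.contract j h (by omega : j + N + s = j + (N + s)) (by omega) b

/-- The creation operator of an element with one top string. -/
noncomputable def cr {m : ℕ} (h : m = j + 1 + l) (e : P.V m) : P.Tot l s →ₗ[ℂ] P.Tot j s :=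
  lift fun N => of (N + 1) rfl ∘ₗ
    P.contract l h (by omega : l + N + s = l + (N + s)) (by omega) e

/-- The annihilation operator of an element with one top string. -/
noncomputable def an {m : ℕ} (h : m = j + 1 + l) (e : P.V m) : P.Tot j s →ₗ[ℂ] P.Tot l s :=
  lift fun
    | 0 => 0
    | N + 1 => of N rfl ∘ₗ
      P.contract (j + 1) (a := l) (by omega) (by omega : j + (N + 1) + s = j + 1 + (N + s)) (by omega)
        (P.adj m e)

theorem act_of {m N n n' : ℕ} (h : m = i + j) (hn : n = j + N + s) (hn' : n' = i + N + s)
    (b : P.V m) (v : P.V n) :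
    act h b (of N hn v) = of N hn' (P.contract j h (by omega : n = j + (N + s)) (by omega) b v) := by
  subst hn hn'
  exact lift_of ..

theorem cr_of {m N n n' : ℕ} (h : m = j + 1 + l) (hn : n = l + N + s) (hn' : n' = j + (N + 1) + s)
    (e : P.V m) (v : P.V n) :
    cr h e (of N hn v)
      = of (N + 1) hn' (P.contract l h (by omega : n = l + (N + s)) (by omega) e v) := by
  subst hn hn'
  exact lift_of ..

theorem an_of_zero {m n : ℕ} (h : m = j + 1 + l) (hn : n = j + 0 + s) (e : P.V m) (v : P.V n) :
    an h e (of 0 hn v : P.Tot j s) = 0 := by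
  subst hn
  exact lift_of ..

theorem an_of_succ {m N n n' : ℕ} (h : m = j + 1 + l) (hn : n = j + (N + 1) + s)
    (hn' : n' = l + N + s) (e : P.V m) (v : P.V n) :
    an h e (of (N + 1) hn v)
      = of N hn' (P.contract (j + 1) (a := l) (by omega) (by omega : n = j + 1 + (N + s)) (by omega)
        (P.adj m e) v) := by
  subst hn hn'
  exact lift_of ..

theorem comp_act {m t n n' : ℕ} (h : m = i + j) (hn : n = i + t + s) (hn' : n' = j + t + s)
    (b : P.V m) (x : P.Tot j s) :
    comp t hn (act h b x)
      = P.contract j h (by omega : n' = j + (t + s)) (by omega) b (comp t hn' x) := by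
  induction x using induction with
  | h0 => simp
  | h2 x y hx hy => simp only [map_add, hx, hy]
  | h1 N v =>
    rw [act_of (n' := i + N + s) _ _ rfl]
    by_cases hN : N = t
    · subst hN hn hn'
      rw [comp_of, comp_of]
    · rw [comp_of_ne hN, comp_of_ne hN, map_zero]

theorem comp_zero_cr {m n : ℕ} (h : m = j + 1 + l) (hn : n = j + 0 + s)
    (e : P.V m) (x : P.Tot l s) : comp 0 hn (cr h e x) = 0 := by
  induction x using induction with
  | h0 => simp
  | h2 x y hx hy => simp only [map_add, hx, hy, add_zero]
  | h1 N v =>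
    rw [cr_of (n' := j + (N + 1) + s) _ _ rfl, comp_of_ne (by omega)]

theorem comp_succ_cr {m t n n' : ℕ} (h : m = j + 1 + l) (hn : n = j + (t + 1) + s)
    (hn' : n' = l + t + s) (e : P.V m) (x : P.Tot l s) :
    comp (t + 1) hn (cr h e x)
      = P.contract l h (by omega : n' = l + (t + s)) (by omega) e (comp t hn' x) := by
  induction x using induction with
  | h0 => simp
  | h2 x y hx hy => simp only [map_add, hx, hy]
  | h1 N v =>
    rw [cr_of (n' := j + (N + 1) + s) _ _ rfl]
    by_cases hN : N = t
    · subst hN hn hn'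
      rw [comp_of, comp_of]
    · rw [comp_of_ne (by omega), comp_of_ne hN, map_zero]

theorem comp_an {m t n n' : ℕ} (h : m = j + 1 + l) (hn : n = l + t + s)
    (hn' : n' = j + (t + 1) + s) (e : P.V m) (x : P.Tot j s) :
    comp t hn (an h e x)
      = P.contract (j + 1) (a := l) (by omega) (by omega : n' = j + 1 + (t + s)) (by omega)
        (P.adj m e) (comp (t + 1) hn' x) := by
  induction x using induction with
  | h0 => simp
  | h2 x y hx hy => simp only [map_add, hx, hy]
  | h1 N v =>
    cases N with
    | zero => rw [an_of_zero, comp_of_ne (by omega), map_zero, map_zero]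
    | succ N =>
      rw [an_of_succ (n' := l + N + s) _ _ rfl]
      by_cases hN : N = t
      · subst hN hn hn'
        rw [comp_of, comp_of]
      · rw [comp_of_ne hN, comp_of_ne (by omega), map_zero]

theorem inner_act_left {m : ℕ} (h : m = i + j) (b : P.V m) (x : P.Tot j s) (y : P.Tot i s) :
    ⟪act h b x, y⟫_ℂ = ⟪x, act (by omega : m = j + i) (P.adj m b) y⟫_ℂ := by
  induction y using induction with
  | h0 => simp
  | h2 y z hy hz => simp only [map_add, inner_add_right, hy, hz]
  | h1 N v =>
    rw [act_of (n' := j + N + s) _ _ rfl, inner_of, inner_of, comp_act (n' := j + N + s) _ _ rfl]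
    exact pair_contract ..

theorem inner_cr_left {m : ℕ} (h : m = j + 1 + l) (e : P.V m) (x : P.Tot l s) (y : P.Tot j s) :
    ⟪cr h e x, y⟫_ℂ = ⟪x, an h e y⟫_ℂ := by
  induction y using induction with
  | h0 => simp
  | h2 y z hy hz => simp only [map_add, inner_add_right, hy, hz]
  | h1 N v =>
    cases N with
    | zero => rw [an_of_zero, inner_of, comp_zero_cr, inner_zero_left, inner_zero_right]
    | succ N =>
      rw [an_of_succ (n' := l + N + s) _ _ rfl, inner_of, inner_of,
        comp_succ_cr (n' := l + N + s) _ _ rfl]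
      exact pair_contract ..

theorem inner_an_left {m : ℕ} (h : m = j + 1 + l) (e : P.V m) (x : P.Tot j s) (y : P.Tot l s) :
    ⟪an h e x, y⟫_ℂ = ⟪x, cr h e y⟫_ℂ := by
  rw [← inner_conj_symm, ← inner_cr_left, inner_conj_symm]

theorem act_act {m m' m'' : ℕ} (h : m = i + j) (h' : m' = j + l) (h'' : m'' = i + l) (b : P.V m)
    (b' : P.V m') (x : P.Tot l s) :
    act h b (act h' b' x) = act h'' (P.contract j h h' h'' b b') x := by
  induction x using induction with
  | h0 => simp
  | h2 x y hx hy => simp only [map_add, hx, hy]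
  | h1 N v =>
    rw [act_of (n' := j + N + s) _ _ rfl, act_of (n' := i + N + s) _ _ rfl,
      act_of (n' := i + N + s) _ _ rfl, contract_assoc (h := by omega)]

theorem act_cr {i' m m' m'' : ℕ} (h : m = i' + j) (h' : m' = j + 1 + l) (h'' : m'' = i' + 1 + l)
    (b : P.V m) (e : P.V m') (x : P.Tot l s) :
    act h b (cr h' e x)
      = cr h'' (P.contract j h (by omega : m' = j + (1 + l)) (by omega) b e) x := by
  induction x using induction with
  | h0 => simp
  | h2 x y hx hy => simp only [map_add, hx, hy]
  | h1 N v =>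
    rw [cr_of (n' := j + (N + 1) + s) _ _ rfl, act_of (n' := i' + (N + 1) + s) _ _ rfl,
      cr_of (n' := i' + (N + 1) + s) _ _ rfl, contract_assoc (h := by omega)]

/-- The relation of Cuntz-Toeplitz type from which all norms and isometry relations of creation
operators are computed. -/
theorem an_cr {l' m m' m'' : ℕ} (h : m = j + 1 + l) (h' : m' = j + 1 + l') (h'' : m'' = l + l')
    (e : P.V m) (e' : P.V m') (x : P.Tot l' s) :
    an h e (cr h' e' x)
      = act h'' (P.contract (j + 1) (a := l) (by omega) h' h'' (P.adj m e) e') x := by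
  induction x using induction with
  | h0 => simp
  | h2 x y hx hy => simp only [map_add, hx, hy]
  | h1 N v =>
    rw [cr_of (n' := j + (N + 1) + s) _ _ rfl, an_of_succ (n' := l + N + s) _ _ rfl,
      act_of (n' := l + N + s) _ _ rfl, contract_assoc (h := by omega)]

theorem act_idn (x : P.Tot j s) : act rfl (P.idn j) x = x := by
  induction x using induction with
  | h0 => simp
  | h2 x y hx hy => simp only [map_add, hx, hy]
  | h1 N v =>
    rw [act_of (n' := j + N + s) _ _ rfl]
    congr 1
    exact idn_contract (by omega) v

theorem exists_norm_act_le {m : ℕ} (h : m = i + j) (b : P.V m) :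
    ∃ C : ℝ, 0 ≤ C ∧ ∀ {s : ℕ} (x : P.Tot j s), ‖act h b x‖ ≤ C * ‖x‖ := by
  obtain ⟨C, hC, hb⟩ := exists_norm_contract_le h b
  refine ⟨C, hC, fun {s} x => ?_⟩
  obtain ⟨K₁, h₁⟩ := exists_norm_sq_eq_sum x
  obtain ⟨K₂, h₂⟩ := exists_norm_sq_eq_sum (act h b x)
  refine le_of_sq_le_sq ?_ (by positivity)
  rw [mul_pow, h₁ _ (le_max_left K₁ K₂), h₂ _ (le_max_right K₁ K₂), Finset.mul_sum]
  refine Finset.sum_le_sum fun t _ => ?_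
  rw [comp_act (n' := j + t + s) _ _ rfl, ← mul_pow]
  gcongr
  exact hb ..

/-- The square ‖cr e x‖² is the inner product of x with the action of e* e, an element without top
strings. -/
theorem exists_norm_cr_le {m : ℕ} (h : m = j + 1 + l) (e : P.V m) :
    ∃ C : ℝ, 0 ≤ C ∧ ∀ {s : ℕ} (x : P.Tot l s), ‖cr h e x‖ ≤ C * ‖x‖ := by
  obtain ⟨C, hC, hb⟩ := exists_norm_act_le (P := P) (i := l) (j := l) rfl
    (P.contract (j + 1) (a := l) (by omega) h rfl (P.adj m e) e)
  refine ⟨Real.sqrt C, Real.sqrt_nonneg _, fun {s} x => ?_⟩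
  rw [← Real.sqrt_sq (norm_nonneg x), ← Real.sqrt_mul hC]
  refine Real.le_sqrt_of_sq_le ?_
  rw [← inner_self_eq_norm_sq (𝕜 := ℂ), inner_cr_left, an_cr h h rfl]
  refine (Complex.re_le_norm _).trans ((norm_inner_le_norm _ _).trans ?_)
  nlinarith [norm_nonneg x, hb x]

theorem norm_adjoint_le {E F : Type*} [SeminormedAddCommGroup E] [InnerProductSpace ℂ E]
    [SeminormedAddCommGroup F] [InnerProductSpace ℂ F] {T : E → F} {T' : F → E}
    (hT : ∀ x y, ⟪T x, y⟫_ℂ = ⟪x, T' y⟫_ℂ) {C : ℝ} (hC : 0 ≤ C) (h : ∀ x, ‖T x‖ ≤ C * ‖x‖) (y : F) :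
    ‖T' y‖ ≤ C * ‖y‖ := by
  have h1 : ‖T' y‖ ^ 2 ≤ C * ‖y‖ * ‖T' y‖ := by
    rw [← inner_self_eq_norm_sq (𝕜 := ℂ), ← hT]
    refine (Complex.re_le_norm _).trans ((norm_inner_le_norm _ _).trans ?_)
    nlinarith [norm_nonneg y, h (T' y)]
  rcases (norm_nonneg (T' y)).eq_or_lt with h0 | h0
  · rw [← h0]; positivity
  · nlinarith

theorem exists_norm_an_le {m : ℕ} (h : m = j + 1 + l) (e : P.V m) :
    ∃ C : ℝ, 0 ≤ C ∧ ∀ {s : ℕ} (x : P.Tot j s), ‖an h e x‖ ≤ C * ‖x‖ := by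
  obtain ⟨C, hC, hb⟩ := exists_norm_cr_le h e
  exact ⟨C, hC, fun x => norm_adjoint_le (inner_cr_left h e) hC hb x⟩

end Tot

end FactorPlanarAlgebra

/-! ### The graded bimodules and their left multiplications. -/

namespace FactorPlanarAlgebra

variable {P : FactorPlanarAlgebra.{u}}
open PlanarAlgebra

/-- The graded bimodule of diagrams with `j` strings on the left and `s` strings on the right. -/
def Bim (P : FactorPlanarAlgebra.{u}) (j s : ℕ) : Type u := DirectSum ℕ fun N => P.V (j + N + s)

noncomputable instance (j s : ℕ) : AddCommGroup (P.Bim j s) :=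
  inferInstanceAs (AddCommGroup (DirectSum ℕ fun N => P.V (j + N + s)))

noncomputable instance (j s : ℕ) : Module ℂ (P.Bim j s) :=
  inferInstanceAs (Module ℂ (DirectSum ℕ fun N => P.V (j + N + s)))

namespace Bim

/-- The inclusion of the summand with `N` top strings. -/
noncomputable def of {j s : ℕ} (N : ℕ) {n : ℕ} (h : n = j + N + s) : P.V n →ₗ[ℂ] P.Bim j s :=
  DirectSum.lof ℂ ℕ (fun N => P.V (j + N + s)) N ∘ₗ P.cast h

/-- The linear map with given values on the summands. -/
noncomputable def lift {j s : ℕ} {W : Type*} [AddCommGroup W] [Module ℂ W]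
    (φ : (N : ℕ) → P.V (j + N + s) →ₗ[ℂ] W) : P.Bim j s →ₗ[ℂ] W :=
  DirectSum.toModule ℂ ℕ W φ

variable {i j l r s : ℕ}

theorem lift_of {W : Type*} [AddCommGroup W] [Module ℂ W]
    (φ : (N : ℕ) → P.V (j + N + s) →ₗ[ℂ] W) (N : ℕ) (x : P.V (j + N + s)) :
    lift φ (of N rfl x) = φ N x := DirectSum.toModule_lof ..

@[elab_as_elim]
theorem induction {C : P.Bim j s → Prop} (x : P.Bim j s) (h0 : C 0)
    (h1 : ∀ N y, C (of N rfl y)) (h2 : ∀ y z, C y → C z → C (y + z)) : C x :=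
  DirectSum.induction_on x h0 h1 h2

/-- The map from the graded to the filtered picture. -/
noncomputable def epi : P.Bim j s →ₗ[ℂ] P.Tot j s :=
  lift fun N => ∑ t ∈ Finset.range (N + 1), Tot.of t rfl ∘ₗ
    scanR N t j (by omega : j ≤ j + s) (by omega) (by omega : j + t + s = j + s + t)

theorem comp_epi_of {t N n n' : ℕ} (h : n = j + N + s) (h' : n' = j + t + s) (v : P.V n) :
    Tot.comp t h' (epi (of N h v))
      = scanR N t j (by omega : j ≤ j + s) (by omega) (by omega) v := by
  subst h h'
  rw [epi, lift_of, LinearMap.sum_apply, map_sum]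
  by_cases ht : t ∈ Finset.range (N + 1)
  · rw [Finset.sum_eq_single_of_mem t ht, LinearMap.comp_apply, Tot.comp_of]
    intro t' _ h
    rw [LinearMap.comp_apply, Tot.comp_of_ne h]
  · rw [Finset.sum_eq_zero, scanR_eq_zero _ _ _ (by simpa using ht)]
    intro t' h
    rw [LinearMap.comp_apply, Tot.comp_of_ne (by rintro rfl; exact ht h)]

/-- The form is pulled back along `epi`, so positivity is automatic. For j = s = k it is the form of
τ_k without the factor δ^{-k}, see `inner_gr_eq`. -/
noncomputable abbrev core (P : FactorPlanarAlgebra.{u}) (j s : ℕ) :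
    PreInnerProductSpace.Core ℂ (P.Bim j s) where
  inner x y := ⟪epi x, epi y⟫_ℂ
  conj_inner_symm x y := inner_conj_symm _ _
  re_inner_nonneg x := inner_self_nonneg
  add_left x y z := by rw [map_add, inner_add_left]
  smul_left x y r := by rw [map_smul, inner_smul_left]

noncomputable instance : SeminormedAddCommGroup (P.Bim j s) :=
  letI := core P j s
  InnerProductSpace.Core.toSeminormedAddCommGroup (𝕜 := ℂ)

noncomputable instance : InnerProductSpace ℂ (P.Bim j s) :=
  InnerProductSpace.ofCore (core P j s)

theorem inner_eq (x y : P.Bim j s) : ⟪x, y⟫_ℂ = ⟪epi x, epi y⟫_ℂ := rfl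

theorem norm_epi (x : P.Bim j s) : ‖epi x‖ = ‖x‖ := by
  rw [@norm_eq_sqrt_re_inner ℂ, @norm_eq_sqrt_re_inner ℂ _ _ _ _ x, inner_eq]

/-- The graded multiplication: the right strings of `x` are joined to the left strings of `y`. -/
noncomputable def mul (i j s : ℕ) : P.Bim i j →ₗ[ℂ] P.Bim j s →ₗ[ℂ] P.Bim i s :=
  lift fun N => (lift fun M =>
    ((P.contract j rfl (Nat.add_assoc j M s)
      (by omega : i + (N + M) + s = i + N + (M + s))).compr₂ (of (N + M) rfl)).flip).flip

local infixl:70 " ∧ₘ " => mul _ _ _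

theorem mul_of {N M K n m k : ℕ} (hK : K = N + M) (hn : n = i + N + j) (hm : m = j + M + s)
    (hk : k = i + K + s) (x : P.V n) (y : P.V m) :
    mul i j s (of N hn x) (of M hm y)
      = of K hk (P.contract j hn (by omega : m = j + (M + s)) (by omega) x y) := by
  subst hK hn hm hk
  simp [mul, lift_of]

theorem mul_mul (x : P.Bim i j) (y : P.Bim j l) (z : P.Bim l s) :
    mul i l s (mul i j l x y) z = mul i j s x (mul j l s y z) := by
  induction x using induction with
  | h0 => simp
  | h2 x x' hx hx' => simp only [map_add, LinearMap.add_apply, hx, hx']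
  | h1 N x =>
    induction y using induction with
    | h0 => simp
    | h2 x x' hx hx' => simp only [map_add, LinearMap.add_apply, hx, hx']
    | h1 M y =>
      induction z using induction with
      | h0 => simp
      | h2 x x' hx hx' => simp only [map_add, hx, hx']
      | h1 K z =>
        rw [mul_of (K := N + M) rfl _ _ rfl, mul_of (K := M + K) rfl _ _ rfl,
          mul_of (K := N + M + K) rfl _ _ rfl, mul_of (K := N + M + K) (by omega) _ _ rfl,
          contract_assoc (h := by omega)]

/-- The involution. -/
noncomputable def adj : P.Bim j s →ₛₗ[starRingEnd ℂ] P.Bim s j where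
  toFun := DFinsupp.mapRange (fun N x => P.cast (by omega : j + N + s = s + N + j) (P.adj _ x))
    fun _ => by simp
  map_add' := DFinsupp.mapRange_add _ _ fun _ => by simp
  map_smul' c x := by
    refine DFinsupp.ext fun N => ?_
    erw [DFinsupp.mapRange_apply, DFinsupp.smul_apply, DFinsupp.smul_apply,
      DFinsupp.mapRange_apply]
    rw [LinearMap.map_smulₛₗ, map_smul]

theorem adj_of {N n : ℕ} (h : n = j + N + s) (h' : n = s + N + j) (x : P.V n) :
    adj (of N h x) = of N h' (P.adj n x) := by
  subst h
  exact DFinsupp.mapRange_single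
    (f := fun N (x : P.V (j + N + s)) => P.cast (by omega : j + N + s = s + N + j) (P.adj _ x))
    (hf := fun _ => by simp)

theorem adj_adj (x : P.Bim j s) : adj (adj x) = x := by
  induction x using induction with
  | h0 => simp
  | h2 x x' hx hx' => simp only [map_add, hx, hx']
  | h1 N x => rw [adj_of _ (by omega), adj_of _ rfl, P.adj_adj]

theorem adj_mul (x : P.Bim i j) (y : P.Bim j s) :
    adj (mul i j s x y) = mul s j i (adj y) (adj x) := by
  induction x using induction with
  | h0 => simp
  | h2 x x' hx hx' => simp only [map_add, LinearMap.add_apply, hx, hx']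
  | h1 N x =>
    induction y using induction with
    | h0 => simp
    | h2 x x' hx hx' => simp only [map_add, LinearMap.add_apply, hx, hx']
    | h1 M y =>
      rw [mul_of (K := N + M) rfl _ _ rfl, adj_of _ (by omega), adj_of _ (by omega),
        adj_of _ (by omega), mul_of (K := N + M) (k := i + (N + M) + s) (by omega) _ _ (by omega),
        adj_contract]
      congr 1
      exact contract_congr ..

theorem epi_mul_zero {m : ℕ} (h : m = i + 0 + j) (b : P.V m) (y : P.Bim j s) :
    epi (mul i j s (of 0 h b) y) = Tot.act h b (epi y) := by
  induction y using induction with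
  | h0 => simp
  | h2 x x' hx hx' => simp only [map_add, hx, hx']
  | h1 M v =>
    refine Tot.ext fun t => ?_
    rw [mul_of (K := M) (by omega) _ _ rfl, comp_epi_of, Tot.comp_act (n' := j + t + s) _ _ rfl,
      comp_epi_of, scanR_contract (s := s) (p := j + t + s) (by omega) rfl _ rfl]

/-- In the Temperley-Lieb sum the top string of e, the leftmost one, either stays open, which is
creation, or is joined to the first string of y still open, which is annihilation. -/
theorem epi_mul_one {m : ℕ} (h : m = i + 1 + j) (e : P.V m) (y : P.Bim j s) :
    epi (mul i j s (of 1 h e) y)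
      = Tot.cr h e (epi y) + Tot.an (by omega) (P.adj m e) (epi y) := by
  induction y using induction with
  | h0 => simp
  | h2 x x' hx hx' => simp only [map_add, hx, hx']; abel
  | h1 M v =>
    refine Tot.ext fun t => ?_
    rw [mul_of (K := M + 1) (by omega) _ _ rfl, comp_epi_of, map_add,
      Tot.comp_an (n' := j + (t + 1) + s) _ _ rfl, P.adj_adj, comp_epi_of]
    cases t with
    | zero =>
      rw [Tot.comp_zero_cr, zero_add, scanR_succ_zero (p := i + 1 + 1 + s) _ _ _ (by omega),
        scanR_contract (s := s) (d := 1 + (0 + s)) (p := j + 1 + s) (by omega) rfl (by omega)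
          (by omega)]
      exact cap_contract _ (by omega) (by omega) (by omega) _ _
    | succ t =>
      rw [Tot.comp_succ_cr (n' := j + t + s) _ _ rfl, comp_epi_of,
        scanR_succ_succ (p := i + 1 + (t + 2) + s) _ _ _ (by omega),
        scanR_contract (s := s) (d := t + s) (p := j + t + s) (by omega) rfl (by omega) (by omega),
        scanR_contract (s := s) (d := 1 + (t + 1 + s)) (p := j + (t + 2) + s) (by omega) rfl (by omega) (by omega)]
      congr 1
      exact cap_contract _ (by omega) (by omega) (by omega) _ _

theorem comp_epi_adj {t n : ℕ} (h : n = s + t + j) (h' : n = j + t + s) (x : P.Bim j s) :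
    Tot.comp t h (epi (adj x)) = P.adj n (Tot.comp t h' (epi x)) := by
  induction x using induction with
  | h0 => simp
  | h2 x x' hx hx' => simp only [map_add, hx, hx']
  | h1 M v =>
    rw [adj_of _ (by omega), comp_epi_of, comp_epi_of, adj_scanR_eq (b' := s) rfl]
    have e : j + s = s + j := by omega
    simp only [e]

theorem inner_comp {t n : ℕ} (h : n = j + t + s) (x y : P.Tot j s) :
    ⟪Tot.comp t h x, Tot.comp t h y⟫_ℂ = ⟪Tot.comp t rfl x, Tot.comp t rfl y⟫_ℂ := by
  subst h; rfl

theorem inner_adj_adj (x y : P.Bim j s) : ⟪adj x, adj y⟫_ℂ = ⟪y, x⟫_ℂ := by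
  rw [inner_eq, inner_eq, Tot.inner_eq, Tot.inner_eq]
  obtain ⟨K₁, h₁⟩ := Tot.exists_fockInner_eq_sum (epi (adj x)) (epi (adj y))
  obtain ⟨K₂, h₂⟩ := Tot.exists_fockInner_eq_sum (epi y) (epi x)
  rw [h₁ _ (le_max_left K₁ K₂), h₂ _ (le_max_right K₁ K₂)]
  refine Finset.sum_congr rfl fun t _ => ?_
  rw [comp_epi_adj rfl (by omega), comp_epi_adj rfl (by omega), ← inner_comp (n := s + t + j) (by omega)]
  exact pair_adj ..

theorem norm_adj (x : P.Bim j s) : ‖adj x‖ = ‖x‖ := by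
  rw [@norm_eq_sqrt_re_inner ℂ, @norm_eq_sqrt_re_inner ℂ _ _ _ _ x, inner_adj_adj]

/-- The identity on i + 1 strings, read with one string on top, bends the last left string of v up
to the top. By induction on N, statements about left multiplications reduce to elements with at most
one top string. -/
theorem of_succ {N n : ℕ} (h : n = i + (N + 1) + j) (v : P.V n) :
    of (N + 1) h v = mul i (i + 1) j (of 1 rfl (P.idn (i + 1))) (of N (by omega) v) := by
  rw [mul_of (K := N + 1) (by omega) _ _ h, idn_contract]

theorem inner_mul_one_left {m : ℕ} (h : m = i + 1 + j) (e : P.V m) (y : P.Bim j s)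
    (z : P.Bim i s) :
    ⟪mul i j s (of 1 h e) y, z⟫_ℂ = ⟪y, mul j i s (adj (of 1 h e)) z⟫_ℂ := by
  rw [adj_of _ (by omega), inner_eq, inner_eq, epi_mul_one, epi_mul_one, inner_add_left,
    inner_add_right, Tot.inner_cr_left, Tot.inner_an_left, P.adj_adj, add_comm]

theorem inner_mul_left (x : P.Bim i j) (y : P.Bim j s) (z : P.Bim i s) :
    ⟪mul i j s x y, z⟫_ℂ = ⟪y, mul j i s (adj x) z⟫_ℂ := by
  induction x using induction with
  | h0 => simp
  | h2 x x' hx hx' =>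
    simp only [map_add, LinearMap.add_apply, inner_add_left, inner_add_right, hx, hx']
  | h1 N x =>
    suffices H : ∀ {n} (h : n = i + N + j) (x : P.V n),
        ⟪mul i j s (of N h x) y, z⟫_ℂ = ⟪y, mul j i s (adj (of N h x)) z⟫_ℂ from H rfl x
    clear x
    induction N generalizing i with
    | zero =>
      intro n h x
      rw [adj_of _ (by omega), inner_eq, inner_eq, epi_mul_zero, epi_mul_zero, Tot.inner_act_left]
    | succ N ih =>
      intro n h x
      rw [of_succ, mul_mul, inner_mul_one_left, adj_mul, mul_mul]
      exact ih _ (by omega) x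

/-- The same constant works for every number s of right strings. -/
theorem exists_norm_mul_le (x : P.Bim i j) :
    ∃ C : ℝ, 0 ≤ C ∧ ∀ {s : ℕ} (y : P.Bim j s), ‖mul i j s x y‖ ≤ C * ‖y‖ := by
  induction x using induction with
  | h0 => exact ⟨0, le_rfl, fun y => by simp⟩
  | h2 x x' hx hx' =>
    obtain ⟨C, hC, h⟩ := hx
    obtain ⟨C', hC', h'⟩ := hx'
    refine ⟨C + C', add_nonneg hC hC', fun y => ?_⟩
    rw [map_add, LinearMap.add_apply, add_mul]
    exact (norm_add_le _ _).trans (add_le_add (h y) (h' y))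
  | h1 N x =>
    suffices H : ∀ {n} (h : n = i + N + j) (x : P.V n),
        ∃ C : ℝ, 0 ≤ C ∧ ∀ {s : ℕ} (y : P.Bim j s), ‖mul i j s (of N h x) y‖ ≤ C * ‖y‖ from H rfl x
    clear x
    induction N generalizing i with
    | zero =>
      intro n h x
      obtain ⟨C, hC, h'⟩ := Tot.exists_norm_act_le h x
      refine ⟨C, hC, fun y => ?_⟩
      rw [← norm_epi, ← norm_epi, epi_mul_zero]
      exact h' _
    | succ N ih =>
      intro n h x
      obtain ⟨C, hC, h₀⟩ := ih (i := i + 1) (by omega) x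
      obtain ⟨C₁, hC₁, h₁⟩ := Tot.exists_norm_cr_le (j := i) rfl (P.idn (i + 1))
      obtain ⟨C₂, hC₂, h₂⟩ := Tot.exists_norm_an_le (l := i) (j := i + 1) (by omega)
        (P.adj _ (P.idn (i + 1)))
      refine ⟨(C₁ + C₂) * C, by positivity, fun y => ?_⟩
      rw [of_succ, mul_mul, ← norm_epi, epi_mul_one]
      refine (norm_add_le _ _).trans ((add_le_add (h₁ _) (h₂ _)).trans ?_)
      rw [← add_mul, norm_epi, mul_assoc]
      exact mul_le_mul_of_nonneg_left (h₀ y) (by positivity)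

theorem exists_norm_mul_le' (y : P.Bim j s) :
    ∃ C : ℝ, 0 ≤ C ∧ ∀ {i : ℕ} (x : P.Bim i j), ‖mul i j s x y‖ ≤ C * ‖x‖ := by
  obtain ⟨C, hC, h⟩ := exists_norm_mul_le (adj y)
  refine ⟨C, hC, fun x => ?_⟩
  rw [← norm_adj, adj_mul, ← norm_adj x]
  exact h _

end Bim

end FactorPlanarAlgebra

/-! ### Orthogonal polynomials of a free Poisson law and creation operators. -/

section Chebyshev

variable {E F G : Type*} [SeminormedAddCommGroup E] [InnerProductSpace ℂ E]
  [SeminormedAddCommGroup F] [InnerProductSpace ℂ F] [SeminormedAddCommGroup G]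
  [InnerProductSpace ℂ G]

/-- The recursion of the orthogonal polynomials of a free Poisson law with rate `t ^ 2`. -/
structure ChebyshevSeq (t : ℝ) (X : E →ₗ[ℂ] E) (η : ℕ → E) : Prop where
  zero : X (η 0) = (t : ℂ) • η 1 + (t : ℂ) ^ 2 • η 0
  succ : ∀ i, X (η (i + 1)) = (t : ℂ) • η (i + 2) + (1 + (t : ℂ) ^ 2) • η (i + 1) + (t : ℂ) • η i

/-- A Turán determinant: symmetry of X, tested on consecutive terms of the recursion, shows that it
does not depend on i. -/
theorem ChebyshevSeq.norm_sq_sub_inner {t : ℝ} (ht : 1 ≤ t) {X : E →ₗ[ℂ] E} {η : ℕ → E}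
    (h : ChebyshevSeq t X η) (hX : ∀ x y, ⟪X x, y⟫_ℂ = ⟪x, X y⟫_ℂ) (i : ℕ) :
    ((t : ℂ) ^ 2) * (⟪η (i + 1), η (i + 1)⟫_ℂ - ⟪η (i + 2), η i⟫_ℂ) = ⟪X (η 0), η 0⟫_ℂ := by
  have ht0 : (t : ℂ) ≠ 0 := by
    exact_mod_cast (by linarith : t ≠ 0)
  induction i with
  | zero =>
    have h1 := hX (η 1) (η 0)
    have h2 := congrArg (fun x => ⟪x, η 0⟫_ℂ) h.zero
    rw [h.zero, h.succ 0] at h1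
    simp only [zero_add, inner_add_left, inner_add_right, inner_smul_left, inner_smul_right,
      map_add, map_one, map_pow, Complex.conj_ofReal] at h1 h2 ⊢
    linear_combination (-t : ℂ) * h1 - h2
  | succ i ih =>
    rw [← ih]
    have h1 := hX (η (i + 2)) (η (i + 1))
    rw [h.succ i, h.succ (i + 1)] at h1
    simp only [inner_add_left, inner_add_right, inner_smul_left, inner_smul_right,
      map_add, map_one, map_pow, Complex.conj_ofReal, add_assoc, Nat.reduceAdd] at h1 ⊢
    linear_combination (-t : ℂ) * h1

/-- If X η_0 = 0 the recursion has the solution (-t)^i η_0; in general the deviation is controlled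
by the size a of X η_0. The constants depend on t, B and i only. -/
theorem ChebyshevSeq.exists_norm_sub_le {t : ℝ} (ht : 1 ≤ t) {B : ℝ} (hB : 0 ≤ B) :
    ∃ c : ℕ → ℝ, ∀ {E : Type u} [SeminormedAddCommGroup E] [InnerProductSpace ℂ E]
      (X : E →ₗ[ℂ] E) (η : ℕ → E) (_ : ChebyshevSeq t X η) (_ : ∀ x, ‖X x‖ ≤ B * ‖x‖) (a : ℝ)
      (_ : ‖X (η 0)‖ ≤ B * a) (i : ℕ), ‖η i - (-t : ℂ) ^ i • η 0‖ ≤ c i * a := by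
  have ht0 : (t : ℂ) ≠ 0 := by
    exact_mod_cast (by linarith : t ≠ 0)
  have htn : ‖(t : ℂ)‖ = t := by simp; linarith
  have htn1 : ‖(t : ℂ)⁻¹‖ ≤ 1 := by rw [norm_inv, htn]; exact inv_le_one_of_one_le₀ ht
  suffices H : ∀ i, ∃ c : ℝ, ∀ (E : Type u) [SeminormedAddCommGroup E] [InnerProductSpace ℂ E]
      (X : E →ₗ[ℂ] E) (η : ℕ → E) (_ : ChebyshevSeq t X η) (_ : ∀ x, ‖X x‖ ≤ B * ‖x‖) (a : ℝ)
      (_ : ‖X (η 0)‖ ≤ B * a), ‖η i - (-t : ℂ) ^ i • η 0‖ ≤ c * a by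
    choose c hc using H
    exact ⟨c, fun X η h hX a ha i => hc i _ X η h hX a ha⟩
  intro i
  induction i using Nat.twoStepInduction with
  | zero => exact ⟨0, fun _ _ _ X η _ _ a _ => by simp⟩
  | one =>
    refine ⟨B, fun _ _ _ X η h hX a ha => ?_⟩
    have e : η 1 - (-t : ℂ) ^ 1 • η 0 = (t : ℂ)⁻¹ • X (η 0) := by
      rw [h.zero, smul_add, smul_smul, smul_smul, inv_mul_cancel₀ ht0, pow_two,
        inv_mul_cancel_left₀ ht0]
      module
    rw [e, norm_smul]
    exact (mul_le_of_le_one_left (norm_nonneg _) htn1).trans ha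
  | more i ih₀ ih₁ =>
    obtain ⟨c₀, h₀⟩ := ih₀
    obtain ⟨c₁, h₁⟩ := ih₁
    refine ⟨B * c₁ + t ^ (i + 1) * B + (1 + t ^ 2) * c₁ + t * c₀, fun _ _ _ X η h hX a ha => ?_⟩
    have e : η (i + 2) - (-t : ℂ) ^ (i + 2) • η 0 = (t : ℂ)⁻¹ •
        (X (η (i + 1) - (-t : ℂ) ^ (i + 1) • η 0) + (-t : ℂ) ^ (i + 1) • X (η 0)
          - (1 + (t : ℂ) ^ 2) • (η (i + 1) - (-t : ℂ) ^ (i + 1) • η 0)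
          - (t : ℂ) • (η i - (-t : ℂ) ^ i • η 0)) := by
      rw [eq_inv_smul_iff₀ ht0, map_sub, map_smul, h.succ i]
      module
    rw [e, norm_smul]
    refine (mul_le_of_le_one_left (norm_nonneg _) htn1).trans ?_
    refine (norm_sub_le _ _).trans ?_
    refine (add_le_add_left ((norm_sub_le _ _).trans (add_le_add_left (norm_add_le _ _) _)) _).trans ?_
    have n1 : ‖(1 + (t : ℂ) ^ 2)‖ ≤ 1 + t ^ 2 := by
      refine (norm_add_le _ _).trans ?_
      rw [norm_pow, htn, norm_one]
    have n2 : ‖(-t : ℂ) ^ (i + 1)‖ = t ^ (i + 1) := by rw [norm_pow, norm_neg, htn]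
    rw [norm_smul, norm_smul, norm_smul, n2, htn]
    have h1 := h₁ _ X η h hX a ha
    have h0 := h₀ _ X η h hX a ha
    have e1 := (hX (η (i + 1) - (-t : ℂ) ^ (i + 1) • η 0)).trans (mul_le_mul_of_nonneg_left h1 hB)
    have e2 := mul_le_mul_of_nonneg_left ha (by positivity : 0 ≤ t ^ (i + 1))
    have e3 := mul_le_mul n1 h1 (norm_nonneg _) (by positivity)
    have e4 := mul_le_mul_of_nonneg_left h0 (by linarith : 0 ≤ t)
    linarith

/-- Either a is small compared with ‖η_0‖, and the η_i stay close to (-t)^i η_0, whose norms do not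
decay since t ≥ 1; or a is large, and the constant Turán determinant a² / t² keeps the sum growing
linearly. The number R of terms is uniform over all spaces, as domination has to hold on all
columns. -/
theorem ChebyshevSeq.exists_le_sum_norm_sq {t : ℝ} (ht : 1 ≤ t) {B : ℝ} (hB : 0 ≤ B) (K : ℝ) :
    ∃ R : ℕ, ∀ {E : Type u} [SeminormedAddCommGroup E] [InnerProductSpace ℂ E]
      (X : E →ₗ[ℂ] E) (η : ℕ → E) (_ : ChebyshevSeq t X η) (_ : ∀ x, ‖X x‖ ≤ B * ‖x‖)
      (_ : ∀ x y, ⟪X x, y⟫_ℂ = ⟪x, X y⟫_ℂ) (a : ℝ) (_ : 0 ≤ a)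
      (_ : ‖X (η 0)‖ ≤ B * a) (_ : ⟪X (η 0), η 0⟫_ℂ = (a : ℂ) ^ 2),
      K * ‖η 0‖ ^ 2 ≤ ∑ i ∈ Finset.range R, ‖η i‖ ^ 2 := by
  obtain ⟨c, hc⟩ := exists_norm_sub_le.{u} ht hB
  -- In the first case each of the R₁ terms is at least ‖η_0‖² / 4, and ε is chosen to keep the
  -- deviations below ‖η_0‖ / 2.
  obtain ⟨R₁, hR₁⟩ := exists_nat_ge (4 * K)
  obtain ⟨ε, hε, hcε⟩ : ∃ ε > 0, ∀ i < R₁, |c i| * ε ≤ 1 / 2 := by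
    refine ⟨(2 * (1 + ∑ i ∈ Finset.range R₁, |c i|))⁻¹, by positivity, fun i hi => ?_⟩
    have h1 : |c i| ≤ ∑ i ∈ Finset.range R₁, |c i| :=
      Finset.single_le_sum (f := fun i => |c i|) (fun i _ => abs_nonneg (c i))
        (Finset.mem_range.2 hi)
    rw [mul_inv_le_iff₀ (by positivity)]
    linarith
  -- In the second case R₂ a² / t² is at most twice the sum of R₂ + 2 terms, and a ≥ ε ‖η_0‖.
  obtain ⟨R₂, hR₂⟩ := exists_nat_ge (2 * K * t ^ 2 / ε ^ 2)
  refine ⟨max R₁ (R₂ + 2), fun {E} _ _ X η h hX hXs a ha0 ha ha2 => ?_⟩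
  have mono : ∀ {R}, R ≤ max R₁ (R₂ + 2) → ∑ i ∈ Finset.range R, ‖η i‖ ^ 2
      ≤ ∑ i ∈ Finset.range (max R₁ (R₂ + 2)), ‖η i‖ ^ 2 := fun hR =>
    Finset.sum_le_sum_of_subset_of_nonneg (Finset.range_mono hR) fun _ _ _ => by positivity
  rcases le_total a (ε * ‖η 0‖) with hle | hle
  · refine le_trans ?_ (mono (le_max_left _ _))
    have h1 : ∀ i ∈ Finset.range R₁, (1 / 4 : ℝ) * ‖η 0‖ ^ 2 ≤ ‖η i‖ ^ 2 := fun i hi => by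
      have h2 : ‖η i - (-t : ℂ) ^ i • η 0‖ ≤ 1 / 2 * ‖η 0‖ := by
        refine (hc X η h hX a ha i).trans ?_
        have h3 := hcε i (Finset.mem_range.1 hi)
        calc c i * a ≤ |c i| * a := mul_le_mul_of_nonneg_right (le_abs_self _) ha0
          _ ≤ |c i| * (ε * ‖η 0‖) := mul_le_mul_of_nonneg_left hle (abs_nonneg _)
          _ = (|c i| * ε) * ‖η 0‖ := by ring
          _ ≤ 1 / 2 * ‖η 0‖ := mul_le_mul_of_nonneg_right h3 (norm_nonneg _)
      have h4 : ‖η 0‖ ≤ ‖(-t : ℂ) ^ i • η 0‖ := by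
        rw [norm_smul, norm_pow, norm_neg, Complex.norm_real, Real.norm_of_nonneg (by linarith)]
        exact le_mul_of_one_le_left (norm_nonneg _) (one_le_pow₀ ht)
      have h5 := norm_sub_norm_le ((-t : ℂ) ^ i • η 0) (η i)
      rw [norm_sub_rev] at h5
      have h6 : 1 / 2 * ‖η 0‖ ≤ ‖η i‖ := by linarith
      have := pow_le_pow_left₀ (by positivity) h6 2
      linarith [mul_pow (1 / 2 : ℝ) ‖η 0‖ 2]
    refine le_trans ?_ (Finset.sum_le_sum h1)
    rw [Finset.sum_const, Finset.card_range, nsmul_eq_mul]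
    nlinarith [sq_nonneg ‖η 0‖]
  · refine le_trans ?_ (mono (le_max_right _ _))
    have h1 : ∀ i ∈ Finset.range R₂, a ^ 2 / t ^ 2
        ≤ ‖η (i + 1)‖ ^ 2 + (‖η i‖ ^ 2 + ‖η (i + 2)‖ ^ 2) / 2 := fun i _ => by
      have h2 := h.norm_sq_sub_inner ht hXs i
      have h2' : (⟪η (i + 1), η (i + 1)⟫_ℂ).re = ‖η (i + 1)‖ ^ 2 := inner_self_eq_norm_sq (𝕜 := ℂ) _
      rw [ha2, ← Complex.ofReal_pow, ← Complex.ofReal_pow] at h2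
      have h3 := congrArg Complex.re h2
      rw [Complex.re_ofReal_mul, Complex.sub_re, Complex.ofReal_re, h2'] at h3
      have h4 := (Complex.abs_re_le_norm _).trans (norm_inner_le_norm (𝕜 := ℂ) (η (i + 2)) (η i))
      rw [div_le_iff₀ (by positivity), ← h3, mul_comm]
      refine mul_le_mul_of_nonneg_right ?_ (by positivity)
      nlinarith [(abs_le.1 h4).1, sq_nonneg (‖η i‖ - ‖η (i + 2)‖)]
    have h2 := Finset.sum_le_sum h1
    rw [Finset.sum_const, Finset.card_range, nsmul_eq_mul, Finset.sum_add_distrib,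
      ← Finset.sum_div, Finset.sum_add_distrib] at h2
    have e0 : ∑ i ∈ Finset.range R₂, ‖η i‖ ^ 2 ≤ ∑ i ∈ Finset.range (R₂ + 2), ‖η i‖ ^ 2 :=
      Finset.sum_le_sum_of_subset_of_nonneg (Finset.range_mono (by omega)) fun _ _ _ => by positivity
    have e1 : ∑ i ∈ Finset.range R₂, ‖η (i + 1)‖ ^ 2 ≤ ∑ i ∈ Finset.range (R₂ + 2), ‖η i‖ ^ 2 := by
      rw [Finset.sum_range_succ _ (R₂ + 1), Finset.sum_range_succ' _ R₂]
      nlinarith [sq_nonneg ‖η 0‖, sq_nonneg ‖η (R₂ + 1)‖]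
    have e2 : ∑ i ∈ Finset.range R₂, ‖η (i + 2)‖ ^ 2 ≤ ∑ i ∈ Finset.range (R₂ + 2), ‖η i‖ ^ 2 := by
      rw [Finset.sum_range_succ' _ (R₂ + 1), Finset.sum_range_succ' _ R₂]
      nlinarith [sq_nonneg ‖η 0‖, sq_nonneg ‖η (0 + 1)‖]
    have h3 : (ε * ‖η 0‖) ^ 2 ≤ a ^ 2 := pow_le_pow_left₀ (by positivity) hle 2
    have h4 : 2 * K * ‖η 0‖ ^ 2 ≤ R₂ * (a ^ 2 / t ^ 2) := by
      calc 2 * K * ‖η 0‖ ^ 2 = 2 * K * t ^ 2 / ε ^ 2 * ((ε * ‖η 0‖) ^ 2 / t ^ 2) := by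
            field_simp
        _ ≤ R₂ * ((ε * ‖η 0‖) ^ 2 / t ^ 2) := mul_le_mul_of_nonneg_right hR₂ (by positivity)
        _ ≤ R₂ * (a ^ 2 / t ^ 2) := by gcongr
    linarith

/-- Operators `v`, `c` with adjoints `v'`, `c'` such that `v` and `t⁻¹ c` are isometries (on the range
of the projection `U`), and an operator `g'` with `g' v = 0`. -/
structure CreationPair (t : ℝ) (v : F →ₗ[ℂ] E) (v' : E →ₗ[ℂ] F) (c : E →ₗ[ℂ] F) (c' : F →ₗ[ℂ] E)
    (U : E →ₗ[ℂ] E) (g : E →ₗ[ℂ] G) : Prop where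
  adj_v : ∀ y x, ⟪v y, x⟫_ℂ = ⟪y, v' x⟫_ℂ
  adj_c : ∀ x y, ⟪c x, y⟫_ℂ = ⟪x, c' y⟫_ℂ
  isometry_c : ∀ x, v' (v (c x)) = c x
  isometry_v' : ∀ x, v' (v (v' x)) = v' x
  c'_c : ∀ x, c' (c x) = (t : ℂ) ^ 2 • U x
  U_v : ∀ y, U (v y) = v y
  U_c' : ∀ y, U (c' y) = c' y
  g_v : ∀ y, g (v y) = 0

/-- Expanding η_i in v, v', c, c', every term beginning with v is killed by g. What is left is Y_i =
(t⁻¹ c' v')^i η_0, and the squares ‖g Y_i‖² telescope. -/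
theorem CreationPair.sum_norm_sq_le {t : ℝ} (ht : 1 ≤ t) {v : F →ₗ[ℂ] E} {v' : E →ₗ[ℂ] F}
    {c : E →ₗ[ℂ] F} {c' : F →ₗ[ℂ] E} {U : E →ₗ[ℂ] E} {g : E →ₗ[ℂ] G}
    (h : CreationPair t v v' c c' U g) {η : ℕ → E}
    (hη : ChebyshevSeq t ((v + c') ∘ₗ (v' + c)) η) (hU : U (η 0) = η 0) {C : ℝ}
    (hC : ∀ x, ‖g x‖ ≤ C * ‖x‖) (R : ℕ) :
    (∀ i, U (η i) = η i) ∧ ∑ i ∈ Finset.range R, ‖g (η i)‖ ^ 2 ≤ C ^ 2 * ‖η 0‖ ^ 2 := by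
  have ht0 : (t : ℂ) ≠ 0 := by
    exact_mod_cast (by linarith : t ≠ 0)
  obtain ⟨Y, hY0, hY⟩ : ∃ Y : ℕ → E, Y 0 = η 0 ∧ ∀ i, (t : ℂ) • Y (i + 1) = c' (v' (Y i)) :=
    ⟨fun i => (fun x => (t : ℂ)⁻¹ • c' (v' x))^[i] (η 0), rfl, fun i => by
      simp only [Function.iterate_succ_apply', smul_inv_smul₀ ht0]⟩
  have hYU : ∀ i, U (Y i) = Y i := fun i => by
    cases i with
    | zero => rw [hY0, hU]
    | succ i =>
      have := congrArg ((t : ℂ)⁻¹ • ·) (hY i)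
      simp only [inv_smul_smul₀ ht0] at this
      rw [this, map_smul, h.U_c']
  -- The exact form of the part in the range of v is needed to close the induction; only c' (v' (Y
  -- i)) = t Y_{i+1} survives g.
  have main : ∀ i, (t : ℂ) • η (i + 1) = v (c (η i) + v' (Y i)) + c' (v' (Y i)) ∧ U (η i) = η i := by
    intro i
    induction i with
    | zero =>
      refine ⟨?_, hU⟩
      have h0 := hη.zero
      simp only [LinearMap.comp_apply, LinearMap.add_apply, map_add, h.c'_c, hU] at h0
      rw [hY0, map_add, ← sub_eq_iff_eq_add.2 h0]
      abel
    | succ i ih =>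
      obtain ⟨ih, ihU⟩ := ih
      have hU1 : U (η (i + 1)) = η (i + 1) := by
        have := congrArg ((t : ℂ)⁻¹ • ·) ih
        simp only [inv_smul_smul₀ ht0] at this
        rw [this, map_smul, map_add, h.U_v, h.U_c']
      refine ⟨?_, hU1⟩
      have h1 := hη.succ i
      have h2 : (t : ℂ) • v' (η (i + 1)) = c (η i) + v' (Y i) + (t : ℂ) • v' (Y (i + 1)) := by
        rw [← map_smul, ← map_smul v', ih, hY, map_add, map_add, map_add, h.isometry_c, h.isometry_v']
      have h3 := congrArg v h2
      have h4 := congrArg c' h2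
      simp only [LinearMap.comp_apply, LinearMap.add_apply, map_add, h.c'_c, hU1, map_smul, ihU]
        at h1 h3 h4 ih ⊢
      have key : (t : ℂ) • ((t : ℂ) • η (i + 1 + 1)) = (t : ℂ) • (v (c (η (i + 1))) + v (v' (Y (i + 1)))
          + c' (v' (Y (i + 1)))) := by
        linear_combination (norm := module) (-t : ℂ) • h1 + h3 + h4 - ih
      exact smul_right_injective E ht0 key
  refine ⟨fun i => (main i).2, ?_⟩
  have hg : ∀ i, g (η i) = g (Y i) := fun i => by
    cases i with
    | zero => rw [hY0]
    | succ i =>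
      refine smul_right_injective G ht0 ?_
      simp only
      rw [← map_smul, ← map_smul, (main i).1, hY, map_add, h.g_v, zero_add]
  -- Subtracting t⁻¹ v c Y_{i+1} does not change g (Y i), and by Pythagoras the difference has
  -- squared norm ‖Y_i‖² - ‖Y_{i+1}‖².
  have step : ∀ i, ‖g (Y i)‖ ^ 2 ≤ C ^ 2 * (‖Y i‖ ^ 2 - ‖Y (i + 1)‖ ^ 2) := fun i => by
    have h1 : g (Y i) = g (Y i - (t : ℂ)⁻¹ • v (c (Y (i + 1)))) := by
      rw [map_sub, map_smul, h.g_v, smul_zero, sub_zero]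
    have hY' : c' (v' (Y i)) = (t : ℂ) • Y (i + 1) := (hY i).symm
    have hinner : ⟪Y i, v (c (Y (i + 1)))⟫_ℂ = t * ⟪Y (i + 1), Y (i + 1)⟫_ℂ := by
      rw [← inner_conj_symm, h.adj_v, h.adj_c, hY', inner_smul_right, map_mul, inner_conj_symm,
        Complex.conj_ofReal]
    have hinner2 : ⟪v (c (Y (i + 1))), v (c (Y (i + 1)))⟫_ℂ
        = (t : ℂ) ^ 2 * ⟪Y (i + 1), Y (i + 1)⟫_ℂ := by
      rw [h.adj_v, h.isometry_c, h.adj_c, h.c'_c, hYU, inner_smul_right]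
    have hinner3 : ⟪v (c (Y (i + 1))), Y i⟫_ℂ = t * ⟪Y (i + 1), Y (i + 1)⟫_ℂ := by
      rw [h.adj_v, h.adj_c, hY', inner_smul_right]
    have h2 : ⟪Y i - (t : ℂ)⁻¹ • v (c (Y (i + 1))), Y i - (t : ℂ)⁻¹ • v (c (Y (i + 1)))⟫_ℂ
        = ⟪Y i, Y i⟫_ℂ - ⟪Y (i + 1), Y (i + 1)⟫_ℂ := by
      rw [inner_sub_left, inner_sub_right, inner_sub_right, inner_smul_left, inner_smul_right,
        inner_smul_left, inner_smul_right, hinner, hinner2, hinner3, map_inv₀, Complex.conj_ofReal]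
      field_simp
      ring
    have h3 : ‖Y i - (t : ℂ)⁻¹ • v (c (Y (i + 1)))‖ ^ 2 = ‖Y i‖ ^ 2 - ‖Y (i + 1)‖ ^ 2 := by
      simp only [inner_self_eq_norm_sq_to_K] at h2
      exact_mod_cast h2
    rw [h1, ← h3, ← mul_pow]
    exact pow_le_pow_left₀ (norm_nonneg _) (hC _) 2
  simp only [hg]
  refine (Finset.sum_le_sum fun i _ => step i).trans ?_
  rw [← Finset.mul_sum, Finset.sum_range_sub', hY0]
  gcongr
  linarith [sq_nonneg ‖Y R‖]

end Chebyshev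

/-! ### Domination by finitely many left multiplications. -/

namespace FactorPlanarAlgebra

variable {P : FactorPlanarAlgebra.{u}}
open PlanarAlgebra

/-- The operator of left multiplication with `x` is dominated by finitely many left multiplications
with elements of the bimodule from level `t` to level `j`. -/
def Dominated (t : ℕ) {j : ℕ} (x : P.V (j + j)) : Prop :=
  ∃ (C : ℝ) (Y : List (P.Bim t j)), 0 ≤ C ∧ ∀ {s : ℕ} (ξ : P.Bim j s),
    ‖Tot.act rfl x (Bim.epi ξ)‖ ^ 2 ≤ C * (Y.map fun y => ‖Bim.mul t j s y ξ‖ ^ 2).sum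

theorem Dominated.zero {t j : ℕ} : Dominated t (0 : P.V (j + j)) :=
  ⟨0, [], le_rfl, fun ξ => by
    have : Tot.act rfl (0 : P.V (j + j)) (Bim.epi ξ) = 0 := by
      rw [← Bim.epi_mul_zero (m := j + j) rfl]; simp
    rw [this]; simp⟩

theorem Tot.act_add {i j s m : ℕ} (h : m = i + j) (x y : P.V m) (ξ : P.Tot j s) :
    act h (x + y) ξ = act h x ξ + act h y ξ := by
  induction ξ using induction with
  | h0 => simp
  | h2 x y hx hy => simp only [map_add, hx, hy]; abel
  | h1 N v =>
    rw [act_of (n' := i + N + s) _ _ rfl, act_of (n' := i + N + s) _ _ rfl,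
      act_of (n' := i + N + s) _ _ rfl, map_add, LinearMap.add_apply, map_add]

theorem Tot.act_smul {i j s m : ℕ} (h : m = i + j) (c : ℂ) (x : P.V m) (ξ : P.Tot j s) :
    act h (c • x) ξ = c • act h x ξ := by
  induction ξ using induction with
  | h0 => simp
  | h2 x y hx hy => simp only [map_add, hx, hy, smul_add]
  | h1 N v =>
    rw [act_of (n' := i + N + s) _ _ rfl, act_of (n' := i + N + s) _ _ rfl,
      map_smul, LinearMap.smul_apply, map_smul]

theorem sum_norm_sq_nonneg {t j s : ℕ} (Y : List (P.Bim t j)) (ξ : P.Bim j s) :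
    0 ≤ (Y.map fun y => ‖Bim.mul t j s y ξ‖ ^ 2).sum :=
  List.sum_nonneg (by simp only [List.mem_map]; rintro _ ⟨y, _, rfl⟩; positivity)

theorem Dominated.of_norm_le {t j : ℕ} {x y : P.V (j + j)} (hx : Dominated t x) (C : ℝ)
    (h : ∀ {s : ℕ} (ξ : P.Tot j s), ‖Tot.act rfl y ξ‖ ≤ C * ‖Tot.act rfl x ξ‖) :
    Dominated t y := by
  obtain ⟨D, Y, hD, hY⟩ := hx
  refine ⟨C ^ 2 * D, Y, by positivity, fun ξ => ?_⟩
  refine (pow_le_pow_left₀ (norm_nonneg _) (h _) 2).trans ?_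
  rw [mul_pow, mul_assoc]
  exact mul_le_mul_of_nonneg_left (hY ξ) (by positivity)

theorem Dominated.add {t j : ℕ} {x y : P.V (j + j)} (hx : Dominated t x) (hy : Dominated t y) :
    Dominated t (x + y) := by
  obtain ⟨C, X, hC, hX⟩ := hx
  obtain ⟨D, Y, hD, hY⟩ := hy
  refine ⟨2 * C + 2 * D, X ++ Y, by positivity, fun ξ => ?_⟩
  have hx := hX ξ
  have hy := hY ξ
  have nx := sum_norm_sq_nonneg X ξ
  have ny := sum_norm_sq_nonneg Y ξ
  rw [Tot.act_add, List.map_append, List.sum_append]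
  have h1 := pow_le_pow_left₀ (norm_nonneg _) (norm_add_le (Tot.act rfl x (Bim.epi ξ))
    (Tot.act rfl y (Bim.epi ξ))) 2
  nlinarith [sq_nonneg (‖Tot.act rfl x (Bim.epi ξ)‖ - ‖Tot.act rfl y (Bim.epi ξ)‖),
    mul_nonneg hC ny, mul_nonneg hD nx]

theorem Dominated.mul_left {t j : ℕ} {x : P.V (j + j)} (hx : Dominated t x) (b : P.V (j + j)) :
    Dominated t (P.contract j rfl rfl rfl b x : P.V (j + j)) := by
  obtain ⟨C, hC, h⟩ := Tot.exists_norm_act_le (P := P) (i := j) (j := j) rfl b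
  refine hx.of_norm_le C fun ξ => ?_
  rw [← Tot.act_act rfl rfl]
  exact h _

theorem Dominated.mul_right {t j : ℕ} {x : P.V (j + j)} (hx : Dominated t x) (b : P.V (j + j)) :
    Dominated t (P.contract j rfl rfl rfl x b : P.V (j + j)) := by
  obtain ⟨D, Y, hD, hY⟩ := hx
  refine ⟨D, Y.map fun y => Bim.mul t j j y (Bim.of 0 rfl b), hD, fun ξ => ?_⟩
  rw [← Tot.act_act rfl rfl, ← Bim.epi_mul_zero (m := j + j) rfl b]
  refine (hY _).trans (le_of_eq ?_)
  simp only [List.map_map, Function.comp_def, Bim.mul_mul]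

/-- The ideal of the dominated elements. -/
def dominatedIdeal (P : FactorPlanarAlgebra.{u}) (t j : ℕ) : Submodule ℂ (P.V (j + j)) where
  carrier := {x | Dominated t x}
  zero_mem' := .zero
  add_mem' := .add
  smul_mem' c x hx := hx.of_norm_le ‖c‖ fun ξ => by rw [Tot.act_smul, norm_smul]

/-- An element factoring through t strings is dominated by the single multiplication with y*, which
has no top strings. -/
theorem Dominated.of_mul_adj {t j n : ℕ} {p : P.V (j + j)} (hn : n = j + t) {y : P.V n} {c : ℂ}
    (hp : p = c • P.contract t hn (by omega : n = t + j) rfl y (P.adj _ y)) : Dominated t p := by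
  have h1 : Dominated t (P.contract t hn (by omega : n = t + j) rfl y (P.adj _ y) : P.V (j + j)) := by
    obtain ⟨C, hC, h⟩ := Tot.exists_norm_act_le (P := P) (i := j) (j := t) hn y
    refine ⟨C ^ 2, [Bim.of 0 (by omega) (P.adj _ y)], by positivity, fun ξ => ?_⟩
    rw [List.map_singleton, List.sum_singleton, ← Bim.norm_epi, Bim.epi_mul_zero, ← mul_pow,
      ← Tot.act_act hn (by omega)]
    exact pow_le_pow_left₀ (norm_nonneg _) (h _) 2
  rw [hp]
  exact (P.dominatedIdeal t j).smul_mem c h1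

theorem dominated_idn (k : ℕ) : Dominated k (P.idn k) :=
  ⟨1, [Bim.of 0 rfl (P.idn k)], zero_le_one, fun ξ => by
    rw [List.map_singleton, List.sum_singleton, ← Bim.norm_epi, Bim.epi_mul_zero, one_mul]⟩

theorem cap_cup : P.cap 0 le_rfl rfl P.cup = (P.delta : ℂ) • P.empty := by
  apply P.ev.injective
  rw [map_smul, P.ev_empty, smul_eq_mul, mul_one]
  have h : P.adj 0 (P.cap 0 le_rfl rfl P.cup) = P.cap 0 le_rfl rfl P.cup := by
    rw [P.adj_cap 0 0 rfl, P.adj_cup]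
  have h2 := P.ev_adj (P.cap 0 le_rfl rfl P.cup)
  rw [h] at h2
  exact (Complex.conj_eq_iff_re.1 h2.symm).symm

theorem cap_ins_cup_eq {i m p : ℕ} (hi : i ≤ m) (hp : p = m + 2) (v : P.V m) :
    P.cap i hi hp (P.ins i hi hp v P.cup) = (P.delta : ℂ) • v := by
  rw [cap_ins_cup, cap_cup, map_smul]
  congr 1
  exact P.ins_empty i hi v

/-- Let X be the identity on j + 1 strings with one of its strings drawn on top. Its creation part
is √δ times an isometry and its annihilation part is a contraction, so ‖X ζ‖ ≥ (√δ - 1) ‖ζ‖. As (p ⊗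
1) X = X p, a bound for p ⊗ 1 on X ξ is one for p on ξ. -/
theorem Dominated.of_ins_cup (hδ : 1 < P.delta) {t j : ℕ} {p : P.V (j + j)}
    (hp : Dominated t (P.ins j (by omega) (by omega) p P.cup : P.V (j + 1 + (j + 1)))) :
    Dominated t p := by
  obtain ⟨C, Y, hC, hY⟩ := hp
  let X : P.V (j + 1 + (j + 1)) := P.idn (j + 1)
  have hX : P.adj _ X = X := P.adj_idn (j + 1)
  let Xs : P.Bim (j + 1) j := Bim.of 1 (by omega) X
  have hsq : 1 < Real.sqrt P.delta := by
    rw [Real.lt_sqrt zero_le_one]; simpa using hδ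
  have hcr : ∀ {s} (ζ : P.Tot j s),
      ‖Tot.cr (j := j + 1) (l := j) (by omega) X ζ‖ = Real.sqrt P.delta * ‖ζ‖ := by
    intro s ζ
    have e : P.contract (j + 1 + 1) (a := j) (b := j) (n := j + j) (by omega) (by omega) rfl
        (P.adj _ X) X = (P.delta : ℂ) • P.idn j := by
      rw [hX, ← cap_contract (n := j + 1 + (j + 1)) (by omega) (by omega) (by omega),
        contract_congr _ _ _ rfl rfl rfl, P.idn_contract rfl X]
      exact cap_ins_cup_eq (by omega) (by omega) (P.idn j)
    have h1 : ‖Tot.cr (j := j + 1) (l := j) (by omega) X ζ‖ ^ 2 = P.delta * ‖ζ‖ ^ 2 := by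
      have h2 : ⟪Tot.cr (j := j + 1) (l := j) (by omega) X ζ,
          Tot.cr (j := j + 1) (l := j) (by omega) X ζ⟫_ℂ = P.delta * ⟪ζ, ζ⟫_ℂ := by
        rw [Tot.inner_cr_left, Tot.an_cr _ _ rfl, e, Tot.act_smul, Tot.act_idn, inner_smul_right]
      have h3 := congrArg Complex.re h2
      rw [Complex.re_ofReal_mul] at h3
      rw [← inner_self_eq_norm_sq (𝕜 := ℂ), ← inner_self_eq_norm_sq (𝕜 := ℂ) ζ]
      exact h3
    rw [← Real.sqrt_sq (norm_nonneg (Tot.cr _ X ζ)), h1, Real.sqrt_mul P.delta_nonneg,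
      Real.sqrt_sq (norm_nonneg _)]
  have han : ∀ {s} (ζ : P.Tot j s), ‖Tot.an (j := j) (l := j + 1) rfl X ζ‖ ≤ 1 * ‖ζ‖ := by
    intro s ζ
    refine Tot.norm_adjoint_le (Tot.inner_cr_left rfl X) zero_le_one (fun x => ?_) ζ
    have h2 : ⟪Tot.cr (j := j) (l := j + 1) rfl X x, Tot.cr (j := j) (l := j + 1) rfl X x⟫_ℂ
        = ⟪x, x⟫_ℂ := by
      rw [Tot.inner_cr_left, Tot.an_cr _ _ rfl, hX]
      exact congrArg _ ((congrArg (fun b => Tot.act rfl b x) (P.idn_contract rfl X)).trans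
        (Tot.act_idn x))
    rw [@norm_eq_sqrt_re_inner ℂ, h2, one_mul, ← @norm_eq_sqrt_re_inner ℂ]
  have hcomm : Bim.mul (j + 1) (j + 1) j (Bim.of 0 rfl
      (P.ins j (by omega) (by omega) p P.cup : P.V (j + 1 + (j + 1)))) Xs
      = Bim.mul (j + 1) j j Xs (Bim.of 0 rfl p) := by
    simp only [Xs]
    rw [Bim.mul_of (K := 1) (k := j + 1 + (j + 1)) rfl _ _ (by omega),
      Bim.mul_of (K := 1) (k := j + 1 + (j + 1)) rfl _ _ (by omega)]
    congr 1
    -- Adjoints are taken because `contract_ins_cup` describes multiplication by p ⊗ 1 from the left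
    -- only.
    apply (P.toPlanarAlgebra.adj_adj _).symm.trans
    apply Eq.trans _ (P.toPlanarAlgebra.adj_adj _)
    congr 1
    rw [adj_contract, adj_contract, hX, P.adj_ins j j rfl, P.adj_cup]
    have h1 (y : P.V (j + 1 + (j + 1))) : P.contract (j + 1) rfl rfl rfl X y = y :=
      P.idn_contract rfl y
    have h2 (y : P.V (j + 1 + (j + 1))) : P.contract (j + 1) rfl rfl rfl y X = y :=
      P.contract_idn rfl y
    refine ((contract_congr _ _ _ rfl rfl rfl X _).trans (h1 _)).trans ?_
    refine (h2 _).symm.trans ?_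
    exact (contract_ins_cup (a := j) (j := j) (b := j + 1) rfl rfl (by omega) rfl _ X).trans
      (contract_congr ..)
  refine ⟨((Real.sqrt P.delta - 1) ^ 2)⁻¹ * C, Y.map fun y => Bim.mul t (j + 1) j y Xs,
    by positivity, fun ξ => ?_⟩
  have h1 : (Real.sqrt P.delta - 1) * ‖Tot.act rfl p (Bim.epi ξ)‖
      ≤ ‖Tot.act rfl (P.ins j (by omega) (by omega) p P.cup : P.V (j + 1 + (j + 1)))
        (Bim.epi (Bim.mul _ _ _ Xs ξ))‖ := by
    rw [← Bim.epi_mul_zero (i := j + 1) (j := j + 1) rfl, ← Bim.mul_mul, hcomm, Bim.mul_mul, Bim.epi_mul_one,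
      Bim.epi_mul_zero, hX]
    have h2 := norm_sub_norm_le (Tot.cr (j := j + 1) (l := j) (by omega) X (Tot.act rfl p (Bim.epi ξ)))
      (-Tot.an (j := j) (l := j + 1) rfl X (Tot.act rfl p (Bim.epi ξ)))
    rw [norm_neg, sub_neg_eq_add, hcr] at h2
    refine le_trans ?_ h2
    linarith [han (Tot.act rfl p (Bim.epi ξ))]
  have h3 : 0 < Real.sqrt P.delta - 1 := by linarith
  have h4 := (pow_le_pow_left₀ (by positivity) h1 2).trans (hY _)
  rw [mul_pow] at h4
  rw [mul_assoc, le_inv_mul_iff₀ (by positivity)]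
  refine h4.trans (le_of_eq ?_)
  simp only [List.map_map, Function.comp_def, Bim.mul_mul]

theorem dominated_idn_of_le (hδ : 1 < P.delta) {m k : ℕ} (h : m ≤ k) : Dominated k (P.idn m) := by
  obtain ⟨d, rfl⟩ := Nat.exists_eq_add_of_le h
  induction d generalizing m with
  | zero => exact dominated_idn m
  | succ d ih =>
    have := ih (m := m + 1) (by omega)
    have e : m + 1 + d = m + (d + 1) := by omega
    rw [e] at this
    exact Dominated.of_ins_cup hδ this

end FactorPlanarAlgebra

/-! ### Domination obtained from an edge of the principal graph. -/

namespace FactorPlanarAlgebra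

variable {P : FactorPlanarAlgebra.{u}}
open PlanarAlgebra

theorem Tot.act_an {j l l' s m m' m'' : ℕ} (h : m = l' + l) (h' : m' = j + 1 + l)
    (h'' : m'' = j + 1 + l') (b : P.V m) (e : P.V m') (x : P.Tot j s) :
    act h b (an h' e x)
      = an h'' (P.contract l (b := l') h' (by omega) h'' e (P.adj m b)) x := by
  induction x using induction with
  | h0 => simp
  | h2 x y hx hy => simp only [map_add, hx, hy]
  | h1 N v =>
    cases N with
    | zero => rw [an_of_zero, an_of_zero, map_zero]
    | succ N =>
      rw [an_of_succ (n' := l + N + s) _ _ rfl, act_of (n' := l' + N + s) _ _ rfl,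
        an_of_succ (n' := l' + N + s) _ _ rfl, adj_contract, P.adj_adj,
        contract_assoc (h := by omega)]

theorem Tot.norm_sq_cr {j l s m n : ℕ} (h : m = j + 1 + l) (hn : n = l + l) {g : P.V m}
    {u : P.V n} {c : ℝ}
    (hg : P.contract (j + 1) (a := l) (b := l) (by omega) h hn (P.adj m g) g = (c : ℂ) • u)
    (x : P.Tot l s) (hu : act hn u x = x) : ‖cr h g x‖ ^ 2 = c * ‖x‖ ^ 2 := by
  have h2 : ⟪cr h g x, cr h g x⟫_ℂ = c * ⟪x, x⟫_ℂ := by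
    rw [inner_cr_left, an_cr _ _ hn, hg, act_smul, hu, inner_smul_right]
  have h3 := congrArg Complex.re h2
  rw [Complex.re_ofReal_mul] at h3
  rw [← inner_self_eq_norm_sq (𝕜 := ℂ), ← inner_self_eq_norm_sq (𝕜 := ℂ) x]
  exact h3

/-- The same diagram e gives two creation operators: e itself over e* e = w, and e*, read from the
other side, over e e* = t² u. Orthogonality g* e = 0 makes the annihilation by g vanish on the range
of the first. -/
theorem creationPair {m j l : ℕ} {t : ℝ} {u : P.V (j + j)} {w : P.V (l + l)}
    {e : P.V (j + 1 + l)} {g : P.V (j + 1 + m)}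
    (hue : P.contract j rfl (Nat.add_assoc j 1 l) (Nat.add_assoc j 1 l) u e = e)
    (hew : P.contract l rfl rfl rfl e w = e)
    (hee : P.contract (j + 1) (a := l) (by omega) rfl rfl (P.adj _ e) e = w)
    (hee' : P.contract (l + 1) (a := j) (b := j) (by omega) (by omega) rfl e (P.adj _ e)
      = (t : ℂ) ^ 2 • u)
    (hge : P.contract (j + 1) (a := m) (by omega) rfl rfl (P.adj _ g) e = (0 : P.V (m + l)))
    (s : ℕ) : CreationPair t (Tot.cr (s := s) rfl e) (Tot.an (s := s) rfl e)
      (Tot.cr (s := s) (j := l) (l := j) (by omega) (P.adj _ e))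
      (Tot.an (s := s) (j := l) (l := j) (by omega) (P.adj _ e)) (Tot.act rfl u)
      (Tot.an rfl g) := by
  have hw : P.adj _ w = w := by rw [← hee, adj_contract, P.adj_adj]
  have hwe : P.contract l rfl (by omega : j + 1 + l = l + (1 + j)) (by omega) w (P.adj _ e)
      = P.adj _ e := by
    conv_rhs => rw [← hew]
    rw [adj_contract, hw]
    exact contract_congr ..
  exact {
      adj_v := fun y x => Tot.inner_cr_left ..
      adj_c := fun y x => Tot.inner_cr_left ..
      isometry_c := fun x => by
        rw [Tot.an_cr _ _ rfl, hee, Tot.act_cr _ _ (show j + 1 + l = l + 1 + j by omega), hwe]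
      isometry_v' := fun x => by
        rw [Tot.an_cr _ _ rfl, hee, Tot.act_an _ _ rfl, hw, hew]
      c'_c := fun x => by
        rw [Tot.an_cr _ _ rfl, P.adj_adj, hee', Tot.act_smul]
      U_v := fun y => by rw [Tot.act_cr _ _ rfl, hue]
      U_c' := fun y => by
        rw [Tot.act_an _ _ (show j + 1 + l = l + 1 + j by omega)]
        congr 2
        conv_rhs => rw [← hue]
        rw [adj_contract]
        exact contract_congr ..
      g_v := fun y => by
        rw [Tot.an_cr _ _ rfl, hge]
        have := Tot.act_smul (P := P) (i := m) (j := l) rfl 0 (0 : P.V (m + l)) y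
        rwa [zero_smul, zero_smul] at this }

theorem sum_map_range (f : ℕ → ℝ) (R : ℕ) :
    ((List.range R).map f).sum = ∑ i ∈ Finset.range R, f i := by
  induction R with
  | zero => simp
  | succ n ih => rw [List.range_succ, Finset.sum_range_succ, ← ih]; simp

theorem exists_two_step_seq {α : Type*} (a b : α) (f : α → α → α) :
    ∃ z : ℕ → α, z 0 = a ∧ z 1 = b ∧ ∀ i, z (i + 2) = f (z i) (z (i + 1)) :=
  ⟨fun i => ((fun p : α × α => (p.2, f p.1 p.2))^[i] (a, b)).1, rfl, rfl, fun i => by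
    simp only [Function.iterate_succ_apply']⟩

-- Left multiplication by g* is creation by g*, which is √c times an isometry on the range of u,
-- plus annihilation by g, which could cancel it. Averaging over the polynomials z_i in e e* defeats
-- the cancellation: the annihilation terms are square summable, the creation terms add up to as
-- much as desired.
set_option maxHeartbeats 1000000 in
theorem Dominated.of_creation {m j l : ℕ} {t : ℝ} (ht : 1 ≤ t) {u : P.V (j + j)}
    {w : P.V (l + l)} {e : P.V (j + 1 + l)} {g : P.V (j + 1 + m)} {c : ℝ} (hc : 0 < c)
    (huu : P.contract j rfl rfl rfl u u = u)
    (hue : P.contract j rfl (Nat.add_assoc j 1 l) (Nat.add_assoc j 1 l) u e = e)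
    (hew : P.contract l rfl rfl rfl e w = e)
    (hee : P.contract (j + 1) (a := l) (by omega) rfl rfl (P.adj _ e) e = w)
    (hee' : P.contract (l + 1) (a := j) (b := j) (by omega) (by omega) rfl e (P.adj _ e)
      = (t : ℂ) ^ 2 • u)
    (hgg : P.contract (m + 1) (a := j) (b := j) (by omega) (by omega) rfl g (P.adj _ g)
      = (c : ℂ) • u)
    (hge : P.contract (j + 1) (a := m) (by omega) rfl rfl (P.adj _ g) e = (0 : P.V (m + l))) :
    Dominated m u := by
  have ht0 : (t : ℂ) ≠ 0 := by
    exact_mod_cast (by linarith : t ≠ 0)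
  have pair := fun s => creationPair hue hew hee hee' hge s
  obtain ⟨C₁, hC₁, h₁⟩ := Tot.exists_norm_cr_le (j := j) rfl e
  obtain ⟨C₂, hC₂, h₂⟩ := Tot.exists_norm_an_le (j := j) rfl e
  obtain ⟨C₃, hC₃, h₃⟩ := Tot.exists_norm_cr_le (j := l) (l := j) (by omega) (P.adj _ e)
  obtain ⟨C₄, hC₄, h₄⟩ := Tot.exists_norm_an_le (j := l) (l := j) (by omega) (P.adj _ e)
  obtain ⟨D, hD, hgD⟩ := Tot.exists_norm_an_le (j := j) rfl g
  -- The summand 1 in B lets one constant bound both ‖A A' x‖ by ‖x‖ and ‖A A' η_0‖ by a = ‖A' η_0‖.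
  -- The factor (2 D² + 1) / c leaves ‖η_0‖² after the annihilation terms, at most 2 D² ‖η_0‖², are
  -- subtracted.
  obtain ⟨R, hR⟩ := ChebyshevSeq.exists_le_sum_norm_sq.{u} ht
    (B := (C₁ + C₄) * (1 + (C₂ + C₃))) (by positivity) ((2 * D ^ 2 + 1) / c)
  let Z : P.Bim j j → P.Bim j j := fun z =>
    Bim.mul j l j (Bim.of 1 rfl e) (Bim.mul l j j (Bim.of 1 (by omega) (P.adj _ e)) z)
  -- The recursion is solved among the diagrams, so that the dominating multiplications do not
  -- depend on ξ or s.
  obtain ⟨z, hz0, hz1, hz⟩ := exists_two_step_seq (Bim.of 0 rfl u)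
    ((t : ℂ)⁻¹ • (Z (Bim.of 0 rfl u) - (t : ℂ) ^ 2 • Bim.of 0 rfl u))
    (fun z z' => (t : ℂ)⁻¹ • (Z z' - (1 + (t : ℂ) ^ 2) • z' - (t : ℂ) • z))
  refine ⟨2, (List.range R).map fun i => Bim.mul m j j (Bim.of 1 (by omega) (P.adj _ g)) (z i),
    zero_le_two, fun {s} ξ => ?_⟩
  let η : ℕ → P.Tot j s := fun i => Bim.epi (Bim.mul j j s (z i) ξ)
  let A : P.Tot l s →ₗ[ℂ] P.Tot j s := Tot.cr (s := s) rfl e +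
    Tot.an (s := s) (j := l) (l := j) (by omega) (P.adj _ e)
  let A' : P.Tot j s →ₗ[ℂ] P.Tot l s := Tot.an (s := s) rfl e +
    Tot.cr (s := s) (j := l) (l := j) (by omega) (P.adj _ e)
  have hAA : ∀ x y, ⟪A x, y⟫_ℂ = ⟪x, A' y⟫_ℂ := fun x y => by
    simp only [A, A', LinearMap.add_apply, inner_add_left, inner_add_right]
    rw [Tot.inner_cr_left, Tot.inner_an_left]
  have hAA' : ∀ x y, ⟪A' x, y⟫_ℂ = ⟪x, A y⟫_ℂ := fun x y => by
    rw [← inner_conj_symm, ← hAA, inner_conj_symm]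
  have hA : ∀ x, ‖A x‖ ≤ (C₁ + C₄) * ‖x‖ := fun x => by
    rw [add_mul]
    exact (norm_add_le _ _).trans (add_le_add (h₁ x) (h₄ x))
  have hA' : ∀ x, ‖A' x‖ ≤ (C₂ + C₃) * ‖x‖ := fun x => by
    rw [add_mul]
    exact (norm_add_le _ _).trans (add_le_add (h₂ x) (h₃ x))
  have hZ : ∀ y : P.Bim j j, Bim.epi (Bim.mul j j s (Z y) ξ)
      = (A ∘ₗ A') (Bim.epi (Bim.mul j j s y ξ)) := fun y => by
    simp only [Z]
    rw [Bim.mul_mul, Bim.mul_mul, Bim.epi_mul_one, Bim.epi_mul_one, P.adj_adj, LinearMap.comp_apply,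
      add_comm (Tot.cr _ (P.adj _ e) _)]
    rfl
  have hη : ChebyshevSeq t (A ∘ₗ A') η := by
    constructor
    · simp only [η, hz1, hz0]
      rw [← hZ, map_smul, LinearMap.smul_apply, map_smul, smul_inv_smul₀ ht0, map_sub,
        LinearMap.sub_apply, map_sub, map_smul, LinearMap.smul_apply, map_smul]
      abel
    · intro i
      simp only [η, hz]
      rw [← hZ, map_smul, LinearMap.smul_apply, map_smul, smul_inv_smul₀ ht0]
      simp only [map_sub, LinearMap.sub_apply, map_smul, LinearMap.smul_apply]
      abel
  have hη0 : η 0 = Tot.act rfl u (Bim.epi ξ) := by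
    simp only [η, hz0]
    rw [Bim.epi_mul_zero]
  obtain ⟨hU, hsum⟩ := (pair s).sum_norm_sq_le ht hη
    (by rw [hη0, Tot.act_act rfl rfl rfl, huu]) hgD R
  have hK := hR (A ∘ₗ A') η hη (fun x => by
      refine (hA _).trans ?_
      rw [mul_assoc]
      refine mul_le_mul_of_nonneg_left ?_ (by positivity)
      linarith [hA' x, norm_nonneg x]) (fun x y => by
      rw [LinearMap.comp_apply, LinearMap.comp_apply, hAA, hAA']) ‖A' (η 0)‖ (norm_nonneg _) (by
      refine (hA _).trans ?_
      rw [mul_assoc]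
      refine mul_le_mul_of_nonneg_left ?_ (by positivity)
      nlinarith [norm_nonneg (A' (η 0))]) (by
      rw [LinearMap.comp_apply, hAA]
      exact inner_self_eq_norm_sq_to_K _)
  rw [List.map_map, ← hη0]
  rw [sum_map_range]
  have hterm : ∀ i ∈ Finset.range R, c * ‖η i‖ ^ 2
      ≤ 2 * ‖Bim.mul m j s (Bim.mul m j j (Bim.of 1 (by omega) (P.adj _ g)) (z i)) ξ‖ ^ 2
        + 2 * ‖Tot.an rfl g (η i)‖ ^ 2 := fun i _ => by
    rw [← Tot.norm_sq_cr (j := m) (by omega) rfl (g := P.adj _ g) (by rw [P.adj_adj, hgg]) (η i) (hU i),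
      Bim.mul_mul, ← Bim.norm_epi, Bim.epi_mul_one, P.adj_adj]
    have := norm_sub_le (Tot.cr (j := m) (l := j) (by omega) (P.adj _ g) (η i)
      + Tot.an (j := j) rfl g (η i)) (Tot.an (j := j) rfl g (η i))
    rw [add_sub_cancel_right] at this
    have h := pow_le_pow_left₀ (norm_nonneg _) this 2
    refine h.trans ?_
    simp only [η]
    nlinarith [sq_nonneg (‖Tot.cr (j := m) (l := j) (by omega) (P.adj _ g) (η i)
      + Tot.an (j := j) rfl g (η i)‖ - ‖Tot.an (j := j) rfl g (η i)‖)]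
  have h5 := Finset.sum_le_sum hterm
  rw [← Finset.mul_sum, Finset.sum_add_distrib, ← Finset.mul_sum, ← Finset.mul_sum] at h5
  rw [div_mul_eq_mul_div, div_le_iff₀ hc] at hK
  simp only [Function.comp_def]
  linarith

end FactorPlanarAlgebra

/-! ### Minimal projections, the principal graph and the depth. -/

namespace FactorPlanarAlgebra

variable {P : FactorPlanarAlgebra.{u}}
open PlanarAlgebra

namespace MinimalProjection

/-- The projection `p` is contained in (the equivalence class of) a multiple of `d` through strings. -/
def Sub (p : P.MinimalProjection) (d : ℕ) : Prop :=
  ∃ x : P.V (p.level + d), P.contract p.level rfl rfl rfl p.p x ≠ 0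

/-- The element y y* lies in p P p = ℂ p, and pairing with p determines the scalar, which is
positive. -/
theorem exists_contract_adj_eq (p : P.MinimalProjection) {d n : ℕ} (hn : n = p.level + d)
    (y : P.V n) (hy : P.contract p.level rfl hn hn p.p y = y) (hy0 : y ≠ 0) :
    ∃ c : ℝ, 0 < c ∧ c = ‖y‖ ^ 2 / ‖p.p‖ ^ 2 ∧
      P.contract d hn (by omega : n = d + p.level) rfl y (P.adj _ y) = (c : ℂ) • p.p := by
  have h1 : P.contract p.level rfl rfl rfl p.p (P.contract d hn (by omega : n = d + p.level) rfl y (P.adj _ y))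
      = P.contract d hn (by omega : n = d + p.level) rfl y (P.adj _ y) := by
    exact Eq.trans (b := P.contract d hn (by omega : n = d + p.level) rfl (P.contract p.level rfl hn hn p.p y)
      (P.adj _ y)) (contract_assoc (h := by omega) ..).symm (by rw [hy])
  have h2 : P.contract p.level rfl rfl rfl (P.contract d hn (by omega : n = d + p.level) rfl y (P.adj _ y)) p.p
      = P.contract d hn (by omega : n = d + p.level) rfl y (P.adj _ y) := by
    have := congrArg (P.adj _) h1
    rw [adj_contract, adj_contract, P.adj_adj, p.adj_p] at this
    exact (congrArg (fun z => P.contract p.level rfl rfl rfl z p.p) (contract_congr ..)).trans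
      ((contract_congr ..).trans (this.trans (contract_congr ..)))
  obtain ⟨c, hc⟩ := p.minimal (P.contract d hn (by omega : n = d + p.level) rfl y (P.adj _ y))
  rw [h1, h2] at hc
  have hp : 0 < ‖p.p‖ := norm_pos_iff.2 p.ne_zero
  have h3 : (‖y‖ : ℂ) ^ 2 = c * (‖p.p‖ : ℂ) ^ 2 := by
    have h4 := pair_contract_right (P := P) (i := d) (j := p.level) (r := p.level) (by omega) rfl (by omega) y p.p y
    rw [hy, hc, ← inner_eq, ← inner_eq, inner_smul_right] at h4
    exact (inner_self_eq_norm_sq_to_K y).symm.trans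
      (h4.trans (congrArg _ (inner_self_eq_norm_sq_to_K p.p)))
  have h5 : c = ((‖y‖ ^ 2 / ‖p.p‖ ^ 2 : ℝ) : ℂ) := by
    push_cast
    rw [h3, mul_div_cancel_right₀]
    exact pow_ne_zero _ (by exact_mod_cast hp.ne')
  refine ⟨_, ?_, rfl, h5 ▸ hc⟩
  have := norm_pos_iff.2 hy0
  positivity

theorem contract_mul_p (p : P.MinimalProjection) {d n : ℕ} (hn : n = p.level + d) (x : P.V n) :
    P.contract p.level rfl hn hn p.p (P.contract p.level rfl hn hn p.p x)
      = P.contract p.level rfl hn hn p.p x := by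
  rw [← contract_assoc (h₈ := hn) (h₉ := hn) (h₁₀ := rfl) (h₁₁ := hn) (h₁₂ := hn) (h₃ := hn) (h₁ := rfl) (h₂ := hn) (h₄ := rfl) (h₅ := rfl) (h₆ := rfl) (h := by omega), p.mul_p]

theorem Sub.dominated {p : P.MinimalProjection} {m : ℕ} (h : p.Sub m) : Dominated m p.p := by
  obtain ⟨x, hx⟩ := h
  obtain ⟨c, hc, -, h⟩ := p.exists_contract_adj_eq rfl _ (p.contract_mul_p rfl x) hx
  refine Dominated.of_mul_adj rfl (c := (c : ℂ)⁻¹) (y := P.contract p.level rfl rfl rfl p.p x) ?_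
  rw [h, inv_smul_smul₀]
  exact_mod_cast hc.ne'

/-- A cup is placed next to x; closing it to a loop recovers δ times the nonzero element. -/
theorem Sub.add_two (hδ : 1 < P.delta) {p : P.MinimalProjection} {d : ℕ} (h : p.Sub d) :
    p.Sub (d + 2) := by
  obtain ⟨x, hx⟩ := h
  refine ⟨P.contract 0 (a := p.level + d) (b := 2) (n := p.level + (d + 2)) rfl rfl (by omega) x
    P.cup, fun h0 => hx ?_⟩
  have e : P.contract 0 (a := p.level + d) (b := 2) (n := p.level + (d + 2)) rfl rfl (by omega)
      (P.contract p.level rfl rfl rfl p.p x) P.cup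
      = P.contract p.level rfl rfl rfl p.p (P.contract 0 (a := p.level + d) (b := 2)
        (n := p.level + (d + 2)) rfl rfl (by omega) x P.cup) := contract_assoc (h := by omega) ..
  rw [← e] at h0
  have h1 := cap_ins_cup_eq (P := P) (i := p.level + d) le_rfl rfl
    (P.contract p.level rfl rfl rfl p.p x)
  have h2 : P.ins (p.level + d) le_rfl rfl (P.contract p.level rfl rfl rfl p.p x) P.cup = 0 := h0
  rw [h2, map_zero] at h1
  have h3 : (P.delta : ℂ) ≠ 0 := by
    exact_mod_cast (by linarith : P.delta ≠ 0)
  exact (smul_eq_zero.1 h1.symm).resolve_left h3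

theorem Sub.of_equivalent {p q : P.MinimalProjection} {d n : ℕ} (h : p.Sub d)
    (hn : n = p.level + q.level) (hn' : n = q.level + p.level) (v : P.V n)
    (h₁ : P.contract q.level hn hn' rfl v (P.adj _ v) = p.p)
    (h₂ : P.contract p.level hn' hn rfl (P.adj _ v) v = q.p) : q.Sub d := by
  obtain ⟨x, hx⟩ := h
  refine ⟨P.contract p.level hn' rfl rfl (P.adj _ v) x, fun h0 => hx ?_⟩
  have h3 := congrArg (P.contract q.level hn rfl rfl v) h0
  have e1 : P.contract q.level rfl rfl rfl q.p (P.contract p.level hn' rfl rfl (P.adj _ v) x)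
      = P.contract p.level (n := q.level + d) hn' rfl rfl (P.adj _ v)
        (P.contract p.level rfl rfl rfl p.p x) := by
    rw [← h₂, contract_assoc (h₈ := rfl) (h₉ := rfl) (h₁₀ := hn) (h₁₁ := rfl) (h₁₂ := rfl)
      (h := by omega), ← contract_assoc (h₁ := rfl) (h₂ := rfl) (h₃ := rfl) (h₄ := hn) (h₅ := hn')
      (h₆ := rfl) (h := by omega), h₁]
  rw [e1, map_zero, ← contract_assoc (h₁ := rfl) (h₂ := rfl) (h₃ := rfl) (h₄ := hn) (h₅ := hn')
      (h₆ := rfl) (h := by omega), h₁, p.contract_mul_p] at h3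
  exact h3

theorem Equivalent.sub_iff {p q : P.MinimalProjection} (h : p.Equivalent q) (d : ℕ) :
    p.Sub d ↔ q.Sub d := by
  obtain ⟨v, h₁, h₂⟩ := h
  exact ⟨fun h => h.of_equivalent rfl (Nat.add_comm _ _) v h₁ h₂, fun h =>
    h.of_equivalent (Nat.add_comm _ _) rfl (P.adj _ v) (by rwa [P.adj_adj]) (by rwa [P.adj_adj])⟩

/-- Passing from `p` to a neighbour in the principal graph. -/
theorem Sub.succ_of_edge {p q : P.MinimalProjection} {d : ℕ} (x : P.V (p.level + 1 + q.level))
    (hx : P.contract q.level rfl rfl rfl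
      (P.contract (p.level + 1) rfl rfl rfl (P.addStrand p.p) x : P.V (p.level + 1 + q.level)) q.p ≠ 0) :
    (p.Sub d → q.Sub (d + 1)) ∧ (q.Sub d → p.Sub (d + 1)) := by
  set w : P.V (p.level + 1 + q.level) := P.contract q.level rfl rfl rfl
      (P.contract (p.level + 1) rfl rfl rfl (P.addStrand p.p) x : P.V (p.level + 1 + q.level)) q.p
    with hw
  have hpp : P.contract (p.level + 1) rfl rfl rfl (P.addStrand p.p) (P.addStrand p.p)
      = P.addStrand p.p := by
    have := contract_addStrand_addStrand (P := P.toPlanarAlgebra) (r := p.level) (a := p.level)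
      (b := p.level) (n' := p.level + 1 + (p.level + 1)) (m' := p.level + 1 + (p.level + 1))
      (k' := p.level + 1 + (p.level + 1)) rfl (by omega) rfl (by omega) rfl (by omega) p.p p.p
    rwa [p.mul_p] at this
  have hpw : P.contract (p.level + 1) rfl rfl rfl (P.addStrand p.p) w = w := by
    rw [hw, ← contract_assoc (h₁ := rfl) (h₂ := rfl) (h₃ := rfl) (h₄ := rfl) (h₅ := rfl) (h₆ := rfl)
      (h := by omega), ← contract_assoc (h₁ := rfl) (h₂ := rfl) (h₃ := rfl) (h₄ := rfl) (h₅ := rfl) (h₆ := rfl)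
      (h := by omega), hpp]
  have hwq : P.contract q.level rfl rfl rfl w q.p = w := by
    rw [hw, contract_assoc (h₈ := rfl) (h₉ := rfl) (h₁₀ := rfl) (h₁₁ := rfl) (h₁₂ := rfl)
      (h := by omega), q.mul_p]
  constructor
  · rintro ⟨y, hy⟩
    set y' : P.V (p.level + d) := P.contract p.level rfl rfl rfl p.p y with hy'
    obtain ⟨c, hc, -, h⟩ := p.exists_contract_adj_eq rfl y' (p.contract_mul_p rfl y) hy
    -- The strand is added below y', so By By* = c (1 ⊗ p). Hence w* By is nonzero: multiplied by
    -- By* it gives c w*.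
    let By : P.V (p.level + 1 + (d + 1)) := P.ins 1 one_le_two (by omega) P.cup y'
    have hB : P.contract (d + 1) (a := p.level + 1) rfl (by omega) rfl By (P.adj _ By)
        = (c : ℂ) • P.addStrand p.p := by
      have := contract_addStrand_addStrand (P := P.toPlanarAlgebra) (r := d) (a := p.level)
        (b := p.level) (n' := p.level + 1 + (p.level + 1)) (m' := p.level + 1 + (d + 1))
        (k' := p.level + 1 + (d + 1)) rfl (by omega) (by omega) (by omega) rfl (by omega) y' (P.adj _ y')
      rw [h, map_smul, ← adj_addStrand (by omega)] at this
      exact this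
    have hqw : P.contract q.level (b := p.level + 1) rfl (by omega) (by omega) q.p (P.adj _ w)
        = P.adj _ w := by
      have := congrArg (P.adj _) hwq
      rw [adj_contract, q.adj_p] at this
      exact (contract_congr ..).trans this
    have hwp : P.contract (p.level + 1) (a := q.level) (by omega) rfl (by omega) (P.adj _ w)
        (P.addStrand p.p)
        = P.adj _ w := by
      have := congrArg (P.adj _) hpw
      rw [adj_contract, addStrand, adj_addStrand (by omega), p.adj_p] at this
      exact (contract_congr ..).trans this
    refine ⟨P.contract (p.level + 1) (by omega) rfl rfl (P.adj _ w) By, fun h0 => hx ?_⟩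
    have e : P.contract q.level rfl rfl rfl q.p
        (P.contract (p.level + 1) (a := q.level) (n := q.level + (d + 1)) (by omega) rfl rfl (P.adj _ w) By)
        = P.contract (p.level + 1) (a := q.level) (n := q.level + (d + 1)) (by omega) rfl rfl
          (P.contract q.level (b := p.level + 1) (n := p.level + 1 + q.level) rfl (by omega)
            (by omega) q.p (P.adj _ w)) By :=
      (contract_assoc (h := by omega) ..).symm
    rw [e, hqw] at h0
    have h1 := congrArg (fun y => P.contract (d + 1) (a := q.level) (b := p.level + 1)
      (n := p.level + 1 + q.level) rfl (by omega) (by omega) y (P.adj _ By)) h0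
    simp only [map_zero, LinearMap.zero_apply] at h1
    have e : P.contract (d + 1) (a := q.level) (b := p.level + 1)
      (n := p.level + 1 + q.level) rfl (by omega) (by omega)
        (P.contract (p.level + 1) (a := q.level) (n := q.level + (d + 1)) (by omega) rfl rfl (P.adj _ w) By)
        (P.adj _ By) = P.contract (p.level + 1) (a := q.level) (b := p.level + 1) (by omega) rfl (by omega) (P.adj _ w)
        (P.contract (d + 1) (a := p.level + 1) rfl (by omega) rfl By (P.adj _ By)) :=
      contract_assoc (h := by omega) ..
    rw [e, hB, map_smul, hwp] at h1
    have h2 := (smul_eq_zero.1 h1).resolve_left (by exact_mod_cast hc.ne')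
    rw [← P.adj_adj w, h2, map_zero]
  · rintro ⟨y, hy⟩
    set y' : P.V (q.level + d) := P.contract q.level rfl rfl rfl q.p y with hy'
    obtain ⟨c, hc, -, h⟩ := q.exists_contract_adj_eq rfl y' (q.contract_mul_p rfl y) hy
    -- The product w y' is nonzero and fixed by p with a strand below; rotation moves that strand to
    -- the d right strings.
    let z : P.V (p.level + (d + 1)) :=
      P.contract q.level (a := p.level + 1) (b := d) rfl rfl (by omega) w y'
    have hz : z ≠ 0 := fun h0 => hx (by
      have h1 := congrArg (fun z => P.contract d (a := p.level + 1) (b := q.level)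
        (n := p.level + 1 + q.level) (by omega) (by omega) (by omega) z (P.adj _ y')) h0
      simp only [map_zero, LinearMap.zero_apply, z] at h1
      have e : P.contract d (a := p.level + 1) (b := q.level) (n := p.level + 1 + q.level)
          (by omega) (by omega) (by omega) (P.contract q.level (a := p.level + 1) (b := d)
            (n := p.level + (d + 1)) rfl rfl (by omega) w y') (P.adj _ y')
          = P.contract q.level rfl rfl rfl w
            (P.contract d rfl (by omega : q.level + d = d + q.level) rfl y' (P.adj _ y')) :=
        contract_assoc (h := by omega) ..
      rw [e, h, map_smul, hwq] at h1
      exact (smul_eq_zero.1 h1).resolve_left (by exact_mod_cast hc.ne'))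
    have hpz : P.contract (p.level + 1) (a := p.level + 1) (b := d) rfl (by omega) (by omega)
        (P.addStrand p.p) z = z := by
      simp only [z]
      rw [← contract_assoc (h₁ := rfl) (h₂ := rfl) (h₃ := by omega) (h₄ := rfl) (h₅ := rfl)
        (h₆ := rfl) (h := by omega), hpw]
    refine ⟨P.rot z, fun h0 => hz ?_⟩
    have h1 := contract_rot (l := p.level) (r := d) rfl (by omega) rfl
      (q := p.level + 1 + (p.level + 1)) (by omega) p.p z
    rw [h0] at h1
    apply rot_injective
    have h2 : P.rot (0 : P.V (p.level + d + 1)) = 0 := by simp [rot]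
    exact ((congrArg P.rot hpz).symm.trans h1.symm).trans h2.symm

end MinimalProjection

/-- Containment of a vertex of the principal graph in a multiple of `d` through strings. -/
def Vertex.Sub (v : P.Vertex) (d : ℕ) : Prop :=
  Quot.lift (fun p : P.MinimalProjection => p.Sub d) (fun _ _ h => propext (h.sub_iff d)) v

theorem Vertex.Sub.succ_of_adj {α β : P.Vertex} (h : P.principalGraph.Adj α β) {d : ℕ}
    (hα : α.Sub d) : β.Sub (d + 1) := by
  rw [principalGraph, SimpleGraph.fromRel_adj] at h
  obtain ⟨-, ⟨p, q, rfl, rfl, x, hx⟩ | ⟨p, q, rfl, rfl, x, hx⟩⟩ := h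
  · exact (MinimalProjection.Sub.succ_of_edge x hx).1 hα
  · exact (MinimalProjection.Sub.succ_of_edge x hx).2 hα

theorem Vertex.Sub.add_length {α β : P.Vertex} (w : P.principalGraph.Walk α β) {d : ℕ}
    (hα : α.Sub d) : β.Sub (d + w.length) := by
  induction w generalizing d with
  | nil => exact hα
  | cons h w ih =>
    have := ih (hα.succ_of_adj h)
    rwa [SimpleGraph.Walk.length_cons, Nat.add_comm w.length, ← Nat.add_assoc]

theorem MinimalProjection.exists_sub_of_depth {n : ℕ} (hn : P.depth = n) (p : P.MinimalProjection) :
    ∃ d ≤ n, p.Sub d := by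
  have h0 : Vertex.Sub (Quot.mk _ P.emptyProjection : P.Vertex) 0 := by
    refine ⟨P.empty, fun h => P.emptyProjection.ne_zero ?_⟩
    exact (P.empty_ins P.empty).symm.trans h
  have h1 : P.principalGraph.edist (Quot.mk _ P.emptyProjection) (Quot.mk _ p) ≤ n :=
    hn ▸ SimpleGraph.edist_le_eccent
  obtain ⟨w, hw⟩ := SimpleGraph.exists_walk_of_edist_ne_top
    (ne_top_of_le_ne_top (ENat.natCast_ne_top n) h1)
  rw [← hw, Nat.cast_le] at h1
  refine ⟨w.length, h1, ?_⟩
  have := h0.add_length w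
  rwa [Nat.zero_add] at this

/-- The number of strings can be raised in steps of two, so only its parity matters. -/
theorem MinimalProjection.sub_or_sub (hδ : 1 < P.delta) {m : ℕ} (hm : P.depth = (m + 1 : ℕ))
    (p : P.MinimalProjection) : p.Sub m ∨ p.Sub (m + 1) := by
  obtain ⟨d, hd, h⟩ := p.exists_sub_of_depth hm
  have key : ∀ i, p.Sub (d + 2 * i) := fun i => by
    induction i with
    | zero => exact h
    | succ i ih => exact ih.add_two hδ
  rcases Nat.even_or_odd' (m + 1 - d) with ⟨c, hc | hc⟩
  · right
    have := key c
    rwa [← hc, Nat.add_sub_cancel' hd] at this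
  · left
    have := key c
    rwa [show d + 2 * c = m by omega] at this

/-- If p lies inside m strings it factors through them. Otherwise p lies inside m + 1 strings
through some g, and `Dominated.of_creation` applies once g* e = 0 is known. -/
theorem MinimalProjection.dominated_of_creation (hδ : 1 < P.delta) {m : ℕ}
    (hm : P.depth = (m + 1 : ℕ)) (p q : P.MinimalProjection) {t : ℝ} (ht : 1 ≤ t)
    {n : ℕ} (hn : n = p.level + 1 + q.level) {e : P.V n}
    (hue : P.contract p.level (b := 1 + q.level) rfl (by omega) (by omega) p.p e = e)
    (hew : P.contract q.level hn rfl hn e q.p = e)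
    (hee : P.contract (p.level + 1) (a := q.level) (b := q.level) (by omega) (by omega) rfl
      (P.adj _ e) e = q.p)
    (hee' : P.contract (q.level + 1) (a := p.level) (b := p.level) (by omega) (by omega) rfl e
      (P.adj _ e) = (t : ℂ) ^ 2 • p.p) : Dominated m p.p ∨ Dominated m q.p := by
  subst hn
  by_cases hq : Dominated m q.p
  · exact Or.inr hq
  refine Or.inl ?_
  rcases p.sub_or_sub hδ hm with hp | hp
  · exact hp.dominated
  obtain ⟨x, hx⟩ : ∃ x : P.V (p.level + 1 + m), P.contract p.level (b := m + 1)
      (n := p.level + 1 + m) rfl (by omega) (by omega) p.p x ≠ 0 := by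
    have key : ∀ n (h : p.level + (m + 1) = n), ∃ x : P.V n,
        P.contract p.level rfl h.symm h.symm p.p x ≠ 0 := by
      rintro _ rfl
      exact hp
    exact key _ (by omega)
  have hn : p.level + 1 + m = p.level + (m + 1) := by omega
  set g : P.V (p.level + 1 + m) := P.contract p.level rfl hn hn p.p x
  have hpg : P.contract p.level rfl hn hn p.p g = g := p.contract_mul_p hn x
  obtain ⟨c, hc, -, hgg⟩ := p.exists_contract_adj_eq hn g hpg hx
  refine Dominated.of_creation (c := c) ht hc p.mul_p hue hew hee hee'
    ((contract_congr ..).trans hgg) ?_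
  -- A nonzero g* e would exhibit q inside m strings, making q dominated.
  by_contra hne
  set z : P.V (m + q.level) :=
    P.contract (p.level + 1) (a := m) (by omega) rfl rfl (P.adj _ g) e with hz
  have hzq : P.contract q.level rfl rfl rfl z q.p = z := by
    have e1 : P.contract q.level rfl rfl rfl z q.p = P.contract (p.level + 1) (a := m) (by omega)
      rfl rfl (P.adj _ g) (P.contract q.level rfl rfl rfl e q.p) := contract_assoc (h := by omega) ..
    rw [e1, hew]
  have hqz : P.contract q.level rfl (Nat.add_comm m _) (Nat.add_comm m _) q.p (P.adj _ z)
      = P.adj _ z := by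
    have := congrArg (P.adj _) hzq
    rwa [adj_contract, q.adj_p] at this
  obtain ⟨c', hc', -, hzz⟩ := q.exists_contract_adj_eq (Nat.add_comm m _) _ hqz fun h0 => hne (by
    rw [← P.adj_adj z, h0, map_zero])
  refine hq (Dominated.of_mul_adj (Nat.add_comm m _) (y := P.adj _ z) (c := (c' : ℂ)⁻¹) ?_)
  rw [hzz, inv_smul_smul₀]
  exact_mod_cast hc'.ne'

/-- By contradiction: if the ideal of dominated elements is proper, it misses a minimal projection
p₀, then p₀ ⊗ 1, then a minimal q₀ below p₀ ⊗ 1. Read with one string on top, q₀ is an edge between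
p₀ and itself. -/
theorem dominated_idn_of_depth (hδ : 1 < P.delta) {m : ℕ} (hm : P.depth = (m + 1 : ℕ)) (k : ℕ) :
    Dominated m (P.idn k) := by
  by_contra hk
  obtain ⟨p₀, hp1, hp2, hp3, hp4, hpJ, -⟩ := exists_minimal_projection (P.dominatedIdeal m k)
    (fun b x hx => Dominated.mul_left hx b) (fun b x hx => Dominated.mul_right hx b) (P.idn k)
    (P.idn_contract rfl _) hk
  let p : P.MinimalProjection := ⟨k, p₀, hp1, hp2, hp3, hp4⟩
  let p' : P.V (k + 1 + (k + 1)) := P.ins k (by omega) (by omega) p₀ P.cup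
  have hp'J : p' ∉ P.dominatedIdeal m (k + 1) := fun h => hpJ (Dominated.of_ins_cup hδ h)
  have hp' : ∀ {b n} (x : P.V n) (hn : n = k + 1 + b), P.contract (k + 1) rfl hn hn p' x
      = P.contract k rfl (by omega : n = k + (1 + b)) (by omega) p₀ x := fun x hn =>
    contract_ins_cup rfl hn (by omega) hn p₀ x
  have hp'2 : P.contract (k + 1) rfl rfl rfl p' p' = p' := by
    have h1 : P.contract k (b := 1 + (k + 1)) (n := k + 1 + (k + 1)) rfl (by omega) (by omega) p₀ (P.idn (k + 1)) = p' :=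
      (hp' _ rfl).symm.trans (P.contract_idn rfl p')
    rw [hp' _ rfl]
    conv_lhs => rw [← h1]
    have e : P.contract k (b := 1 + (k + 1)) (n := k + 1 + (k + 1)) rfl (by omega) (by omega) p₀
        (P.contract k (b := 1 + (k + 1)) (n := k + 1 + (k + 1)) rfl (by omega) (by omega) p₀ (P.idn (k + 1)))
        = P.contract k (b := 1 + (k + 1)) (n := k + 1 + (k + 1)) rfl (by omega) (by omega)
          (P.contract k rfl rfl rfl p₀ p₀) (P.idn (k + 1)) := (contract_assoc (h := by omega) ..).symm
    rw [e, hp2, h1]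
  obtain ⟨q₀, hq1, hq2, hq3, hq4, hqJ, hpq⟩ := exists_minimal_projection
    (P.dominatedIdeal m (k + 1)) (fun b x hx => Dominated.mul_left hx b)
    (fun b x hx => Dominated.mul_right hx b) p' hp'2 hp'J
  let q : P.MinimalProjection := ⟨k + 1, q₀, hq1, hq2, hq3, hq4⟩
  have hpe : P.contract k rfl (Nat.add_assoc k 1 (k + 1)) (Nat.add_assoc k 1 (k + 1)) p₀ q₀ = q₀ :=
    (hp' q₀ rfl).symm.trans hpq
  -- The scalar b is the ratio of the traces of q₀ and p₀. The analytic lemma needs t ≥ 1: for b ≥ 1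
  -- it is applied to p with t = √b, and for b ≤ 1 to q with the edge rescaled by 1 / √b and t = 1 /
  -- √b.
  obtain ⟨b, hb, -, hee⟩ := p.exists_contract_adj_eq (d := k + 1 + 1) (n := k + 1 + (k + 1))
    (by simp only [p]; omega) q₀ ((contract_congr ..).trans hpe) hq3
  rcases le_total 1 b with h1 | h1
  · refine (p.dominated_of_creation hδ hm q (t := Real.sqrt b) (Real.one_le_sqrt.2 h1) rfl (e := q₀)
      hpe hq2 ?_ ?_).elim hpJ hqJ
    · rw [hq1]
      exact (contract_congr ..).trans hq2
    · refine (contract_congr ..).trans (hee.trans ?_)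
      rw [← Complex.ofReal_pow, Real.sq_sqrt hb.le]
  · have hqp : P.contract k (a := k + 1 + 1) (by omega) rfl (by omega) q₀ p₀ = q₀ := by
      have := congrArg (P.adj _) hpe
      rw [adj_contract, hp1, hq1] at this
      exact (contract_congr ..).trans this
    have hs : ((Real.sqrt b⁻¹ : ℝ) : ℂ) * (Real.sqrt b⁻¹ : ℝ) = ((b⁻¹ : ℝ) : ℂ) := by
      rw [← Complex.ofReal_mul, Real.mul_self_sqrt (inv_nonneg.2 hb.le)]
    have hadj : P.adj _ (((Real.sqrt b⁻¹ : ℝ) : ℂ) • q₀) = ((Real.sqrt b⁻¹ : ℝ) : ℂ) • q₀ := by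
      rw [LinearMap.map_smulₛₗ, Complex.conj_ofReal, hq1]
    refine (q.dominated_of_creation hδ hm p (t := Real.sqrt b⁻¹) (Real.one_le_sqrt.2
      ((one_le_inv₀ hb).2 h1)) (n := k + 1 + (k + 1)) (by simp only [p, q]; omega)
      (e := ((Real.sqrt b⁻¹ : ℝ) : ℂ) • q₀) ?_ ?_ ?_ ?_).elim hqJ hpJ
    · rw [map_smul]
      exact congrArg _ ((contract_congr ..).trans hq2)
    · rw [map_smul, LinearMap.smul_apply]
      exact congrArg _ ((contract_congr ..).trans hqp)
    · rw [hadj, map_smul, map_smul, LinearMap.smul_apply, smul_smul, hs]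
      rw [hq1] at hee
      refine (congrArg _ ((contract_congr ..).trans hee)).trans ?_
      rw [smul_smul, ← Complex.ofReal_mul, inv_mul_cancel₀ hb.ne', Complex.ofReal_one, one_smul]
    · rw [hadj, map_smul, map_smul, LinearMap.smul_apply, smul_smul, pow_two]
      exact congrArg _ ((contract_congr ..).trans hq2)

end FactorPlanarAlgebra

/-! ### Closures of two representations with equal norms. -/

section PairedRepresentations

variable {A B : Type*} [CStarAlgebra A] [CStarAlgebra B]

/-- Equality of norms makes the first projection isometric on the complete closure of S₀, so its
image is closed. -/
theorem exists_mem_closure_of_norm_fst_eq (S₀ : StarSubalgebra ℂ (A × B))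
    (h : ∀ x ∈ S₀.topologicalClosure, ‖x.1‖ = ‖x.2‖) {a : A}
    (ha : a ∈ closure (Prod.fst '' (S₀ : Set (A × B)))) : ∃ b, (a, b) ∈ S₀.topologicalClosure := by
  let π : S₀.topologicalClosure →+ A :=
    (AddMonoidHom.fst A B).comp (S₀.topologicalClosure.toSubalgebra.toSubmodule.toAddSubgroup.subtype)
  have hπ : Isometry π := AddMonoidHomClass.isometry_of_norm π fun x => by
    have h1 : ‖x‖ = max ‖x.1.1‖ ‖x.1.2‖ := rfl
    rw [h1, ← h x.1 x.2, max_self]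
    rfl
  have : CompleteSpace S₀.topologicalClosure :=
    S₀.isClosed_topologicalClosure.completeSpace_coe
  have hcl : IsClosed (Set.range π) := hπ.isClosedEmbedding.isClosed_range
  have hsub : Prod.fst '' (S₀ : Set (A × B)) ⊆ Set.range π := by
    rintro _ ⟨x, hx, rfl⟩
    exact ⟨⟨x, S₀.le_topologicalClosure hx⟩, rfl⟩
  obtain ⟨x, rfl⟩ := closure_minimal hsub hcl ha
  exact ⟨x.1.2, x.2⟩

theorem exists_mem_closure_of_norm_snd_eq (S₀ : StarSubalgebra ℂ (A × B))
    (h : ∀ x ∈ S₀.topologicalClosure, ‖x.1‖ = ‖x.2‖) {b : B}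
    (hb : b ∈ closure (Prod.snd '' (S₀ : Set (A × B)))) : ∃ a, (a, b) ∈ S₀.topologicalClosure := by
  let π : S₀.topologicalClosure →+ B :=
    (AddMonoidHom.snd A B).comp (S₀.topologicalClosure.toSubalgebra.toSubmodule.toAddSubgroup.subtype)
  have hπ : Isometry π := AddMonoidHomClass.isometry_of_norm π fun x => by
    have h1 : ‖x‖ = max ‖x.1.1‖ ‖x.1.2‖ := rfl
    rw [h1, h x.1 x.2, max_self]
    rfl
  have : CompleteSpace S₀.topologicalClosure :=
    S₀.isClosed_topologicalClosure.completeSpace_coe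
  have hcl : IsClosed (Set.range π) := hπ.isClosedEmbedding.isClosed_range
  have hsub : Prod.snd '' (S₀ : Set (A × B)) ⊆ Set.range π := by
    rintro _ ⟨x, hx, rfl⟩
    exact ⟨⟨x, S₀.le_topologicalClosure hx⟩, rfl⟩
  obtain ⟨x, rfl⟩ := closure_minimal hsub hcl hb
  exact ⟨x.1.1, x.2⟩

/-- Two representations with equal norms on a dense `*`-algebra have isomorphic closures. -/
theorem exists_starAlgHom_of_norm_eq (S₀ : StarSubalgebra ℂ (A × B))
    (h : ∀ x ∈ S₀, ‖x.1‖ = ‖x.2‖) (S : StarSubalgebra ℂ A)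
    (hS : (S : Set A) = closure (Prod.fst '' (S₀ : Set (A × B)))) :
    ∃ f : S →⋆ₐ[ℂ] B, Function.Injective f ∧
      Set.range f = closure (Prod.snd '' (S₀ : Set (A × B))) := by
  have h' : ∀ x ∈ S₀.topologicalClosure, ‖x.1‖ = ‖x.2‖ := by
    have hcl : IsClosed {x : A × B | ‖x.1‖ = ‖x.2‖} :=
      isClosed_eq continuous_fst.norm continuous_snd.norm
    exact fun x hx => closure_minimal (fun x hx => h x hx) hcl hx
  set D := S₀.topologicalClosure with hD
  -- The closure D is the graph of a function, which is the desired homomorphism.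
  have huniq : ∀ {a : A} {b b' : B}, (a, b) ∈ D → (a, b') ∈ D → b = b' := fun {a b b'} h₁ h₂ => by
    have := h' _ (D.sub_mem h₁ h₂)
    rw [Prod.mk_sub_mk, sub_self, norm_zero] at this
    exact sub_eq_zero.1 (norm_eq_zero.1 this.symm)
  have hex : ∀ a : S, ∃ b, (a.1, b) ∈ D := fun a =>
    exists_mem_closure_of_norm_fst_eq S₀ h' (hS ▸ a.2)
  choose g hg using hex
  refine ⟨{ toFun := g, map_one' := ?_, map_mul' := ?_, map_zero' := ?_, map_add' := ?_,
            commutes' := ?_, map_star' := ?_ }, ?_, ?_⟩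
  · exact huniq (hg 1) D.one_mem
  · exact fun a b => huniq (hg (a * b)) (D.mul_mem (hg a) (hg b))
  · exact huniq (hg 0) D.zero_mem
  · exact fun a b => huniq (hg (a + b)) (D.add_mem (hg a) (hg b))
  · exact fun r => huniq (hg _) (D.algebraMap_mem r)
  · exact fun a => huniq (hg _) (star_mem (hg a))
  · intro a b hab
    have h1 : (a.1 - b.1, g a - g b) ∈ D := D.sub_mem (hg a) (hg b)
    have h2 : g a = g b := hab
    have := h' _ h1
    rw [h2, sub_self, norm_zero, norm_eq_zero, sub_eq_zero] at this
    exact Subtype.ext this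
  · ext b
    constructor
    · rintro ⟨a, rfl⟩
      exact image_closure_subset_closure_image continuous_snd ⟨_, hg a, rfl⟩
    · intro hb
      obtain ⟨a, ha⟩ := exists_mem_closure_of_norm_snd_eq S₀ h' hb
      have haS : a ∈ S := by
        rw [← SetLike.mem_coe, hS]
        exact image_closure_subset_closure_image continuous_fst ⟨_, ha, rfl⟩
      exact ⟨⟨a, haS⟩, huniq (hg ⟨a, haS⟩) ha⟩

end PairedRepresentations

set_option linter.unusedSectionVars false

/-! ### Linking algebras of operator spaces on a finite sum of Hilbert spaces. -/

section LinkingAlgebra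

open ContinuousLinearMap

variable {ι : Type} [Fintype ι] [DecidableEq ι] (H : ι → Type u) [∀ i, NormedAddCommGroup (H i)]
  [∀ i, InnerProductSpace ℂ (H i)] [∀ i, CompleteSpace (H i)]

/-- The inclusion of a summand of a Hilbert space direct sum. -/
noncomputable def hilbertIncl (i : ι) : H i →L[ℂ] PiLp 2 H := adjoint (PiLp.proj 2 H i)

/-- The projection to a summand of a Hilbert space direct sum. -/
noncomputable def hilbertProj (i : ι) : PiLp 2 H →L[ℂ] H i := PiLp.proj 2 H i

variable {H}

theorem adjoint_hilbertIncl (i : ι) : adjoint (hilbertIncl H i) = hilbertProj H i :=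
  adjoint_adjoint _

theorem adjoint_hilbertProj (i : ι) : adjoint (hilbertProj H i) = hilbertIncl H i := rfl

theorem hilbertIncl_apply (i : ι) (x : H i) : hilbertIncl H i x = PiLp.single 2 i x := by
  refine ext_inner_right ℂ fun y => ?_
  rw [hilbertIncl, adjoint_inner_left, PiLp.inner_apply, Finset.sum_eq_single i]
  · rw [PiLp.single_eq_same]; rfl
  · intro j _ hj
    rw [PiLp.single_eq_of_ne 2 hj, inner_zero_left]
  · simp

theorem hilbertProj_comp_hilbertIncl (i : ι) : hilbertProj H i ∘L hilbertIncl H i = 1 := by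
  ext x
  rw [comp_apply, hilbertIncl_apply]
  exact PiLp.single_eq_same 2 ..

theorem hilbertProj_comp_hilbertIncl_of_ne {i j : ι} (h : i ≠ j) :
    hilbertProj H i ∘L hilbertIncl H j = 0 := by
  ext x
  rw [comp_apply, hilbertIncl_apply]
  exact PiLp.single_eq_of_ne 2 h ..

theorem sum_hilbertIncl_comp_hilbertProj : ∑ i, hilbertIncl H i ∘L hilbertProj H i = 1 := by
  ext x j
  rw [sum_apply]
  have h1 : ∀ i, (hilbertIncl H i ∘L hilbertProj H i) x = PiLp.single 2 i (x i) := fun i => by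
    rw [comp_apply, hilbertIncl_apply]; rfl
  simp only [h1]
  have h2 := map_sum (hilbertProj H j) (fun i => (PiLp.single 2 i (x i) : PiLp 2 H)) Finset.univ
  refine h2.trans ?_
  rw [Finset.sum_eq_single j]
  · exact PiLp.single_eq_same 2 ..
  · intro i _ hi
    exact PiLp.single_eq_of_ne 2 hi.symm ..
  · simp

/-- A system of closed operator spaces which is closed under composition and adjoints. -/
structure LinkingSystem (X : ∀ i j, Submodule ℂ (H j →L[ℂ] H i)) : Prop where
  closed : ∀ i j, IsClosed (X i j : Set (H j →L[ℂ] H i))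
  one_mem : ∀ i, 1 ∈ X i i
  comp_mem : ∀ {i j l} {S : H j →L[ℂ] H i} {T : H l →L[ℂ] H j}, S ∈ X i j → T ∈ X j l → S ∘L T ∈ X i l
  adjoint_mem : ∀ {i j} {T : H j →L[ℂ] H i}, T ∈ X i j → adjoint T ∈ X j i

variable {X : ∀ i j, Submodule ℂ (H j →L[ℂ] H i)}

theorem block_mul (S T : PiLp 2 H →L[ℂ] PiLp 2 H) (i l : ι) :
    hilbertProj H i ∘L (S * T) ∘L hilbertIncl H l
      = ∑ j, (hilbertProj H i ∘L S ∘L hilbertIncl H j) ∘L (hilbertProj H j ∘L T ∘L hilbertIncl H l) := by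
  have h : S * T = S ∘L (∑ j, hilbertIncl H j ∘L hilbertProj H j) ∘L T := by
    rw [sum_hilbertIncl_comp_hilbertProj]; rfl
  rw [h]
  ext x
  simp only [comp_apply, sum_apply, map_sum]

theorem eq_sum_block (T : PiLp 2 H →L[ℂ] PiLp 2 H) :
    T = ∑ i, ∑ j, hilbertIncl H i ∘L (hilbertProj H i ∘L T ∘L hilbertIncl H j) ∘L hilbertProj H j := by
  have h : T = (∑ j, hilbertIncl H j ∘L hilbertProj H j) ∘L T ∘L
      (∑ j, hilbertIncl H j ∘L hilbertProj H j) := by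
    rw [sum_hilbertIncl_comp_hilbertProj]; rfl
  conv_lhs => rw [h]
  ext1 x
  simp only [comp_apply, sum_apply, map_sum]
  rw [Finset.sum_comm]

/-- The linking algebra: the operators with matrix entries in the given spaces. -/
noncomputable def LinkingSystem.algebra (hX : LinkingSystem X) :
    StarSubalgebra ℂ (PiLp 2 H →L[ℂ] PiLp 2 H) where
  carrier := {T | ∀ i j, hilbertProj H i ∘L T ∘L hilbertIncl H j ∈ X i j}
  mul_mem' {S T} hS hT i l := by
    rw [block_mul]
    exact Submodule.sum_mem _ fun j _ => hX.comp_mem (hS i j) (hT j l)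
  add_mem' {S T} hS hT i j := by
    rw [add_comp, comp_add]
    exact Submodule.add_mem _ (hS i j) (hT i j)
  algebraMap_mem' r i j := by
    have h : hilbertProj H i ∘L (algebraMap ℂ (PiLp 2 H →L[ℂ] PiLp 2 H) r) ∘L hilbertIncl H j
        = r • (hilbertProj H i ∘L hilbertIncl H j) := by
      ext x
      simp [Algebra.algebraMap_eq_smul_one]
    rw [h]
    refine Submodule.smul_mem _ _ ?_
    by_cases hij : i = j
    · subst hij
      rw [hilbertProj_comp_hilbertIncl]
      exact hX.one_mem i
    · rw [hilbertProj_comp_hilbertIncl_of_ne hij]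
      exact Submodule.zero_mem _
  star_mem' {T} hT i j := by
    have := hX.adjoint_mem (hT j i)
    rwa [adjoint_comp, adjoint_comp, adjoint_hilbertIncl, adjoint_hilbertProj] at this

theorem LinkingSystem.isClosed_algebra (hX : LinkingSystem X) :
    IsClosed (hX.algebra : Set (PiLp 2 H →L[ℂ] PiLp 2 H)) := by
  have : (hX.algebra : Set (PiLp 2 H →L[ℂ] PiLp 2 H)) = ⋂ i, ⋂ j,
      (fun T => hilbertProj H i ∘L T ∘L hilbertIncl H j) ⁻¹' (X i j : Set (H j →L[ℂ] H i)) := by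
    ext T
    simp only [Set.mem_iInter]
    rfl
  rw [this]
  exact isClosed_iInter fun i => isClosed_iInter fun j => (hX.closed i j).preimage (by fun_prop)

theorem LinkingSystem.corner_mem (hX : LinkingSystem X) {i j : ι} {T : H j →L[ℂ] H i}
    (hT : T ∈ X i j) : hilbertIncl H i ∘L T ∘L hilbertProj H j ∈ hX.algebra := by
  intro a b
  by_cases ha : a = i
  · by_cases hb : j = b
    · subst ha hb
      have h1 : hilbertProj H a ∘L (hilbertIncl H a ∘L T ∘L hilbertProj H j) ∘L hilbertIncl H j
          = (hilbertProj H a ∘L hilbertIncl H a) ∘L T ∘L (hilbertProj H j ∘L hilbertIncl H j) := rfl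
      rw [h1, hilbertProj_comp_hilbertIncl, hilbertProj_comp_hilbertIncl]
      exact hT
    · have h1 : hilbertProj H a ∘L (hilbertIncl H i ∘L T ∘L hilbertProj H j) ∘L hilbertIncl H b
          = (hilbertProj H a ∘L hilbertIncl H i) ∘L T ∘L (hilbertProj H j ∘L hilbertIncl H b) := rfl
      rw [h1, hilbertProj_comp_hilbertIncl_of_ne hb, comp_zero, comp_zero]
      exact Submodule.zero_mem _
  · have h1 : hilbertProj H a ∘L (hilbertIncl H i ∘L T ∘L hilbertProj H j) ∘L hilbertIncl H b
        = (hilbertProj H a ∘L hilbertIncl H i) ∘L T ∘L (hilbertProj H j ∘L hilbertIncl H b) := rfl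
    rw [h1, hilbertProj_comp_hilbertIncl_of_ne ha, zero_comp]
    exact Submodule.zero_mem _

noncomputable instance (hX : LinkingSystem X) : CStarAlgebra hX.algebra :=
  StarSubalgebra.cstarAlgebra _ (h_closed := hX.isClosed_algebra)

theorem LinkingSystem.separableSpace (hX : LinkingSystem X)
    (hsep : ∀ i j, TopologicalSpace.IsSeparable (X i j : Set (H j →L[ℂ] H i))) :
    TopologicalSpace.SeparableSpace hX.algebra := by
  have : ∀ i j, TopologicalSpace.SeparableSpace (X i j) := fun i j => (hsep i j).separableSpace
  let F : (∀ i j, X i j) → hX.algebra := fun T =>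
    ∑ i, ∑ j, ⟨hilbertIncl H i ∘L (T i j).1 ∘L hilbertProj H j, hX.corner_mem (T i j).2⟩
  have hF : Continuous F := by
    refine continuous_finsetSum _ fun i _ => continuous_finsetSum _ fun j _ => ?_
    refine Continuous.subtype_mk ?_ _
    have : Continuous fun T : (∀ i j, X i j) => (T i j).1 := by fun_prop
    fun_prop
  refine DenseRange.separableSpace (f := F) (Function.Surjective.denseRange fun T => ?_) hF
  refine ⟨fun i j => ⟨hilbertProj H i ∘L T.1 ∘L hilbertIncl H j, T.2 i j⟩, Subtype.ext ?_⟩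
  simp only [F]
  rw [AddSubmonoidClass.coe_finsetSum]
  conv_rhs => rw [eq_sum_block T.1]
  refine Finset.sum_congr rfl fun i _ => ?_
  rw [AddSubmonoidClass.coe_finsetSum]

end LinkingAlgebra

/-! ### Corners of the linking algebra: heredity and fullness. -/

section LinkingAlgebra

open ContinuousLinearMap

variable {ι : Type} [Fintype ι] [DecidableEq ι] {H : ι → Type u} [∀ i, NormedAddCommGroup (H i)]
  [∀ i, InnerProductSpace ℂ (H i)] [∀ i, CompleteSpace (H i)]
  {X : ∀ i j, Submodule ℂ (H j →L[ℂ] H i)}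

/-- On a vector η = ξ - e ξ the operator a vanishes, so -‖y η‖² = ‖z η‖² and y η = 0. For c = y* y
below a corner element a this shows c = e c e. -/
theorem comp_eq_of_sub_eq_adjoint_comp {K : Type*} [NormedAddCommGroup K] [InnerProductSpace ℂ K]
    [CompleteSpace K] {a e y z : K →L[ℂ] K} (ha : a ∘L e = a)
    (h : a - adjoint y ∘L y = adjoint z ∘L z) : y ∘L e = y := by
  ext1 ξ
  have h0 : a (ξ - e ξ) = 0 := by
    rw [map_sub, sub_eq_zero]
    exact (congrArg (· ξ) ha).symm
  set η := ξ - e ξ with hη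
  have h1 : ⟪(a - adjoint y ∘L y) η, η⟫_ℂ = ⟪z η, z η⟫_ℂ := by
    rw [h, comp_apply, adjoint_inner_left]
  rw [sub_apply, h0, zero_sub, inner_neg_left, comp_apply, adjoint_inner_left,
    inner_self_eq_norm_sq_to_K, inner_self_eq_norm_sq_to_K] at h1
  have h2 : -(‖y η‖ ^ 2) = ‖z η‖ ^ 2 := by exact_mod_cast h1
  have h3 : ‖y η‖ ^ 2 = 0 := by nlinarith [sq_nonneg ‖y η‖, sq_nonneg ‖z η‖]
  have h4 : y η = 0 := norm_eq_zero.1 (pow_eq_zero_iff (two_ne_zero) |>.1 h3)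
  rw [hη, map_sub, sub_eq_zero] at h4
  exact h4.symm

/-- The diagonal entries of a linking system form a `C^*`-algebra. -/
def LinkingSystem.diagonal (hX : LinkingSystem X) (i : ι) : StarSubalgebra ℂ (H i →L[ℂ] H i) where
  carrier := X i i
  mul_mem' hS hT := hX.comp_mem hS hT
  add_mem' hS hT := (X i i).add_mem hS hT
  algebraMap_mem' r := by
    rw [Algebra.algebraMap_eq_smul_one]
    exact (X i i).smul_mem r (hX.one_mem i)
  star_mem' hT := hX.adjoint_mem hT

/-- The embedding of a diagonal entry as a corner of the linking algebra. -/
noncomputable def LinkingSystem.corner (hX : LinkingSystem X) {i : ι} {A : Type*} [CStarAlgebra A]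
    (φ : A →⋆ₐ[ℂ] (H i →L[ℂ] H i)) (hφ : ∀ a, φ a ∈ X i i) : A →⋆ₙₐ[ℂ] hX.algebra where
  toFun a := ⟨hilbertIncl H i ∘L φ a ∘L hilbertProj H i, hX.corner_mem (hφ a)⟩
  map_smul' r a := Subtype.ext <| by
    simp only [map_smul, smul_comp, comp_smul]
    rfl
  map_zero' := Subtype.ext <| by simp
  map_add' a b := Subtype.ext <| by
    simp only [map_add, add_comp, comp_add]
    rfl
  map_mul' a b := Subtype.ext <| by
    have h : hilbertIncl H i ∘L (φ a * φ b) ∘L hilbertProj H i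
        = hilbertIncl H i ∘L φ a ∘L (1 : H i →L[ℂ] H i) ∘L φ b ∘L hilbertProj H i := rfl
    simp only [map_mul]
    rw [h, ← hilbertProj_comp_hilbertIncl]
    rfl
  map_star' a := Subtype.ext <| by
    change _ = adjoint (hilbertIncl H i ∘L φ a ∘L hilbertProj H i)
    rw [adjoint_comp, adjoint_comp, adjoint_hilbertIncl, adjoint_hilbertProj]
    simp only [map_star]
    rfl

theorem LinkingSystem.coe_corner (hX : LinkingSystem X) {i : ι} {A : Type*} [CStarAlgebra A]
    (φ : A →⋆ₐ[ℂ] (H i →L[ℂ] H i)) (hφ : ∀ a, φ a ∈ X i i) (a : A) :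
    (hX.corner φ hφ a : PiLp 2 H →L[ℂ] PiLp 2 H) = hilbertIncl H i ∘L φ a ∘L hilbertProj H i := rfl

theorem LinkingSystem.corner_injective (hX : LinkingSystem X) {i : ι} {A : Type*} [CStarAlgebra A]
    (φ : A →⋆ₐ[ℂ] (H i →L[ℂ] H i)) (hφ : ∀ a, φ a ∈ X i i) (hinj : Function.Injective φ) :
    Function.Injective (hX.corner φ hφ) := by
  intro a b hab
  refine hinj ?_
  have h : ∀ a, φ a = hilbertProj H i ∘L (hX.corner φ hφ a).1 ∘L hilbertIncl H i := fun a => by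
    rw [hX.coe_corner]
    have : hilbertProj H i ∘L (hilbertIncl H i ∘L φ a ∘L hilbertProj H i) ∘L hilbertIncl H i
        = (hilbertProj H i ∘L hilbertIncl H i) ∘L φ a ∘L (hilbertProj H i ∘L hilbertIncl H i) := rfl
    rw [this, hilbertProj_comp_hilbertIncl]
    rfl
  rw [h a, h b, hab]

theorem LinkingSystem.mem_range_corner (hX : LinkingSystem X) {i : ι} {A : Type*} [CStarAlgebra A]
    (φ : A →⋆ₐ[ℂ] (H i →L[ℂ] H i)) (hφ : ∀ a, φ a ∈ X i i)
    (hr : (X i i : Set (H i →L[ℂ] H i)) ⊆ Set.range φ) {T : H i →L[ℂ] H i} (hT : T ∈ X i i) :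
    (⟨hilbertIncl H i ∘L T ∘L hilbertProj H i, hX.corner_mem hT⟩ : hX.algebra)
      ∈ Set.range (hX.corner φ hφ) := by
  obtain ⟨a, rfl⟩ := hr hT
  exact ⟨a, rfl⟩

theorem LinkingSystem.isHereditary_corner (hX : LinkingSystem X) {i : ι} {A : Type*} [CStarAlgebra A]
    (φ : A →⋆ₐ[ℂ] (H i →L[ℂ] H i)) (hφ : ∀ a, φ a ∈ X i i)
    (hr : (X i i : Set (H i →L[ℂ] H i)) ⊆ Set.range φ) :
    IsHereditary (Set.range (hX.corner φ hφ)) := by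
  rintro _ ⟨a, rfl⟩ c - ⟨y, hy⟩ ⟨z, hz⟩
  set e : PiLp 2 H →L[ℂ] PiLp 2 H := hilbertIncl H i ∘L hilbertProj H i with he
  have he_adj : adjoint e = e := by
    rw [he, adjoint_comp, adjoint_hilbertIncl, adjoint_hilbertProj]
  have hae : (hilbertIncl H i ∘L φ a ∘L hilbertProj H i) ∘L e
      = hilbertIncl H i ∘L φ a ∘L hilbertProj H i := by
    have h1 : (hilbertIncl H i ∘L φ a ∘L hilbertProj H i) ∘L e
      = hilbertIncl H i ∘L φ a ∘L (hilbertProj H i ∘L hilbertIncl H i) ∘L hilbertProj H i := rfl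
    rw [h1, hilbertProj_comp_hilbertIncl]
    rfl
  have hy' : c.1 = adjoint y.1 ∘L y.1 := congrArg Subtype.val hy
  have hz' : (hilbertIncl H i ∘L φ a ∘L hilbertProj H i) - c.1 = adjoint z.1 ∘L z.1 :=
    congrArg Subtype.val hz
  have hye : y.1 ∘L e = y.1 := comp_eq_of_sub_eq_adjoint_comp hae (hy' ▸ hz')
  have hc : (c : PiLp 2 H →L[ℂ] PiLp 2 H) = e ∘L c.1 ∘L e := by
    conv_lhs => rw [hy', ← hye, adjoint_comp, he_adj]
    rw [hy']
    rfl
  have h1 := hX.mem_range_corner φ hφ hr (c.2 i i)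
  convert h1 using 1
  exact Subtype.ext hc

/-- The hypothesis says that b = ∑ y* y is at least 1 / C, hence invertible. The inverse lies in the
closed diagonal `*`-algebra by spectral permanence. -/
theorem LinkingSystem.exists_sum_comp_eq_one (hX : LinkingSystem X) {i j : ι}
    (h : ∃ C : ℝ, ∃ Y : List (H j →L[ℂ] H i), 0 < C ∧ (∀ y ∈ Y, y ∈ X i j) ∧
      ∀ ξ, ‖ξ‖ ^ 2 ≤ C * (Y.map fun y => ‖y ξ‖ ^ 2).sum) :
    ∃ Y : List (H j →L[ℂ] H i), (∀ y ∈ Y, y ∈ X i j) ∧ ∃ c ∈ X j j,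
      (Y.map fun y => (c ∘L adjoint y) ∘L y).sum = 1 := by
  obtain ⟨C, Y, hC, hY, hle⟩ := h
  refine ⟨Y, hY, ?_⟩
  have hmem : ∀ Z : List (H j →L[ℂ] H i), (∀ y ∈ Z, y ∈ X i j) →
      (Z.map fun y => adjoint y ∘L y).sum ∈ hX.diagonal j := fun Z hZ => by
    refine list_sum_mem fun T hT => ?_
    obtain ⟨y, hy, rfl⟩ := List.mem_map.1 hT
    exact hX.comp_mem (hX.adjoint_mem (hZ y hy)) (hZ y hy)
  have hin : ∀ (Z : List (H j →L[ℂ] H i)) (ξ : H j), ⟪(Z.map fun y => adjoint y ∘L y).sum ξ, ξ⟫_ℂ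
      = ((Z.map fun y => ‖y ξ‖ ^ 2).sum : ℝ) := fun Z ξ => by
    induction Z with
    | nil => simp
    | cons y Z ih =>
      rw [List.map_cons, List.sum_cons, List.map_cons, List.sum_cons, add_apply, inner_add_left, ih,
        comp_apply, adjoint_inner_left, inner_self_eq_norm_sq_to_K]
      push_cast
      rfl
  set b := (Y.map fun y => adjoint y ∘L y).sum with hb
  have hu : IsUnit b := by
    refine isUnit_of_forall_le_norm_inner_map b (c := ⟨C⁻¹, inv_nonneg.2 hC.le⟩) ?_ fun ξ => ?_
    · exact_mod_cast inv_pos.2 hC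
    · rw [hin, Complex.norm_real]
      refine le_trans ?_ (le_abs_self _)
      change ‖ξ‖ ^ 2 * C⁻¹ ≤ _
      rw [← div_eq_mul_inv, div_le_iff₀' hC]
      exact hle ξ
  have hu' : IsUnit (⟨b, hmem Y hY⟩ : hX.diagonal j) :=
    (StarSubalgebra.coe_isUnit (hS := hX.closed j j)).1 hu
  obtain ⟨c, hc⟩ := hu'.exists_left_inv
  refine ⟨c.1, c.2, ?_⟩
  have h1 : c.1 * b = 1 := congrArg Subtype.val hc
  rw [← h1, hb, ← List.sum_map_mul_left]
  rfl

/-- With 1 = ∑ c y* y every block S = ∑ (c y*) (y S) factors through the summand i. The span of the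
products is then the whole algebra, not only dense. -/
theorem LinkingSystem.isFull_corner (hX : LinkingSystem X) {i : ι} {A : Type*} [CStarAlgebra A]
    (φ : A →⋆ₐ[ℂ] (H i →L[ℂ] H i)) (hφ : ∀ a, φ a ∈ X i i)
    (h : ∀ j, ∃ C : ℝ, ∃ Y : List (H j →L[ℂ] H i), 0 < C ∧ (∀ y ∈ Y, y ∈ X i j) ∧
      ∀ ξ, ‖ξ‖ ^ 2 ≤ C * (Y.map fun y => ‖y ξ‖ ^ 2).sum) :
    IsFull (Set.range (hX.corner φ hφ)) := by
  set M := Submodule.span ℂ {c : hX.algebra | ∃ x y : hX.algebra,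
    ∃ a ∈ Set.range (hX.corner φ hφ), c = x * a * y} with hM
  suffices hall : ∀ T, T ∈ M by
    intro T
    exact subset_closure (hall T)
  intro T
  have hgen : ∀ {j l} (W : H i →L[ℂ] H j) (V : H l →L[ℂ] H i) (hW : W ∈ X j i) (hV : V ∈ X i l),
      (⟨hilbertIncl H j ∘L (W ∘L V) ∘L hilbertProj H l, hX.corner_mem (hX.comp_mem hW hV)⟩ : hX.algebra)
        ∈ M := fun {j l} W V hW hV => by
    refine Submodule.subset_span ⟨⟨_, hX.corner_mem hW⟩, ⟨_, hX.corner_mem hV⟩, _, ⟨1, rfl⟩, ?_⟩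
    refine Subtype.ext ?_
    have h1 : hilbertIncl H j ∘L (W ∘L V) ∘L hilbertProj H l
        = hilbertIncl H j ∘L W ∘L (1 : H i →L[ℂ] H i) ∘L (1 : H i →L[ℂ] H i) ∘L
          (1 : H i →L[ℂ] H i) ∘L V ∘L hilbertProj H l := rfl
    change hilbertIncl H j ∘L (W ∘L V) ∘L hilbertProj H l =
      (hilbertIncl H j ∘L W ∘L hilbertProj H i) ∘L (hilbertIncl H i ∘L φ 1 ∘L hilbertProj H i) ∘L
        (hilbertIncl H i ∘L V ∘L hilbertProj H l)
    rw [map_one, h1]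
    nth_rewrite 1 3 [← hilbertProj_comp_hilbertIncl]
    rfl
  have hone : ∀ j l (S : H l →L[ℂ] H j) (hS : S ∈ X j l),
      (⟨hilbertIncl H j ∘L S ∘L hilbertProj H l, hX.corner_mem hS⟩ : hX.algebra) ∈ M := by
    intro j l S hS
    obtain ⟨Y, hY, c, hc, hsum⟩ := hX.exists_sum_comp_eq_one (h j)
    have key : ∀ (Z : List (H j →L[ℂ] H i)) (hZ : ∀ y ∈ Z, y ∈ X i j), ∃ m ∈ M,
        (m : PiLp 2 H →L[ℂ] PiLp 2 H) = hilbertIncl H j ∘L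
          ((Z.map fun y => (c ∘L adjoint y) ∘L y).sum ∘L S) ∘L hilbertProj H l := by
      intro Z
      induction Z with
      | nil => exact fun _ => ⟨0, M.zero_mem, by simp⟩
      | cons y Z ih =>
        intro hZ
        obtain ⟨m, hm, hm'⟩ := ih fun z hz => hZ z (List.mem_cons_of_mem _ hz)
        have hy := hZ y List.mem_cons_self
        refine ⟨_, M.add_mem (hgen (c ∘L adjoint y) (y ∘L S) (hX.comp_mem hc (hX.adjoint_mem hy))
          (hX.comp_mem hy hS)) hm, ?_⟩
        rw [List.map_cons, List.sum_cons, add_comp, add_comp, comp_add, ← hm']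
        rfl
    obtain ⟨m, hm, hm'⟩ := key Y hY
    rw [hsum] at hm'
    convert hm using 1
    exact Subtype.ext hm'.symm
  have hT : T = ∑ j, ∑ l, ⟨hilbertIncl H j ∘L (hilbertProj H j ∘L T.1 ∘L hilbertIncl H l) ∘L
      hilbertProj H l, hX.corner_mem (T.2 j l)⟩ := by
    refine Subtype.ext ?_
    rw [AddSubmonoidClass.coe_finsetSum]
    conv_lhs => rw [eq_sum_block T.1]
    refine Finset.sum_congr rfl fun i _ => ?_
    rw [AddSubmonoidClass.coe_finsetSum]
  rw [hT]
  exact M.sum_mem fun j _ => M.sum_mem fun l _ => hone j l _ (T.2 j l)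

theorem stronglyMoritaEquivalent_of_linkingSystem (hX : LinkingSystem X)
    (hsep : ∀ i j, TopologicalSpace.IsSeparable (X i j : Set (H j →L[ℂ] H i)))
    (h : ∀ i j, ∃ C : ℝ, ∃ Y : List (H j →L[ℂ] H i), 0 < C ∧ (∀ y ∈ Y, y ∈ X i j) ∧
      ∀ ξ, ‖ξ‖ ^ 2 ≤ C * (Y.map fun y => ‖y ξ‖ ^ 2).sum)
    {i j : ι} {A B : Type u} [CStarAlgebra A] [CStarAlgebra B]
    (φ : A →⋆ₐ[ℂ] (H i →L[ℂ] H i)) (hφ : Function.Injective φ) (hφr : Set.range φ = X i i)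
    (ψ : B →⋆ₐ[ℂ] (H j →L[ℂ] H j)) (hψ : Function.Injective ψ) (hψr : Set.range ψ = X j j) :
    StronglyMoritaEquivalent A B := by
  have hφm : ∀ a, φ a ∈ X i i := fun a => hφr.subset ⟨a, rfl⟩
  have hψm : ∀ a, ψ a ∈ X j j := fun a => hψr.subset ⟨a, rfl⟩
  exact ⟨hX.algebra, inferInstance, hX.corner φ hφm, hX.corner ψ hψm, hX.separableSpace hsep,
    hX.corner_injective φ hφm hφ, hX.isHereditary_corner φ hφm hφr.superset, hX.isFull_corner φ hφm (h i),
    hX.corner_injective ψ hψm hψ, hX.isHereditary_corner ψ hψm hψr.superset, hX.isFull_corner ψ hψm (h j)⟩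

end LinkingAlgebra

/-! ### The operators of left multiplication on a column. -/

namespace FactorPlanarAlgebra

variable {P : FactorPlanarAlgebra.{u}}
open PlanarAlgebra

namespace Bim

variable {i j l r s t : ℕ}

theorem idn_mul (ξ : P.Bim j s) : mul j j s (of 0 rfl (P.idn j)) ξ = ξ := by
  induction ξ using induction with
  | h0 => simp
  | h1 N v => rw [mul_of (K := N) (by omega) _ _ rfl, idn_contract]
  | h2 y z hy hz => rw [map_add, hy, hz]

theorem act_idn_epi (ξ : P.Bim j s) : ‖Tot.act rfl (P.idn j) (epi ξ)‖ = ‖ξ‖ := by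
  rw [← epi_mul_zero (m := j + j) rfl, idn_mul, norm_epi]

/-- If the identity is dominated, then the norm of a left multiplication can be computed on one column. -/
theorem norm_mul_le_of_dominated (hd : Dominated t (P.idn j)) (a : P.Bim i j) {N : ℝ} (hN : 0 ≤ N)
    (h : ∀ y : P.Bim j t, ‖mul i j t a y‖ ≤ N * ‖y‖) (ξ : P.Bim j s) :
    ‖mul i j s a ξ‖ ≤ N * ‖ξ‖ := by
  let T (s : ℕ) (y : P.Bim j s) : P.Bim j s := mul j i s (adj a) (mul i j s a y)
  have hT : ∀ x y : P.Bim j s, ⟪T s x, y⟫_ℂ = ⟪x, T s y⟫_ℂ := fun x y => by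
    simp only [T]
    rw [inner_mul_left, adj_adj, inner_mul_left]
  have hT' : ∀ y : P.Bim j t, ‖T t y‖ ≤ N ^ 2 * ‖y‖ := fun y => by
    have h1 : ‖T t y‖ ≤ N * ‖mul i j t a y‖ := Tot.norm_adjoint_le (T := mul i j t a)
      (T' := mul j i t (adj a)) (fun _ _ => inner_mul_left ..) hN h _
    refine h1.trans ?_
    rw [pow_two, mul_assoc]
    exact mul_le_mul_of_nonneg_left (h y) hN
  have hiter : ∀ (n : ℕ) (z : P.Bim j t), ‖(T t)^[n] z‖ ≤ (N ^ 2) ^ n * ‖z‖ := fun n z => by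
    induction n with
    | zero => simp
    | succ n ih =>
      rw [Function.iterate_succ_apply', pow_succ' (N ^ 2), mul_assoc]
      exact (hT' _).trans (mul_le_mul_of_nonneg_left ih (by positivity))
  -- For T = a* a the vector y T^n ξ equals (T^n y*)* ξ, where T^n y* lies in column t and its norm
  -- is at most N^{2n} ‖y‖. Domination then bounds ‖T^n ξ‖ on column s, and log-convexity gives ‖T
  -- ξ‖ ≤ N² ‖ξ‖.
  have hmove : ∀ (n : ℕ) (z : P.Bim j t) (ξ : P.Bim j s),
      mul t j s (adj z) ((T s)^[n] ξ) = mul t j s (adj ((T t)^[n] z)) ξ := fun n => by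
    induction n with
    | zero => exact fun _ _ => rfl
    | succ n ih =>
      intro z ξ
      rw [Function.iterate_succ_apply', Function.iterate_succ_apply, ← ih]
      simp only [T]
      rw [adj_mul, adj_mul, adj_adj, mul_mul, mul_mul]
  obtain ⟨C, Y, hC, hY⟩ := hd
  obtain ⟨D, hD, hξ⟩ := exists_norm_mul_le' ξ
  set E := C * (Y.map fun y => (D * ‖y‖) ^ 2).sum with hE
  have hbound : ∀ n, ‖(T s)^[n] ξ‖ ≤ √E * (N ^ 2) ^ n := fun n => by
    refine le_of_sq_le_sq ?_ (by positivity)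
    have hE0 : 0 ≤ E := mul_nonneg hC (List.sum_nonneg (by
      simp only [List.mem_map]; rintro _ ⟨y, _, rfl⟩; positivity))
    rw [mul_pow, Real.sq_sqrt hE0, hE, mul_assoc, ← List.sum_map_mul_right, ← act_idn_epi]
    refine (hY _).trans (mul_le_mul_of_nonneg_left (List.sum_le_sum fun y _ => ?_) hC)
    rw [← mul_pow, ← adj_adj y, hmove, mul_assoc]
    refine pow_le_pow_left₀ (norm_nonneg _) ((hξ _).trans (mul_le_mul_of_nonneg_left ?_ hD)) 2
    rw [norm_adj, norm_adj, mul_comm]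
    exact hiter n _
  have key : ‖T s ξ‖ ≤ N ^ 2 * ‖ξ‖ :=
    norm_apply_le_of_iterate_le (T s) hT (by positivity) hbound
  refine le_of_sq_le_sq ?_ (by positivity)
  rw [mul_pow, ← inner_self_eq_norm_sq (𝕜 := ℂ), inner_mul_left]
  refine (Complex.re_le_norm _).trans ((norm_inner_le_norm _ _).trans ?_)
  nlinarith [norm_nonneg ξ]

/-- The Hilbert space completion of the bimodule. -/
abbrev L2 (P : FactorPlanarAlgebra.{u}) (j s : ℕ) : Type u := UniformSpace.Completion (P.Bim j s)

/-- Left multiplication as a bounded operator. -/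
noncomputable def mulL (s : ℕ) (x : P.Bim i j) : P.Bim j s →L[ℂ] P.Bim i s :=
  (mul i j s x).mkContinuousOfExistsBound ((exists_norm_mul_le x).imp fun _ h => h.2)

/-- Left multiplication on the completions. -/
noncomputable def op (s : ℕ) (x : P.Bim i j) : L2 P j s →L[ℂ] L2 P i s := (mulL s x).completion

theorem op_coe (x : P.Bim i j) (y : P.Bim j s) : op s x (y : L2 P j s) = (mul i j s x y : P.Bim i s) :=
  (mulL s x).completion_apply_coe y

theorem clm_ext {W : Type*} [NormedAddCommGroup W] [NormedSpace ℂ W] {f g : L2 P j s →L[ℂ] W}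
    (h : ∀ y : P.Bim j s, f y = g y) : f = g :=
  ContinuousLinearMap.ext fun x => congrFun
    (UniformSpace.Completion.ext f.continuous g.continuous h) x

variable (P i j) in
/-- Left multiplication, as a linear map in the multiplier. -/
noncomputable def opHom (s : ℕ) : P.Bim i j →ₗ[ℂ] L2 P j s →L[ℂ] L2 P i s where
  toFun := op s
  map_add' x y := clm_ext fun z => by
    rw [add_apply, op_coe, op_coe, op_coe, map_add, LinearMap.add_apply,
      UniformSpace.Completion.coe_add]
  map_smul' c x := clm_ext fun z => by
    rw [smul_apply, op_coe, RingHom.id_apply, op_coe, map_smul,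
      LinearMap.smul_apply, UniformSpace.Completion.coe_smul]

theorem opHom_coe (x : P.Bim i j) (y : P.Bim j s) :
    opHom P i j s x (y : L2 P j s) = (mul i j s x y : P.Bim i s) := op_coe x y

theorem opHom_mul (x : P.Bim i j) (y : P.Bim j l) :
    opHom P i l s (mul i j l x y) = opHom P i j s x ∘L opHom P j l s y := clm_ext fun z => by
  rw [ContinuousLinearMap.comp_apply, opHom_coe, opHom_coe, opHom_coe, mul_mul]

theorem opHom_idn : opHom P j j s (of 0 rfl (P.idn j)) = 1 := clm_ext fun z => by
  rw [opHom_coe, idn_mul]; rfl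

theorem opHom_adj (x : P.Bim i j) :
    opHom P j i s (adj x) = ContinuousLinearMap.adjoint (opHom P i j s x) := by
  rw [ContinuousLinearMap.eq_adjoint_iff]
  intro y z
  induction y, z using UniformSpace.Completion.induction_on₂ with
  | hp => exact isClosed_eq (by fun_prop) (by fun_prop)
  | ih y z =>
    rw [opHom_coe, opHom_coe, UniformSpace.Completion.inner_coe, UniformSpace.Completion.inner_coe,
      inner_mul_left, adj_adj]

theorem norm_opHom_le_iff {x : P.Bim i j} {N : ℝ} (hN : 0 ≤ N) :
    ‖opHom P i j s x‖ ≤ N ↔ ∀ y : P.Bim j s, ‖mul i j s x y‖ ≤ N * ‖y‖ := by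
  refine ⟨fun h y => ?_, fun h => ContinuousLinearMap.opNorm_le_bound _ hN fun y => ?_⟩
  · have := (opHom P i j s x).le_of_opNorm_le h (y : L2 P j s)
    rwa [opHom_coe, UniformSpace.Completion.norm_coe, UniformSpace.Completion.norm_coe] at this
  · induction y using UniformSpace.Completion.induction_on with
    | hp => exact isClosed_le (by fun_prop) (by fun_prop)
    | ih y =>
      rw [opHom_coe, UniformSpace.Completion.norm_coe, UniformSpace.Completion.norm_coe]
      exact h y

theorem norm_opHom_le_of_dominated (hd : Dominated t (P.idn j)) (x : P.Bim i j) :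
    ‖opHom P i j s x‖ ≤ ‖opHom P i j t x‖ := by
  have h := (norm_opHom_le_iff (s := t) (x := x) (norm_nonneg (opHom P i j t x))).1 le_rfl
  exact (norm_opHom_le_iff (norm_nonneg _)).2 (norm_mul_le_of_dominated hd x (norm_nonneg _) h)

/-- The closed operator spaces generated by the graded bimodules. -/
noncomputable def opSpace (P : FactorPlanarAlgebra.{u}) (i j s : ℕ) :
    Submodule ℂ (L2 P j s →L[ℂ] L2 P i s) :=
  (LinearMap.range (opHom P i j s)).topologicalClosure

theorem coe_opSpace : (opSpace P i j s : Set (L2 P j s →L[ℂ] L2 P i s))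
    = closure (Set.range (opHom P i j s)) := by
  rw [opSpace, Submodule.topologicalClosure_coe]
  rfl

theorem opHom_mem (x : P.Bim i j) : opHom P i j s x ∈ opSpace P i j s :=
  Submodule.le_topologicalClosure _ ⟨x, rfl⟩

theorem linkingSystem_opSpace {ι : Type} (κ : ι → ℕ) (s : ℕ) :
    LinkingSystem (H := fun a => L2 P (κ a) s) (fun a b => opSpace P (κ a) (κ b) s) where
  closed a b := Submodule.isClosed_topologicalClosure _
  one_mem a := by rw [← opHom_idn]; exact opHom_mem _
  comp_mem {a b c} S T hS hT := by
    have hcont : Continuous fun p : (L2 P (κ b) s →L[ℂ] L2 P (κ a) s) ×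
        (L2 P (κ c) s →L[ℂ] L2 P (κ b) s) => p.1 ∘L p.2 := by fun_prop
    rw [← SetLike.mem_coe, coe_opSpace] at hS hT ⊢
    refine map_mem_closure₂ hcont hS hT ?_
    rintro _ ⟨x, rfl⟩ _ ⟨y, rfl⟩
    exact ⟨_, opHom_mul x y⟩
  adjoint_mem {a b} T hT := by
    rw [← SetLike.mem_coe, coe_opSpace] at hT ⊢
    refine map_mem_closure ContinuousLinearMap.adjoint.continuous hT ?_
    rintro _ ⟨x, rfl⟩
    exact ⟨_, opHom_adj x⟩

theorem isSeparable_opSpace :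
    TopologicalSpace.IsSeparable (opSpace P i j s : Set (L2 P j s →L[ℂ] L2 P i s)) := by
  rw [coe_opSpace]
  refine TopologicalSpace.IsSeparable.closure ?_
  have hsub : Set.range (opHom P i j s) ⊆ Submodule.span ℂ
      (⋃ N : ℕ, Set.range fun a => opHom P i j s (of N rfl (Module.finBasis ℂ (P.V (i + N + j)) a))) := by
    rintro _ ⟨x, rfl⟩
    induction x using induction with
    | h0 => simp
    | h2 x y hx hy => rw [map_add]; exact Submodule.add_mem _ hx hy
    | h1 N v =>
      rw [← (Module.finBasis ℂ (P.V (i + N + j))).sum_repr v, map_sum, map_sum]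
      refine Submodule.sum_mem _ fun a _ => ?_
      rw [map_smul, map_smul]
      exact Submodule.smul_mem _ _ (Submodule.subset_span (Set.mem_iUnion.2 ⟨N, a, rfl⟩))
  refine TopologicalSpace.IsSeparable.mono ?_ hsub
  exact TopologicalSpace.IsSeparable.span
    (Set.countable_iUnion fun N => Set.countable_range _).isSeparable

theorem exists_norm_sq_le_of_dominated (hd : Dominated i (P.idn j)) (s : ℕ) :
    ∃ C : ℝ, ∃ Y : List (L2 P j s →L[ℂ] L2 P i s), 0 < C ∧ (∀ y ∈ Y, y ∈ opSpace P i j s) ∧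
      ∀ ξ, ‖ξ‖ ^ 2 ≤ C * (Y.map fun y => ‖y ξ‖ ^ 2).sum := by
  obtain ⟨C, Y, hC, hY⟩ := hd
  -- C is only nonnegative, whereas a strictly positive constant is required.
  refine ⟨C + 1, Y.map (opHom P i j s), by linarith, ?_, fun ξ => ?_⟩
  · simp only [List.mem_map]
    rintro _ ⟨y, _, rfl⟩
    exact opHom_mem y
  · rw [List.map_map]
    induction ξ using UniformSpace.Completion.induction_on with
    | hp =>
      refine isClosed_le (by fun_prop) (continuous_const.mul ?_)
      refine continuous_list_sum _ fun y _ => ?_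
      simp only [Function.comp_apply]
      fun_prop
    | ih ξ =>
      have h1 := hY ξ
      rw [act_idn_epi] at h1
      simp only [Function.comp_def, opHom_coe, UniformSpace.Completion.norm_coe]
      have := sum_norm_sq_nonneg Y ξ
      nlinarith

end Bim

end FactorPlanarAlgebra

/-! ### The algebra A_k as a diagonal block. -/

namespace FactorPlanarAlgebra

variable {P : FactorPlanarAlgebra.{u}}
open PlanarAlgebra

variable {k : ℕ}

/-- The graded algebra as a bimodule. -/
noncomputable def grBim (P : FactorPlanarAlgebra.{u}) (k : ℕ) : P.Gr k ≃ₗ[ℂ] P.Bim k k :=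
  LinearEquiv.refl ℂ (DirectSum ℕ fun N => P.V (k + N + k))

theorem grBim_ofGr (N : ℕ) (x : P.V (k + N + k)) :
    P.grBim k (P.ofGr k N x) = Bim.of N rfl x := rfl

theorem grBim_mul (x y : P.Gr k) :
    P.grBim k (P.grMul k x y) = Bim.mul k k k (P.grBim k x) (P.grBim k y) := by
  induction x using gr_induction with
  | h0 => simp
  | h2 x x' hx hx' => simp only [map_add, LinearMap.add_apply, hx, hx']
  | h1 N x =>
    induction y using gr_induction with
    | h0 => simp
    | h2 y y' hy hy' => simp only [map_add, hy, hy']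
    | h1 M y =>
      rw [grMul_ofGr, grBim_ofGr, grBim_ofGr, grBim_ofGr, Bim.mul_of (K := N + M) rfl _ _ rfl]

theorem grBim_star (x : P.Gr k) : P.grBim k (P.grStar k x) = Bim.adj (P.grBim k x) := by
  induction x using gr_induction with
  | h0 => simp
  | h2 x x' hx hx' => simp only [map_add, hx, hx']
  | h1 N x => rw [grStar_ofGr, grBim_ofGr, grBim_ofGr, Bim.adj_of _ rfl]

theorem epi_eq_comp (t : ℕ) (x : P.Gr k) :
    P.epi k t x = Tot.comp t rfl (Bim.epi (P.grBim k x)) := by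
  induction x using gr_induction with
  | h0 => simp
  | h2 x x' hx hx' => simp only [map_add, hx, hx']
  | h1 N x => rw [grBim_ofGr, Bim.comp_epi_of, epi, liftGr_ofGr]

theorem inner_gr_eq (x y : P.Gr k) :
    ⟪x, y⟫_ℂ = ((P.delta : ℂ) ^ k)⁻¹ * ⟪P.grBim k x, P.grBim k y⟫_ℂ := by
  obtain ⟨K₁, h₁⟩ := P.tau_star_mul k x y
  obtain ⟨K₂, h₂⟩ := Tot.exists_fockInner_eq_sum (Bim.epi (P.grBim k x)) (Bim.epi (P.grBim k y))
  have h : ⟪x, y⟫_ℂ = P.tau k (P.grMul k (P.grStar k x) y) := rfl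
  rw [h, h₁ _ (le_max_left K₁ K₂), Bim.inner_eq, Tot.inner_eq, h₂ _ (le_max_right K₁ K₂)]
  simp only [epi_eq_comp]
  rfl

theorem norm_gr_eq (hδ : 1 < P.delta) (x : P.Gr k) :
    ‖x‖ = √((P.delta ^ k)⁻¹) * ‖P.grBim k x‖ := by
  rw [@norm_eq_sqrt_re_inner ℂ, @norm_eq_sqrt_re_inner ℂ _ _ _ _ (P.grBim k x), inner_gr_eq,
    ← Real.sqrt_mul (by positivity)]
  congr 1
  rw [← Complex.ofReal_pow, ← Complex.ofReal_inv]
  exact Complex.re_ofReal_mul _ _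

/-- The forms on `Gr` and `Bim` differ by the factor δ^{-k}, which does not affect operator norms.
-/
theorem norm_grMul_le_iff (hδ : 1 < P.delta) {x : P.Gr k} {N : ℝ} :
    (∀ y, ‖P.grMul k x y‖ ≤ N * ‖y‖) ↔
      ∀ y, ‖Bim.mul k k k (P.grBim k x) y‖ ≤ N * ‖y‖ := by
  have hc : 0 < √((P.delta ^ k)⁻¹) := Real.sqrt_pos.2 (by positivity)
  rw [(P.grBim k).surjective.forall]
  refine forall_congr' fun y => ?_
  rw [norm_gr_eq hδ, norm_gr_eq hδ, grBim_mul, mul_left_comm, mul_le_mul_iff_right₀ hc]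

/-- Left multiplication on the graded algebra, as a bounded operator. -/
noncomputable def grMulL (hδ : 1 < P.delta) (x : P.Gr k) : P.Gr k →L[ℂ] P.Gr k :=
  (P.grMul k x).mkContinuousOfExistsBound
    ((Bim.exists_norm_mul_le (P.grBim k x)).imp fun _ h => (norm_grMul_le_iff hδ).2 h.2)

theorem gr_clm_ext {W : Type*} [NormedAddCommGroup W] [NormedSpace ℂ W] {f g : P.L2 k →L[ℂ] W}
    (h : ∀ y : P.Gr k, f y = g y) : f = g :=
  ContinuousLinearMap.ext fun x => congrFun
    (UniformSpace.Completion.ext f.continuous g.continuous h) x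

/-- The left action of the graded algebra on its `L²`-space. -/
noncomputable def grHom (hδ : 1 < P.delta) (k : ℕ) : P.Gr k →ₗ[ℂ] P.L2 k →L[ℂ] P.L2 k where
  toFun x := (grMulL hδ x).completion
  map_add' x y := gr_clm_ext fun z => by
    rw [add_apply, ContinuousLinearMap.completion_apply_coe, ContinuousLinearMap.completion_apply_coe,
      ContinuousLinearMap.completion_apply_coe, ← UniformSpace.Completion.coe_add]
    exact congrArg _ (LinearMap.congr_fun ((P.grMul k).map_add x y) z)
  map_smul' c x := gr_clm_ext fun z => by
    rw [smul_apply, RingHom.id_apply, ContinuousLinearMap.completion_apply_coe,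
      ContinuousLinearMap.completion_apply_coe, ← UniformSpace.Completion.coe_smul]
    exact congrArg _ (LinearMap.congr_fun ((P.grMul k).map_smul c x) z)

theorem grHom_coe (hδ : 1 < P.delta) (x y : P.Gr k) :
    grHom hδ k x (y : P.L2 k) = (P.grMul k x y : P.Gr k) :=
  (grMulL hδ x).completion_apply_coe y

theorem grHom_mul (hδ : 1 < P.delta) (x y : P.Gr k) :
    grHom hδ k (P.grMul k x y) = grHom hδ k x * grHom hδ k y := gr_clm_ext fun z => by
  rw [mul_apply_eq_comp, grHom_coe, grHom_coe, grHom_coe]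
  congr 1
  apply (P.grBim k).injective
  rw [grBim_mul, grBim_mul, grBim_mul, grBim_mul, Bim.mul_mul]

theorem grHom_one (hδ : 1 < P.delta) :
    grHom hδ k ((P.grBim k).symm (Bim.of 0 rfl (P.idn k))) = 1 := gr_clm_ext fun z => by
  rw [grHom_coe]
  change _ = (z : P.L2 k)
  congr 1
  apply (P.grBim k).injective
  rw [grBim_mul, LinearEquiv.apply_symm_apply, Bim.idn_mul]

theorem grHom_star (hδ : 1 < P.delta) (x : P.Gr k) :
    grHom hδ k (P.grStar k x) = star (grHom hδ k x) := by
  rw [ContinuousLinearMap.star_eq_adjoint, ContinuousLinearMap.eq_adjoint_iff]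
  intro y z
  induction y, z using UniformSpace.Completion.induction_on₂ with
  | hp => exact isClosed_eq (by fun_prop) (by fun_prop)
  | ih y z =>
    rw [grHom_coe, grHom_coe, UniformSpace.Completion.inner_coe, UniformSpace.Completion.inner_coe,
      inner_gr_eq, inner_gr_eq, grBim_mul, grBim_mul, Bim.inner_mul_left, grBim_star, Bim.adj_adj]

theorem norm_grHom (hδ : 1 < P.delta) (x : P.Gr k) :
    ‖grHom hδ k x‖ = ‖Bim.opHom P k k k (P.grBim k x)‖ := by
  refine le_antisymm ?_ ?_
  · refine ContinuousLinearMap.opNorm_le_bound _ (norm_nonneg _) fun y => ?_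
    induction y using UniformSpace.Completion.induction_on with
    | hp => exact isClosed_le (by fun_prop) (by fun_prop)
    | ih y =>
      rw [grHom_coe, UniformSpace.Completion.norm_coe, UniformSpace.Completion.norm_coe]
      exact (norm_grMul_le_iff hδ).2 ((Bim.norm_opHom_le_iff (norm_nonneg _)).1 le_rfl) y
  · refine (Bim.norm_opHom_le_iff (norm_nonneg _)).2 ((norm_grMul_le_iff hδ).1 fun y => ?_)
    have := (grHom hδ k x).le_opNorm (y : P.L2 k)
    rwa [grHom_coe, UniformSpace.Completion.norm_coe, UniformSpace.Completion.norm_coe] at this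

/-- A_k is defined on column k. One inequality comes from domination by m, the other from the
trivial domination of level k by itself; so column m carries a faithful representation of A_k. -/
theorem norm_grHom_eq_of_dominated (hδ : 1 < P.delta) {m : ℕ} (hd : Dominated m (P.idn k))
    (x : P.Gr k) : ‖grHom hδ k x‖ = ‖Bim.opHom P k k m (P.grBim k x)‖ := by
  rw [norm_grHom]
  exact le_antisymm (Bim.norm_opHom_le_of_dominated hd _)
    (Bim.norm_opHom_le_of_dominated (dominated_idn k) _)

/-- The graded algebra, acting on its `L²`-space and on the column with `m` strings on the right. -/
noncomputable def grPair (hδ : 1 < P.delta) (k m : ℕ) :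
    StarSubalgebra ℂ ((P.L2 k →L[ℂ] P.L2 k) × (Bim.L2 P k m →L[ℂ] Bim.L2 P k m)) where
  carrier := Set.range fun x => (grHom hδ k x, Bim.opHom P k k m (P.grBim k x))
  mul_mem' := by
    rintro _ _ ⟨x, rfl⟩ ⟨y, rfl⟩
    exact ⟨P.grMul k x y, Prod.ext (grHom_mul hδ x y)
      ((congrArg _ (grBim_mul x y)).trans (Bim.opHom_mul _ _))⟩
  add_mem' := by
    rintro _ _ ⟨x, rfl⟩ ⟨y, rfl⟩
    exact ⟨x + y, by simp⟩
  algebraMap_mem' c := ⟨c • (P.grBim k).symm (Bim.of 0 rfl (P.idn k)), by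
    simp only [map_smul, grHom_one, LinearEquiv.apply_symm_apply, Bim.opHom_idn,
      Algebra.algebraMap_eq_smul_one]
    rfl⟩
  star_mem' := by
    rintro _ ⟨x, rfl⟩
    exact ⟨P.grStar k x, Prod.ext (grHom_star hδ x)
      ((congrArg _ (grBim_star x)).trans (Bim.opHom_adj _))⟩

/-- The left multiplications already form a unital `*`-algebra, and an operator is determined by its
values on the dense subspace, so generating a `*`-algebra adds nothing. -/
theorem coe_gjs (hδ : 1 < P.delta) (k m : ℕ) :
    (P.gjs k : Set (P.L2 k →L[ℂ] P.L2 k)) = closure (Prod.fst '' (grPair hδ k m).carrier) := by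
  rw [gjs, StarSubalgebra.topologicalClosure_coe]
  congr 1
  let S : StarSubalgebra ℂ (P.L2 k →L[ℂ] P.L2 k) := (grPair hδ k m).map (StarAlgHom.fst ℂ _ _)
  have hS : (S : Set (P.L2 k →L[ℂ] P.L2 k)) = Prod.fst '' (grPair hδ k m).carrier := rfl
  rw [← hS, SetLike.coe_set_eq]
  refine le_antisymm (StarAlgebra.adjoin_le ?_) ?_
  · rintro T ⟨x, hx⟩
    refine ⟨_, ⟨x, rfl⟩, ?_⟩
    exact gr_clm_ext fun y => (grHom_coe hδ x y).trans (hx y).symm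
  · rintro _ ⟨_, ⟨x, rfl⟩, rfl⟩
    exact StarAlgebra.subset_adjoin _ _ ⟨x, grHom_coe hδ x⟩

theorem exists_starAlgHom_gjs (hδ : 1 < P.delta) {m : ℕ} (hd : Dominated m (P.idn k)) :
    ∃ φ : P.GJSAlgebra k →⋆ₐ[ℂ] (Bim.L2 P k m →L[ℂ] Bim.L2 P k m), Function.Injective φ ∧
      Set.range φ = Bim.opSpace P k k m := by
  obtain ⟨φ, hφ, hr⟩ := exists_starAlgHom_of_norm_eq (grPair hδ k m) (by
    rintro _ ⟨x, rfl⟩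
    exact norm_grHom_eq_of_dominated hδ hd x) (P.gjs k) (coe_gjs hδ k m)
  refine ⟨φ, hφ, hr.trans ?_⟩
  rw [Bim.coe_opSpace]
  congr 1
  ext T
  constructor
  · rintro ⟨_, ⟨x, rfl⟩, rfl⟩
    exact ⟨P.grBim k x, rfl⟩
  · rintro ⟨x, rfl⟩
    exact ⟨_, ⟨(P.grBim k).symm x, rfl⟩, congrArg (Bim.opHom P k k m) ((P.grBim k).apply_symm_apply x)⟩

end FactorPlanarAlgebra

theorem mainTheorem9 (P : FactorPlanarAlgebra.{u}) (hδ : 1 < P.delta) (n : ℕ) (hn : 1 ≤ n)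
    (hdepth : P.depth = n) (k : ℕ) (hk : n - 1 ≤ k) :
    StronglyMoritaEquivalent (P.GJSAlgebra (n - 1)) (P.GJSAlgebra k) := by
  obtain ⟨m, rfl⟩ : ∃ m, n = m + 1 := ⟨n - 1, by omega⟩
  rw [Nat.add_sub_cancel] at hk ⊢
  have hd : FactorPlanarAlgebra.Dominated m (P.idn k) :=
    FactorPlanarAlgebra.dominated_idn_of_depth hδ hdepth k
  obtain ⟨φ, hφ, hφr⟩ := FactorPlanarAlgebra.exists_starAlgHom_gjs hδ
    (FactorPlanarAlgebra.dominated_idn (P := P) m)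
  obtain ⟨ψ, hψ, hψr⟩ := FactorPlanarAlgebra.exists_starAlgHom_gjs hδ hd
  -- Both algebras are represented on column m: `false` is level m and `true` is level k.
  refine stronglyMoritaEquivalent_of_linkingSystem (ι := Bool) (i := false) (j := true)
    (FactorPlanarAlgebra.Bim.linkingSystem_opSpace (fun b => cond b k m) m)
    (fun _ _ => FactorPlanarAlgebra.Bim.isSeparable_opSpace) ?_ φ hφ hφr ψ hψ hψr
  -- Each of the two levels dominates itself and the other; only the domination of level k by level
  -- m uses the depth.
  rintro (_ | _) (_ | _)
  · exact FactorPlanarAlgebra.Bim.exists_norm_sq_le_of_dominated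
      (FactorPlanarAlgebra.dominated_idn m) m
  · exact FactorPlanarAlgebra.Bim.exists_norm_sq_le_of_dominated hd m
  · exact FactorPlanarAlgebra.Bim.exists_norm_sq_le_of_dominated
      (FactorPlanarAlgebra.dominated_idn_of_le hδ hk) m
  · exact FactorPlanarAlgebra.Bim.exists_norm_sq_le_of_dominated
      (FactorPlanarAlgebra.dominated_idn k) m
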